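/- Let $L$ be a discretely (non-trivially) valued non-archimedean field with absolute value $|\cdot|$, uniformizer $\pi$ and residue field $\bar L$. Let $q\in L^\times$ with $|q|=1$, $q\neq q^{-1}$, let $\bar q$ be its residue class, and let $R\in|L|$ with $R>|(q^{-1}-q)^{-1}|$. Let $U_q(\mathfrak b_+)$ be the $L$-algebra generated by $K^{\pm1},E$ with $KE=q^2EK$, and $U_q(\mathfrak b_-)$ the $L$-algebra generated by $K^{\pm1},F$ with $KF=q^{-2}FK$. They are Hopf algebras with $\Delta K=K\otimes K$, $\Delta E=E\otimes K+1\otimes E$, $\Delta F=F\otimes1+K^{-1}\otimes F$, $\epsilon(K)=1$, $\epsilon(E)=\epsilon(F)=0$, $S(K)=K^{-1}$, $S(E)=-EK^{-1}$, $S(F)=-KF$. Let $\sigma=\langle\cdot,\cdot\rangle$ be the dual pairing of $U_q(\mathfrak b_+)$ with $U_q(\mathfrak b_-)^{op}$ determined by $\langle K,K\rangle=q^{-2}$, $\langle K,F\rangle=\langle E,K\rangle=0$, $\langle E,F\rangle=(q^{-1}-q)^{-1}$, and $\bar\sigma(a,b)=\sigma(S(a),b)$ its convolution inverse. The quantum double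 is $U_q(\mathfrak b_-)\otimes U_q(\mathfrak b_+)$ with the product $$(b\otimes a)(b'\otimes a')=\sum b\,b'_{(2)}\,\bar\sigma(a_{(1)},b'_{(1)})\otimes a_{(2)}a'\,\sigma(a_{(3)},b'_{(3)}).$$ Write $E=1\otimes E$, $K=1\otimes K$, $F=F\otimes1$, $K_-=K\otimes 1$ for its generators. Equip it with the tensor product of the Gauss $R$-norms, $\bigl\|\sum a_{ijkl}\,F^iK_-^j\otimes E^kK^l\bigr\|=\max|a_{ijkl}|R^{i+k}$ ($i,k\in\mathbb N$, $j,l\in\mathbb Z$), which is submultiplicative, and let $D=D(U_q(\mathfrak b_+,R),U_q(\mathfrak b_-,R))$ be the completion. For a ring $A$ with a submultiplicative non-archimedean norm let $Gr_\cdot A=\bigoplus_{r>0}\{\|a\|\le r\}/\{\|a\|<r\}$. Then: 1. $D$ is left and right noetherian, and its norm is multiplicative. 2. There is a ring isomorphism $$Gr_\cdot D\;\cong\;\bar L[\bar\pi^{\pm1}]\bigl[\tilde K^{\pm1},\tilde K_-^{\pm1}\bigr]\bigl[\tilde F,\beta_0,0\bigr]\bigl[\tilde E,\beta_1,0\bigr]$$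 onto an iterated skew polynomial ring (with the rule $xa=\beta(a)x$), under which the classes of $E,F$ in degree $R$, of $K,K_-$ in degree $1$, of $\pi$ in degree $|\pi|$ and of $c\in L$, $|c|\le1$, in degree $1$ correspond to $\tilde E,\tilde F,\tilde K,\tilde K_-,\bar\pi$ and the residue class $\bar c$. Here $\beta_0,\beta_1$ are automorphisms fixing $\bar L[\bar\pi^{\pm1}]$ with $\beta_0(\tilde K)=\bar q^{2}\tilde K$, $\beta_0(\tilde K_-)=\bar q^{2}\tilde K_-$, $\beta_1(\tilde K)=\bar q^{-2}\tilde K$, $\beta_1(\tilde K_-)=\bar q^{-2}\tilde K_-$, $\beta_1(\tilde F)=\tilde F$. 3. If $|1-q|<1$, then $Gr_\cdot D$ is commutative. 4. Let $I_q\subset D$ be the closed two-sided ideal generated by $K-K_-$. Then $U_q(\mathfrak{sl}_{2,L},R):=D/I_q$ is left and right noetherian, and its quotient norm is multiplicative (with $\|1\|=1$). -/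

import Mathlib

set_option linter.unusedSectionVars false
noncomputable section

open scoped TensorProduct NNReal Topology

namespace QuantumSL2

universe u

section Borel

variable {L : Type u} [Field L]

/-- Generators `K`, `K⁻¹`, `X` of a quantum Borel algebra (`X = E` or `X = F`). -/
inductive BorelGen
  | K | Kinv | X

/-- Relations `K K⁻¹ = K⁻¹ K = 1` and `K X = p X K`. -/
inductive BorelRel (p : L) : FreeAlgebra L BorelGen → FreeAlgebra L BorelGen → Prop
  | mul_inv : BorelRel p (FreeAlgebra.ι L BorelGen.K * FreeAlgebra.ι L BorelGen.Kinv) 1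
  | inv_mul : BorelRel p (FreeAlgebra.ι L BorelGen.Kinv * FreeAlgebra.ι L BorelGen.K) 1
  | comm : BorelRel p (FreeAlgebra.ι L BorelGen.K * FreeAlgebra.ι L BorelGen.X)
      (p • (FreeAlgebra.ι L BorelGen.X * FreeAlgebra.ι L BorelGen.K))

/-- The `L`-algebra generated by `K^{±1}` and `X` with the relation `K X = p X K`. -/
def QBorel (p : L) : Type u := RingQuot (BorelRel p)

namespace QBorel

variable {p : L}

instance : Ring (QBorel p) := inferInstanceAs (Ring (RingQuot (BorelRel p)))
instance : Algebra L (QBorel p) := inferInstanceAs (Algebra L (RingQuot (BorelRel p)))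

/-- The quotient map from the free algebra. -/
def mk (p : L) : FreeAlgebra L BorelGen →ₐ[L] QBorel p := RingQuot.mkAlgHom L (BorelRel p)

/-- The generator `K`, as a unit. -/
def K (p : L) : (QBorel p)ˣ where
  val := mk p (FreeAlgebra.ι L BorelGen.K)
  inv := mk p (FreeAlgebra.ι L BorelGen.Kinv)
  val_inv := by
    rw [← map_mul, ← map_one (mk p)]
    exact RingQuot.mkAlgHom_rel L BorelRel.mul_inv
  inv_val := by
    rw [← map_mul, ← map_one (mk p)]
    exact RingQuot.mkAlgHom_rel L BorelRel.inv_mul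

/-- The generator `X`. -/
def X (p : L) : QBorel p := mk p (FreeAlgebra.ι L BorelGen.X)

theorem K_mul_X : (K p : QBorel p) * X p = p • (X p * K p) := by
  change mk p _ * mk p _ = p • (mk p _ * mk p _)
  rw [← map_mul, ← map_mul, ← map_smul]
  exact RingQuot.mkAlgHom_rel L BorelRel.comm

variable {C : Type*} [Ring C] [Algebra L C]

/-- The value of a homomorphism on the three generators. -/
def genVal (k : Cˣ) (x : C) : BorelGen → C
  | .K => k
  | .Kinv => (k⁻¹ : Cˣ)
  | .X => x

/-- Universal property: a unit `k` and an element `x` with `k x = p x k`. -/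
def lift (k : Cˣ) (x : C) (h : (k : C) * x = p • (x * k)) : QBorel p →ₐ[L] C :=
  RingQuot.liftAlgHom L ⟨FreeAlgebra.lift L (genVal k x), by
    intro a b hab
    cases hab <;> simp [genVal, h]⟩

@[simp] theorem lift_K (k : Cˣ) (x : C) (h : (k : C) * x = p • (x * k)) :
    lift k x h (K p : QBorel p) = k := by
  change RingQuot.liftAlgHom L _ (RingQuot.mkAlgHom L _ _) = _
  rw [RingQuot.liftAlgHom_mkAlgHom_apply]
  simp [genVal]

@[simp] theorem lift_Kinv (k : Cˣ) (x : C) (h : (k : C) * x = p • (x * k)) :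
    lift k x h ((K p)⁻¹ : (QBorel p)ˣ) = (k⁻¹ : Cˣ) := by
  change RingQuot.liftAlgHom L _ (RingQuot.mkAlgHom L _ _) = _
  rw [RingQuot.liftAlgHom_mkAlgHom_apply]
  simp [genVal]

@[simp] theorem lift_X (k : Cˣ) (x : C) (h : (k : C) * x = p • (x * k)) :
    lift k x h (X p : QBorel p) = x := by
  change RingQuot.liftAlgHom L _ (RingQuot.mkAlgHom L _ _) = _
  rw [RingQuot.liftAlgHom_mkAlgHom_apply]
  simp [genVal]

theorem eq_top (S : Subalgebra L (QBorel p)) (h1 : (K p : QBorel p) ∈ S)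
    (h2 : (((K p)⁻¹ : (QBorel p)ˣ) : QBorel p) ∈ S) (h3 : X p ∈ S) : S = ⊤ := by
  rw [eq_top_iff]
  rintro x -
  obtain ⟨f, rfl⟩ := RingQuot.mkAlgHom_surjective L (BorelRel p) x
  change mk p f ∈ S
  induction f using FreeAlgebra.induction with
  | grade0 r => rw [AlgHom.commutes]; exact S.algebraMap_mem r
  | grade1 g => cases g <;> assumption
  | mul a b ha hb => rw [map_mul]; exact S.mul_mem ha hb
  | add a b ha hb => rw [map_add]; exact S.add_mem ha hb

theorem hom_ext {f g : QBorel p →ₐ[L] C} (h1 : f (K p : QBorel p) = g (K p : QBorel p))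
    (h3 : f (X p) = g (X p)) : f = g := by
  have h2 : f ((K p)⁻¹ : (QBorel p)ˣ) = g ((K p)⁻¹ : (QBorel p)ˣ) := by
    have : Units.map (f : QBorel p →* C) (K p) = Units.map (g : QBorel p →* C) (K p) :=
      Units.ext h1
    have := congrArg (fun u : Cˣ => ((u⁻¹ : Cˣ) : C)) this
    simpa [← map_inv] using this
  have := eq_top (AlgHom.equalizer f g) h1 h2 h3
  ext x
  have hx : x ∈ AlgHom.equalizer f g := this ▸ Algebra.mem_top
  exact hx

end QBorel

/-- `U_q(b₊)`: generators `K^{±1}`, `E`, relation `K E = q² E K`. -/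
def UqBPlus (q : Lˣ) : Type u := QBorel ((q : L) ^ 2)

/-- `U_q(b₋)`: generators `K^{±1}`, `F`, relation `K F = q⁻² F K`. -/
def UqBMinus (q : Lˣ) : Type u := QBorel (((q⁻¹ : Lˣ) : L) ^ 2)

variable (q : Lˣ)

instance : Ring (UqBPlus q) := inferInstanceAs (Ring (QBorel _))
instance : Algebra L (UqBPlus q) := inferInstanceAs (Algebra L (QBorel _))
instance : Ring (UqBMinus q) := inferInstanceAs (Ring (QBorel _))
instance : Algebra L (UqBMinus q) := inferInstanceAs (Algebra L (QBorel _))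

namespace UqBPlus

def K : (UqBPlus q)ˣ := QBorel.K _
def E : UqBPlus q := QBorel.X _

theorem K_mul_E : (K q : UqBPlus q) * E q = (q : L) ^ 2 • (E q * K q) := QBorel.K_mul_X

variable {q} {C : Type*} [Ring C] [Algebra L C]

/-- Universal property of `U_q(b₊)`. -/
def lift (k : Cˣ) (x : C) (h : (k : C) * x = (q : L) ^ 2 • (x * k)) : UqBPlus q →ₐ[L] C :=
  QBorel.lift k x h

@[simp] theorem lift_K (k : Cˣ) (x : C) (h : (k : C) * x = (q : L) ^ 2 • (x * k)) :
    lift k x h (K q : UqBPlus q) = k := QBorel.lift_K k x h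
@[simp] theorem lift_Kinv (k : Cˣ) (x : C) (h : (k : C) * x = (q : L) ^ 2 • (x * k)) :
    lift k x h ((K q)⁻¹ : (UqBPlus q)ˣ) = (k⁻¹ : Cˣ) := QBorel.lift_Kinv k x h
@[simp] theorem lift_E (k : Cˣ) (x : C) (h : (k : C) * x = (q : L) ^ 2 • (x * k)) :
    lift k x h (E q) = x := QBorel.lift_X k x h

theorem hom_ext {f g : UqBPlus q →ₐ[L] C} (h1 : f (K q : UqBPlus q) = g (K q : UqBPlus q))
    (h3 : f (E q) = g (E q)) : f = g := QBorel.hom_ext h1 h3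

theorem eq_top (S : Subalgebra L (UqBPlus q)) (h1 : (K q : UqBPlus q) ∈ S)
    (h2 : (((K q)⁻¹ : (UqBPlus q)ˣ) : UqBPlus q) ∈ S) (h3 : E q ∈ S) : S = ⊤ :=
  QBorel.eq_top S h1 h2 h3

/-- `K ⊗ K` as a unit. -/
def KK (q : Lˣ) : (UqBPlus q ⊗[L] UqBPlus q)ˣ where
  val := (K q : UqBPlus q) ⊗ₜ (K q : UqBPlus q)
  inv := (((K q)⁻¹ : (UqBPlus q)ˣ) : UqBPlus q) ⊗ₜ (((K q)⁻¹ : (UqBPlus q)ˣ) : UqBPlus q)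
  val_inv := by simp [Algebra.TensorProduct.one_def]
  inv_val := by simp [Algebra.TensorProduct.one_def]

/-- `Δ(K) = K ⊗ K`, `Δ(E) = E ⊗ K + 1 ⊗ E`. -/
def comulHom (q : Lˣ) : UqBPlus q →ₐ[L] UqBPlus q ⊗[L] UqBPlus q :=
  lift (KK q) (E q ⊗ₜ (K q : UqBPlus q) + 1 ⊗ₜ E q) (by
    simp [KK, mul_add, add_mul, K_mul_E, TensorProduct.smul_tmul'])

/-- `ε(K) = 1`, `ε(E) = 0`. -/
def counitHom (q : Lˣ) : UqBPlus q →ₐ[L] L := lift 1 0 (by simp)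

instance : Bialgebra L (UqBPlus q) :=
  Bialgebra.ofAlgHom (comulHom q) (counitHom q)
    (hom_ext (by simp [comulHom, KK]) (by
      simp [comulHom, KK, TensorProduct.add_tmul, TensorProduct.tmul_add, add_assoc,
        Algebra.TensorProduct.one_def]))
    (hom_ext (by simp [comulHom, counitHom, KK]) (by simp [comulHom, counitHom, KK]))
    (hom_ext (by simp [comulHom, counitHom, KK]) (by simp [comulHom, counitHom, KK]))

theorem E_mul_Kinv : E q * ((K q)⁻¹ : (UqBPlus q)ˣ) =
    (q : L) ^ 2 • ((((K q)⁻¹ : (UqBPlus q)ˣ) : UqBPlus q) * E q) := by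
  rw [← Units.inv_mul_cancel_left (K q) (E q * _), ← mul_assoc (K q : UqBPlus q), K_mul_E,
    smul_mul_assoc, mul_assoc (E q), Units.mul_inv, mul_one, mul_smul_comm]

/-- The antipode `S(K) = K⁻¹`, `S(E) = - E K⁻¹`, an algebra map to the opposite algebra. -/
def antipode (q : Lˣ) : UqBPlus q →ₐ[L] (UqBPlus q)ᵐᵒᵖ :=
  lift (Units.opEquiv.symm (MulOpposite.op (K q)⁻¹))
    (MulOpposite.op (-(E q * ((K q)⁻¹ : (UqBPlus q)ˣ)))) (by
      apply MulOpposite.unop_injective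
      simp only [Units.coe_opEquiv_symm, MulOpposite.unop_op, MulOpposite.unop_mul,
        MulOpposite.unop_smul]
      rw [neg_mul, mul_neg, smul_neg, ← mul_assoc, ← smul_mul_assoc, ← E_mul_Kinv])

end UqBPlus

namespace UqBMinus

/-- The generator `K` of `U_q(b₋)`, which becomes the element `K₋` of the double. -/
def K : (UqBMinus q)ˣ := QBorel.K _

/-- The generator `F` of `U_q(b₋)`. -/
def F : UqBMinus q := QBorel.X _

theorem K_mul_F : (K q : UqBMinus q) * F q = ((q⁻¹ : Lˣ) : L) ^ 2 • (F q * K q) := QBorel.K_mul_X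

theorem Kinv_mul_F : (((K q)⁻¹ : (UqBMinus q)ˣ) : UqBMinus q) * F q =
    (q : L) ^ 2 • (F q * ((K q)⁻¹ : (UqBMinus q)ˣ)) := by
  have h : F q * (K q : UqBMinus q) = (q : L) ^ 2 • ((K q : UqBMinus q) * F q) := by
    rw [K_mul_F, smul_smul, ← mul_pow]; simp
  rw [← Units.mul_inv_cancel_right (_ * F q) (K q), mul_assoc _ (F q), h, mul_smul_comm,
    Units.inv_mul_cancel_left, smul_mul_assoc]

variable {q} {C : Type*} [Ring C] [Algebra L C]

/-- Universal property of `U_q(b₋)`. -/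
def lift (k : Cˣ) (x : C) (h : (k : C) * x = ((q⁻¹ : Lˣ) : L) ^ 2 • (x * k)) :
    UqBMinus q →ₐ[L] C := QBorel.lift k x h

@[simp] theorem lift_K (k : Cˣ) (x : C) (h : (k : C) * x = ((q⁻¹ : Lˣ) : L) ^ 2 • (x * k)) :
    lift k x h (K q : UqBMinus q) = k := QBorel.lift_K k x h
@[simp] theorem lift_Kinv (k : Cˣ) (x : C) (h : (k : C) * x = ((q⁻¹ : Lˣ) : L) ^ 2 • (x * k)) :
    lift k x h ((K q)⁻¹ : (UqBMinus q)ˣ) = (k⁻¹ : Cˣ) := QBorel.lift_Kinv k x h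
@[simp] theorem lift_F (k : Cˣ) (x : C) (h : (k : C) * x = ((q⁻¹ : Lˣ) : L) ^ 2 • (x * k)) :
    lift k x h (F q) = x := QBorel.lift_X k x h

theorem hom_ext {f g : UqBMinus q →ₐ[L] C} (h1 : f (K q : UqBMinus q) = g (K q : UqBMinus q))
    (h3 : f (F q) = g (F q)) : f = g := QBorel.hom_ext h1 h3

theorem eq_top (S : Subalgebra L (UqBMinus q)) (h1 : (K q : UqBMinus q) ∈ S)
    (h2 : (((K q)⁻¹ : (UqBMinus q)ˣ) : UqBMinus q) ∈ S) (h3 : F q ∈ S) : S = ⊤ :=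
  QBorel.eq_top S h1 h2 h3

/-- `K ⊗ K` as a unit. -/
def KK (q : Lˣ) : (UqBMinus q ⊗[L] UqBMinus q)ˣ where
  val := (K q : UqBMinus q) ⊗ₜ (K q : UqBMinus q)
  inv := (((K q)⁻¹ : (UqBMinus q)ˣ) : UqBMinus q) ⊗ₜ (((K q)⁻¹ : (UqBMinus q)ˣ) : UqBMinus q)
  val_inv := by simp [Algebra.TensorProduct.one_def]
  inv_val := by simp [Algebra.TensorProduct.one_def]

/-- `Δ(K) = K ⊗ K`, `Δ(F) = F ⊗ 1 + K⁻¹ ⊗ F`. -/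
def comulHom (q : Lˣ) : UqBMinus q →ₐ[L] UqBMinus q ⊗[L] UqBMinus q :=
  lift (KK q) (F q ⊗ₜ 1 + (((K q)⁻¹ : (UqBMinus q)ˣ) : UqBMinus q) ⊗ₜ F q) (by
    simp [KK, mul_add, add_mul, K_mul_F, TensorProduct.smul_tmul'])

/-- `ε(K) = 1`, `ε(F) = 0`. -/
def counitHom (q : Lˣ) : UqBMinus q →ₐ[L] L := lift 1 0 (by simp)

instance : Bialgebra L (UqBMinus q) :=
  Bialgebra.ofAlgHom (comulHom q) (counitHom q)
    (hom_ext (by simp [comulHom, KK]) (by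
      simp [comulHom, KK, TensorProduct.add_tmul, TensorProduct.tmul_add, add_assoc,
        Algebra.TensorProduct.one_def]))
    (hom_ext (by simp [comulHom, counitHom, KK]) (by simp [comulHom, counitHom, KK]))
    (hom_ext (by simp [comulHom, counitHom, KK]) (by simp [comulHom, counitHom, KK]))

theorem comul_K : Coalgebra.comul (R := L) (K q : UqBMinus q) =
    (K q : UqBMinus q) ⊗ₜ (K q : UqBMinus q) := by
  change comulHom q _ = _
  simp [comulHom, KK]

theorem comul_Kinv : Coalgebra.comul (R := L) (((K q)⁻¹ : (UqBMinus q)ˣ) : UqBMinus q) =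
    (((K q)⁻¹ : (UqBMinus q)ˣ) : UqBMinus q) ⊗ₜ (((K q)⁻¹ : (UqBMinus q)ˣ) : UqBMinus q) := by
  change comulHom q _ = _
  simp only [comulHom, lift_Kinv]
  rfl

theorem comul_F : Coalgebra.comul (R := L) (F q) =
    F q ⊗ₜ 1 + (((K q)⁻¹ : (UqBMinus q)ˣ) : UqBMinus q) ⊗ₜ F q := by
  change comulHom q _ = _
  simp [comulHom]

/-! ### The pairing -/

/-- The functional `⟨K, ·⟩`: the character with `K ↦ q⁻²`, `F ↦ 0`. -/
def chi (q : Lˣ) : UqBMinus q →ₐ[L] L := lift (q⁻¹ ^ 2) 0 (by simp)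

/-- The functional `⟨K⁻¹, ·⟩`: the character with `K ↦ q²`, `F ↦ 0`. -/
def chiInv (q : Lˣ) : UqBMinus q →ₐ[L] L := lift (q ^ 2) 0 (by simp)

/-- `diag(q⁻², 1)`. -/
def diagUnit (q : Lˣ) : (Matrix (Fin 2) (Fin 2) L)ˣ where
  val := !![((q⁻¹ : Lˣ) : L) ^ 2, 0; 0, 1]
  inv := !![(q : L) ^ 2, 0; 0, 1]
  val_inv := by simp [Matrix.one_fin_two]
  inv_val := by simp [Matrix.one_fin_two]

/-- The representation `b ↦ (⟨K, b⟩, ⟨E, b⟩; 0, ε(b))` of `U_q(b₋)`. -/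
def pairRep (q : Lˣ) : UqBMinus q →ₐ[L] Matrix (Fin 2) (Fin 2) L :=
  lift (diagUnit q) !![0, (((q⁻¹ : Lˣ) : L) - (q : L))⁻¹; 0, 0] (by
    simp [diagUnit, Matrix.smul_of])

/-- The functional `⟨E, ·⟩`: it has `⟨E, K⟩ = 0`, `⟨E, F⟩ = (q⁻¹ - q)⁻¹` and
`⟨E, b b'⟩ = ⟨K, b⟩ ⟨E, b'⟩ + ⟨E, b⟩ ε(b')`. -/
def pairE (q : Lˣ) : UqBMinus q →ₗ[L] L where
  toFun b := pairRep q b 0 1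
  map_add' _ _ := by simp
  map_smul' _ _ := by simp

theorem pairRep_apply (b : UqBMinus q) :
    pairRep q b = !![chi q b, pairE q b; 0, Coalgebra.counit (R := L) b] := by
  let S : Subalgebra L (UqBMinus q) :=
    { carrier := {b | pairRep q b = !![chi q b, pairE q b; 0, Coalgebra.counit (R := L) b]}
      mul_mem' := by
        intro a b ha hb
        have h01 : pairE q (a * b) = (pairRep q a * pairRep q b) 0 1 := by
          simp [pairE]
        simp only [Set.mem_ofPred_eq] at ha hb ⊢
        rw [h01, map_mul, ha, hb, map_mul, Bialgebra.counit_mul]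
        simp
      add_mem' := by
        intro a b ha hb
        simp only [Set.mem_ofPred_eq] at ha hb ⊢
        rw [map_add, ha, hb]
        simp
      algebraMap_mem' := by
        intro r
        have h01 : pairE q (algebraMap L _ r) = algebraMap L (Matrix (Fin 2) (Fin 2) L) r 0 1 := by
          simp [pairE]
        simp only [Set.mem_ofPred_eq]
        rw [h01, AlgHom.commutes, AlgHom.commutes, Bialgebra.counit_algebraMap]
        ext i j
        fin_cases i <;> fin_cases j <;> simp [Matrix.algebraMap_matrix_apply] }
  have hS : S = ⊤ := by
    apply eq_top
    · change pairRep q _ = !![_, pairRep q _ 0 1; 0, counitHom q _]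
      simp [pairRep, chi, counitHom, diagUnit]
    · change pairRep q _ = !![_, pairRep q _ 0 1; 0, counitHom q _]
      simp [pairRep, chi, counitHom, diagUnit]
    · change pairRep q _ = !![_, pairRep q _ 0 1; 0, counitHom q _]
      simp [pairRep, chi, counitHom]
  have : b ∈ S := hS ▸ Algebra.mem_top
  exact this

theorem pairE_mul (a b : UqBMinus q) : pairE q (a * b) =
    chi q a * pairE q b + pairE q a * Coalgebra.counit (R := L) b := by
  change pairRep q (a * b) 0 1 = _
  rw [map_mul, pairRep_apply, pairRep_apply]
  simp


theorem chi_mul_chiInv : WithConv.toConv (chi q) * WithConv.toConv (chiInv q) = 1 := by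
  apply WithConv.ofConv_injective
  apply hom_ext
  · change (WithConv.toConv (chi q) * WithConv.toConv (chiInv q)) _ = counitHom q _
    rw [AlgHom.convMul_apply, comul_K]
    simp [chi, chiInv, counitHom]
  · change (WithConv.toConv (chi q) * WithConv.toConv (chiInv q)) _ = counitHom q _
    rw [AlgHom.convMul_apply, comul_F]
    simp [chi, chiInv, counitHom]

theorem chiInv_mul_chi : WithConv.toConv (chiInv q) * WithConv.toConv (chi q) = 1 := by
  apply WithConv.ofConv_injective
  apply hom_ext
  · change (WithConv.toConv (chiInv q) * WithConv.toConv (chi q)) _ = counitHom q _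
    rw [AlgHom.convMul_apply, comul_K]
    simp [chi, chiInv, counitHom]
  · change (WithConv.toConv (chiInv q) * WithConv.toConv (chi q)) _ = counitHom q _
    rw [AlgHom.convMul_apply, comul_F]
    simp [chi, chiInv, counitHom]

/-- The functional `⟨K, ·⟩` is invertible in the convolution algebra `U_q(b₋)^*`. -/
def chiUnit (q : Lˣ) : (WithConv (UqBMinus q →ₗ[L] L))ˣ where
  val := WithConv.toConv (chi q).toLinearMap
  inv := WithConv.toConv (chiInv q).toLinearMap
  val_inv := congrArg (fun f : WithConv (UqBMinus q →ₐ[L] L) =>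
    WithConv.toConv f.ofConv.toLinearMap) chi_mul_chiInv
  inv_val := congrArg (fun f : WithConv (UqBMinus q →ₐ[L] L) =>
    WithConv.toConv f.ofConv.toLinearMap) chiInv_mul_chi

theorem skewDer_ext {u v : UqBMinus q →ₐ[L] L} {f g : UqBMinus q →ₗ[L] L}
    (hf : ∀ a b, f (a * b) = u a * f b + f a * v b)
    (hg : ∀ a b, g (a * b) = u a * g b + g a * v b)
    (h1 : f (K q : UqBMinus q) = g (K q : UqBMinus q))
    (h2 : f ((K q)⁻¹ : (UqBMinus q)ˣ) = g ((K q)⁻¹ : (UqBMinus q)ˣ))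
    (h3 : f (F q) = g (F q)) : f = g := by
  have f1 : f 1 = 0 := by simpa using hf 1 1
  have g1 : g 1 = 0 := by simpa using hg 1 1
  let S : Subalgebra L (UqBMinus q) :=
    { carrier := {b | f b = g b}
      mul_mem' := by
        intro a b ha hb
        simp only [Set.mem_ofPred_eq] at ha hb ⊢
        rw [hf, hg, ha, hb]
      add_mem' := by
        intro a b ha hb
        simp only [Set.mem_ofPred_eq] at ha hb ⊢
        rw [map_add, map_add, ha, hb]
      algebraMap_mem' := by
        intro r
        simp [Algebra.algebraMap_eq_smul_one, f1, g1] }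
  have hS : S = ⊤ := eq_top S h1 h2 h3
  ext b
  have : b ∈ S := hS ▸ Algebra.mem_top
  exact this

theorem chi_conv_pairE :
    WithConv.toConv (chi q).toLinearMap * WithConv.toConv (pairE q) =
      (q : L) ^ 2 • (WithConv.toConv (pairE q) * WithConv.toConv (chi q).toLinearMap) := by
  have key1 : ∀ x y : UqBMinus q ⊗[L] UqBMinus q,
      LinearMap.mul' L L (TensorProduct.map (chi q).toLinearMap (pairE q) (x * y)) =
        LinearMap.mul' L L (TensorProduct.map (chi q).toLinearMap (chi q).toLinearMap x) *
          LinearMap.mul' L L (TensorProduct.map (chi q).toLinearMap (pairE q) y) +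
        LinearMap.mul' L L (TensorProduct.map (chi q).toLinearMap (pairE q) x) *
          LinearMap.mul' L L (TensorProduct.map (chi q).toLinearMap
            (Coalgebra.counit (R := L)) y) := by
    intro x y
    induction x with
    | zero => simp
    | add a b ha hb => rw [add_mul, map_add, map_add, ha, hb]; simp; ring
    | tmul a b =>
      induction y with
      | zero => simp
      | add c d hc hd => rw [mul_add, map_add, map_add, hc, hd]; simp; ring
      | tmul c d => simp [pairE_mul]; ring
  have key2 : ∀ x y : UqBMinus q ⊗[L] UqBMinus q,
      LinearMap.mul' L L (TensorProduct.map (pairE q) (chi q).toLinearMap (x * y)) =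
        LinearMap.mul' L L (TensorProduct.map (chi q).toLinearMap (chi q).toLinearMap x) *
          LinearMap.mul' L L (TensorProduct.map (pairE q) (chi q).toLinearMap y) +
        LinearMap.mul' L L (TensorProduct.map (pairE q) (chi q).toLinearMap x) *
          LinearMap.mul' L L (TensorProduct.map (Coalgebra.counit (R := L))
            (chi q).toLinearMap y) := by
    intro x y
    induction x with
    | zero => simp
    | add a b ha hb => rw [add_mul, map_add, map_add, ha, hb]; simp; ring
    | tmul a b =>
      induction y with
      | zero => simp
      | add c d hc hd => rw [mul_add, map_add, map_add, hc, hd]; simp; ring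
      | tmul c d => simp [pairE_mul]; ring
  have hr : ∀ b : UqBMinus q, LinearMap.mul' L L (TensorProduct.map (chi q).toLinearMap
      (Coalgebra.counit (R := L)) (Coalgebra.comul b)) = chi q b := fun b =>
    congrArg (fun f : WithConv (UqBMinus q →ₗ[L] L) => f b)
      (mul_one (WithConv.toConv (chi q).toLinearMap))
  have hl : ∀ b : UqBMinus q, LinearMap.mul' L L (TensorProduct.map
      (Coalgebra.counit (R := L)) (chi q).toLinearMap (Coalgebra.comul b)) = chi q b := fun b =>
    congrArg (fun f : WithConv (UqBMinus q →ₗ[L] L) => f b)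
      (one_mul (WithConv.toConv (chi q).toLinearMap))
  have eK : pairE q (K q : UqBMinus q) = 0 := by
    change pairRep q _ 0 1 = 0; simp [pairRep, diagUnit]
  have eKi : pairE q ((K q)⁻¹ : (UqBMinus q)ˣ) = 0 := by
    change pairRep q _ 0 1 = 0; simp [pairRep, diagUnit]
  apply WithConv.ofConv_injective
  refine skewDer_ext (u := (WithConv.toConv (chi q) * WithConv.toConv (chi q)).ofConv)
    (v := chi q) ?_ ?_ ?_ ?_ ?_
  · intro a b
    have := key1 (Coalgebra.comul a) (Coalgebra.comul b)
    rw [← Bialgebra.comul_mul, hr] at this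
    exact this
  · intro a b
    have := key2 (Coalgebra.comul a) (Coalgebra.comul b)
    rw [← Bialgebra.comul_mul, hl] at this
    change (q : L) ^ 2 * _ = _ * ((q : L) ^ 2 * _) + (q : L) ^ 2 * _ * _
    refine (congrArg ((q : L) ^ 2 * ·) this).trans ?_
    rw [mul_add, mul_left_comm, mul_assoc]
    rfl
  · change LinearMap.mul' L L (TensorProduct.map _ _ (Coalgebra.comul _)) =
      (q : L) ^ 2 * LinearMap.mul' L L (TensorProduct.map _ _ (Coalgebra.comul _))
    rw [comul_K]; simp [eK]
  · change LinearMap.mul' L L (TensorProduct.map _ _ (Coalgebra.comul _)) =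
      (q : L) ^ 2 * LinearMap.mul' L L (TensorProduct.map _ _ (Coalgebra.comul _))
    rw [comul_Kinv]; simp [eKi]
  · change LinearMap.mul' L L (TensorProduct.map _ _ (Coalgebra.comul _)) =
      (q : L) ^ 2 * LinearMap.mul' L L (TensorProduct.map _ _ (Coalgebra.comul _))
    rw [comul_F]; simp [eKi, chi]

end UqBMinus

/-- The skew-pairing `σ : U_q(b₊) × U_q(b₋) → L` with `⟨K, K⟩ = q⁻²`, `⟨K, F⟩ = ⟨E, K⟩ = 0`,
`⟨E, F⟩ = (q⁻¹ - q)⁻¹`, as the algebra map `a ↦ ⟨a, ·⟩` to the convolution algebra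
`U_q(b₋)^*`. -/
def pairing (q : Lˣ) : UqBPlus q →ₐ[L] WithConv (UqBMinus q →ₗ[L] L) :=
  UqBPlus.lift (UqBMinus.chiUnit q) (WithConv.toConv (UqBMinus.pairE q))
    UqBMinus.chi_conv_pairE

/-- The convolution inverse `(a, b) ↦ ⟨S(a), b⟩` of the pairing. -/
def pairingInv (q : Lˣ) : UqBPlus q →ₗ[L] WithConv (UqBMinus q →ₗ[L] L) where
  toFun a := pairing q (UqBPlus.antipode q a).unop
  map_add' _ _ := by simp
  map_smul' _ _ := by simp

section Actions

variable {B : Type*} [Ring B] [Bialgebra L B]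

open WithConv

/-- A functional on `B`, regarded as a linear map `B → B` with values in the scalars. -/
def eta (f : WithConv (B →ₗ[L] L)) : WithConv (B →ₗ[L] B) :=
  toConv (Algebra.linearMap L B ∘ₗ f.ofConv)

theorem eta_mul (f g : WithConv (B →ₗ[L] L)) : eta (f * g) = eta f * eta g :=
  ofConv_injective (LinearMap.algHom_comp_convMul_distrib (Algebra.ofId L B) f g)

theorem eta_one : eta (1 : WithConv (B →ₗ[L] L)) = 1 := rfl

theorem comp_conv_eta (h k : B →ₗ[L] B) (f : WithConv (B →ₗ[L] L)) :
    h ∘ₗ (toConv k * eta f).ofConv = (toConv (h ∘ₗ k) * eta f).ofConv := by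
  have : ∀ x : B ⊗[L] B, h (LinearMap.mul' L B (TensorProduct.map k (eta f).ofConv x)) =
      LinearMap.mul' L B (TensorProduct.map (h ∘ₗ k) (eta f).ofConv x) := by
    intro x
    induction x with
    | zero => simp
    | add a b ha hb => simp only [map_add, ha, hb]
    | tmul a b => simp [eta, ← Algebra.commutes, ← Algebra.smul_def]
  ext b
  exact this _

theorem comp_eta_conv (h k : B →ₗ[L] B) (f : WithConv (B →ₗ[L] L)) :
    h ∘ₗ (eta f * toConv k).ofConv = (eta f * toConv (h ∘ₗ k)).ofConv := by
  have : ∀ x : B ⊗[L] B, h (LinearMap.mul' L B (TensorProduct.map (eta f).ofConv k x)) =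
      LinearMap.mul' L B (TensorProduct.map (eta f).ofConv (h ∘ₗ k) x) := by
    intro x
    induction x with
    | zero => simp
    | add a b ha hb => simp only [map_add, ha, hb]
    | tmul a b => simp [eta, ← Algebra.smul_def]
  ext b
  exact this _

/-- `b ↦ ∑ b₍₁₎ f(b₍₂₎)`. -/
def actL (f : WithConv (B →ₗ[L] L)) : Module.End L B := (toConv LinearMap.id * eta f).ofConv

/-- `b ↦ ∑ f(b₍₁₎) b₍₂₎`. -/
def actR (f : WithConv (B →ₗ[L] L)) : Module.End L B := (eta f * toConv LinearMap.id).ofConv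

theorem actL_mul (f g : WithConv (B →ₗ[L] L)) : actL (f * g) = actL f * actL g := by
  change _ = actL f ∘ₗ (toConv LinearMap.id * eta g).ofConv
  rw [comp_conv_eta, LinearMap.comp_id, actL, eta_mul, ← mul_assoc]
  rfl

theorem actR_mul (f g : WithConv (B →ₗ[L] L)) : actR (f * g) = actR g * actR f := by
  change _ = actR g ∘ₗ (eta f * toConv LinearMap.id).ofConv
  rw [comp_eta_conv, LinearMap.comp_id, actR, eta_mul, mul_assoc]
  rfl

theorem actR_comm_actL (f g : WithConv (B →ₗ[L] L)) : Commute (actR f) (actL g) := by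
  change actR f ∘ₗ (toConv LinearMap.id * eta g).ofConv =
    actL g ∘ₗ (eta f * toConv LinearMap.id).ofConv
  rw [comp_conv_eta, comp_eta_conv, LinearMap.comp_id, LinearMap.comp_id]
  change (eta f * toConv LinearMap.id * eta g).ofConv =
    (eta f * (toConv LinearMap.id * eta g)).ofConv
  rw [mul_assoc]

theorem actL_one : actL (1 : WithConv (B →ₗ[L] L)) = 1 := by
  rw [actL, eta_one, mul_one]; rfl

theorem actR_one : actR (1 : WithConv (B →ₗ[L] L)) = 1 := by
  rw [actR, eta_one, one_mul]; rfl

/-- `actL` as a linear map. -/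
def actLLin : WithConv (B →ₗ[L] L) →ₗ[L] Module.End L B where
  toFun := actL
  map_add' f g := by
    have : eta (f + g) = eta f + eta g := by
      ext b; simp [eta]
    simp only [actL, this, mul_add]; rfl
  map_smul' r f := by
    have : eta (r • f) = r • eta f := by
      exact congrArg toConv (LinearMap.comp_smul _ _ _)
    simp only [actL, this, mul_smul_comm]; rfl

/-- `actR` as a linear map. -/
def actRLin : WithConv (B →ₗ[L] L) →ₗ[L] Module.End L B where
  toFun := actR
  map_add' f g := by
    have : eta (f + g) = eta f + eta g := by
      ext b; simp [eta]
    simp only [actR, this, add_mul]; rfl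
  map_smul' r f := by
    have : eta (r • f) = r • eta f := by
      exact congrArg toConv (LinearMap.comp_smul _ _ _)
    simp only [actR, this, smul_mul_assoc]; rfl

end Actions

/-- `a ↦ (b ↦ ∑ b₍₁₎ σ(a, b₍₂₎))`. -/
def lam (q : Lˣ) : UqBPlus q →ₐ[L] Module.End L (UqBMinus q) :=
  AlgHom.ofLinearMap (actLLin ∘ₗ (pairing q).toLinearMap)
    (by simp only [LinearMap.comp_apply, AlgHom.toLinearMap_apply, map_one]; exact actL_one)
    (by
      intro x y
      simp only [LinearMap.comp_apply, AlgHom.toLinearMap_apply, map_mul]; exact actL_mul _ _)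

/-- `a ↦ (b ↦ ∑ σ̄(a, b₍₁₎) b₍₂₎)`. -/
def rho (q : Lˣ) : UqBPlus q →ₐ[L] Module.End L (UqBMinus q) :=
  AlgHom.ofLinearMap (actRLin ∘ₗ pairingInv q)
    (by
      have : pairingInv q 1 = 1 := by simp [pairingInv]
      rw [LinearMap.comp_apply, this]; exact actR_one)
    (by
      intro x y
      have : pairingInv q (x * y) = pairingInv q y * pairingInv q x := by simp [pairingInv]
      rw [LinearMap.comp_apply, this]; exact actR_mul _ _)

theorem rho_comm_lam (a a' : UqBPlus q) : Commute (rho q a) (lam q a') := actR_comm_actL _ _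

/-- `f ↦ f ⊗ 1` on `U_q(b₋) ⊗ U_q(b₊)`. -/
def onB (q : Lˣ) :
    Module.End L (UqBMinus q) →ₐ[L] Module.End L (UqBMinus q ⊗[L] UqBPlus q) :=
  Module.End.rTensorAlgHom L (UqBMinus q) (UqBPlus q)

/-- `f ↦ 1 ⊗ f` on `U_q(b₋) ⊗ U_q(b₊)`. -/
def onA (q : Lˣ) :
    Module.End L (UqBPlus q) →ₐ[L] Module.End L (UqBMinus q ⊗[L] UqBPlus q) :=
  Module.End.lTensorAlgHom L (UqBPlus q) (UqBMinus q)

@[simp] theorem onB_tmul (f : Module.End L (UqBMinus q)) (b : UqBMinus q) (a : UqBPlus q) :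
    onB q f (b ⊗ₜ[L] a) = f b ⊗ₜ[L] a := rfl

@[simp] theorem onA_tmul (f : Module.End L (UqBPlus q)) (b : UqBMinus q) (a : UqBPlus q) :
    onA q f (b ⊗ₜ[L] a) = b ⊗ₜ[L] f a := rfl

theorem onA_comm_onB (f : Module.End L (UqBPlus q)) (g : Module.End L (UqBMinus q)) :
    Commute (onA q f) (onB q g) := by
  apply TensorProduct.ext'; intro b a; simp

/-- `a ⊗ a'` acts by left multiplication by `a` on the right factor composed with `lam a'` on the
left factor. -/
def crossAux (q : Lˣ) :
    UqBPlus q ⊗[L] UqBPlus q →ₐ[L] Module.End L (UqBMinus q ⊗[L] UqBPlus q) :=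
  Algebra.TensorProduct.lift ((onA q).comp (Algebra.lmul L (UqBPlus q))) ((onB q).comp (lam q))
    (fun _ _ => onA_comm_onB q _ _)

theorem crossAux_tmul (a a' : UqBPlus q) : crossAux q (a ⊗ₜ a') =
    onA q (Algebra.lmul L (UqBPlus q) a) * onB q (lam q a') := rfl

/-- Left multiplication by `1 ⊗ a` in the double:
`b' ⊗ a' ↦ ∑ σ̄(a₍₁₎, b'₍₁₎) b'₍₂₎ σ(a₍₃₎, b'₍₃₎) ⊗ a₍₂₎ a'`. -/
def crossAct (q : Lˣ) : UqBPlus q →ₐ[L] Module.End L (UqBMinus q ⊗[L] UqBPlus q) :=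
  (Algebra.TensorProduct.lift ((onB q).comp (rho q)) (crossAux q) (fun x y => by
    induction y with
    | zero => simp
    | add c d hc hd => rw [map_add]; exact hc.add_right hd
    | tmul c d =>
      exact (onA_comm_onB q _ _).symm.mul_right ((rho_comm_lam q x d).map (onB q)))).comp
  ((Algebra.TensorProduct.map (AlgHom.id L (UqBPlus q)) (Bialgebra.comulAlgHom L (UqBPlus q))).comp
    (Bialgebra.comulAlgHom L (UqBPlus q)))

theorem UqBPlus.comul_K : Coalgebra.comul (R := L) (UqBPlus.K q : UqBPlus q) =
    (UqBPlus.K q : UqBPlus q) ⊗ₜ (UqBPlus.K q : UqBPlus q) := by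
  change UqBPlus.comulHom q _ = _
  simp [UqBPlus.comulHom, UqBPlus.KK]

theorem UqBPlus.comul_Kinv :
    Coalgebra.comul (R := L) (((UqBPlus.K q)⁻¹ : (UqBPlus q)ˣ) : UqBPlus q) =
    (((UqBPlus.K q)⁻¹ : (UqBPlus q)ˣ) : UqBPlus q) ⊗ₜ
      (((UqBPlus.K q)⁻¹ : (UqBPlus q)ˣ) : UqBPlus q) := by
  change UqBPlus.comulHom q _ = _
  simp only [UqBPlus.comulHom, UqBPlus.lift_Kinv]
  rfl

theorem UqBPlus.comul_E : Coalgebra.comul (R := L) (UqBPlus.E q) =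
    UqBPlus.E q ⊗ₜ (UqBPlus.K q : UqBPlus q) + 1 ⊗ₜ UqBPlus.E q := by
  change UqBPlus.comulHom q _ = _
  simp [UqBPlus.comulHom]

theorem crossAct_groupLike (g : UqBPlus q)
    (hg : Coalgebra.comul (R := L) g = g ⊗ₜ g) (b : UqBMinus q) (a : UqBPlus q) :
    crossAct q g (b ⊗ₜ a) = rho q g (lam q g b) ⊗ₜ (g * a) := by
  simp [crossAct, crossAux_tmul, hg]

theorem crossAct_E (b : UqBMinus q) (a : UqBPlus q) :
    crossAct q (UqBPlus.E q) (b ⊗ₜ a) =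
      rho q (UqBPlus.E q) (lam q (UqBPlus.K q : UqBPlus q) b) ⊗ₜ ((UqBPlus.K q : UqBPlus q) * a) +
      lam q (UqBPlus.K q : UqBPlus q) b ⊗ₜ (UqBPlus.E q * a) +
      lam q (UqBPlus.E q) b ⊗ₜ a := by
  simp [crossAct, crossAux_tmul, UqBPlus.comul_E, UqBPlus.comul_K, TensorProduct.tmul_add, add_assoc]

section SkewActions

variable {B : Type*} [Ring B] [Bialgebra L B]

open WithConv

theorem actL_skew {f u v : WithConv (B →ₗ[L] L)}
    (h : ∀ a b : B, f (a * b) = u a * f b + f a * v b) (a b : B) :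
    actL f (a * b) = actL u a * actL f b + actL f a * actL v b := by
  have key : ∀ x y : B ⊗[L] B,
      LinearMap.mul' L B (TensorProduct.map LinearMap.id (eta f).ofConv (x * y)) =
      LinearMap.mul' L B (TensorProduct.map LinearMap.id (eta u).ofConv x) *
        LinearMap.mul' L B (TensorProduct.map LinearMap.id (eta f).ofConv y) +
      LinearMap.mul' L B (TensorProduct.map LinearMap.id (eta f).ofConv x) *
        LinearMap.mul' L B (TensorProduct.map LinearMap.id (eta v).ofConv y) := by
    intro x y
    induction x with
    | zero => simp
    | add a b ha hb => rw [add_mul, map_add, map_add, ha, hb]; simp only [map_add, add_mul]; abel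
    | tmul a b =>
      induction y with
      | zero => simp
      | add c d hc hd => rw [mul_add, map_add, map_add, hc, hd]; simp only [map_add, mul_add]; abel
      | tmul c d =>
        have h' := h b d
        simp only [eta, Algebra.TensorProduct.tmul_mul_tmul, TensorProduct.map_tmul,
          LinearMap.mul'_apply, LinearMap.id_apply, LinearMap.comp_apply, ofConv_toConv,
          Algebra.linearMap_apply, ← Algebra.commutes, ← Algebra.smul_def]
        change f (b * d) • (a * c) = (u b • a) * (f d • c) + (f b • a) * (v d • c)
        rw [h', add_smul, smul_mul_smul_comm, smul_mul_smul_comm]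
  have := key (Coalgebra.comul a) (Coalgebra.comul b)
  rw [← Bialgebra.comul_mul] at this
  exact this

theorem actR_skew {f u v : WithConv (B →ₗ[L] L)}
    (h : ∀ a b : B, f (a * b) = u a * f b + f a * v b) (a b : B) :
    actR f (a * b) = actR u a * actR f b + actR f a * actR v b := by
  have key : ∀ x y : B ⊗[L] B,
      LinearMap.mul' L B (TensorProduct.map (eta f).ofConv LinearMap.id (x * y)) =
      LinearMap.mul' L B (TensorProduct.map (eta u).ofConv LinearMap.id x) *
        LinearMap.mul' L B (TensorProduct.map (eta f).ofConv LinearMap.id y) +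
      LinearMap.mul' L B (TensorProduct.map (eta f).ofConv LinearMap.id x) *
        LinearMap.mul' L B (TensorProduct.map (eta v).ofConv LinearMap.id y) := by
    intro x y
    induction x with
    | zero => simp
    | add a b ha hb => rw [add_mul, map_add, map_add, ha, hb]; simp only [map_add, add_mul]; abel
    | tmul b a =>
      induction y with
      | zero => simp
      | add c d hc hd => rw [mul_add, map_add, map_add, hc, hd]; simp only [map_add, mul_add]; abel
      | tmul d c =>
        have h' := h b d
        simp only [eta, Algebra.TensorProduct.tmul_mul_tmul, TensorProduct.map_tmul,
          LinearMap.mul'_apply, LinearMap.id_apply, LinearMap.comp_apply, ofConv_toConv,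
          Algebra.linearMap_apply, ← Algebra.smul_def]
        change f (b * d) • (a * c) = (u b • a) * (f d • c) + (f b • a) * (v d • c)
        rw [h', add_smul, smul_mul_smul_comm, smul_mul_smul_comm]
  have := key (Coalgebra.comul a) (Coalgebra.comul b)
  rw [← Bialgebra.comul_mul] at this
  exact this

theorem actL_algHom (u : B →ₐ[L] L) (a b : B) : actL (toConv u.toLinearMap) (a * b) =
    actL (toConv u.toLinearMap) a * actL (toConv u.toLinearMap) b := by
  have := actL_skew (f := toConv u.toLinearMap) (u := toConv u.toLinearMap) (v := 0)
    (fun a b => by simp) a b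
  rw [this]
  have h0 : actL (0 : WithConv (B →ₗ[L] L)) = 0 := map_zero actLLin
  simp [h0]

theorem actR_algHom (u : B →ₐ[L] L) (a b : B) : actR (toConv u.toLinearMap) (a * b) =
    actR (toConv u.toLinearMap) a * actR (toConv u.toLinearMap) b := by
  have := actR_skew (f := toConv u.toLinearMap) (u := toConv u.toLinearMap) (v := 0)
    (fun a b => by simp) a b
  rw [this]
  have h0 : actR (0 : WithConv (B →ₗ[L] L)) = 0 := map_zero actRLin
  simp [h0]

end SkewActions

open WithConv UqBMinus

theorem pairing_K : pairing q (UqBPlus.K q : UqBPlus q) = toConv (chi q).toLinearMap :=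
  UqBPlus.lift_K _ _ _

theorem pairing_Kinv : pairing q ((UqBPlus.K q)⁻¹ : (UqBPlus q)ˣ) =
    toConv (chiInv q).toLinearMap :=
  UqBPlus.lift_Kinv _ _ _

theorem pairing_E : pairing q (UqBPlus.E q) = toConv (pairE q) := UqBPlus.lift_E _ _ _

theorem lam_K : lam q (UqBPlus.K q : UqBPlus q) = actL (toConv (chi q).toLinearMap) :=
  congrArg actL (pairing_K q)

theorem lam_Kinv : lam q ((UqBPlus.K q)⁻¹ : (UqBPlus q)ˣ) =
    actL (toConv (chiInv q).toLinearMap) :=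
  congrArg actL (pairing_Kinv q)

theorem lam_E : lam q (UqBPlus.E q) = actL (toConv (pairE q)) := congrArg actL (pairing_E q)

theorem rho_K : rho q (UqBPlus.K q : UqBPlus q) = actR (toConv (chiInv q).toLinearMap) := by
  refine congrArg actR (Eq.trans ?_ (pairing_Kinv q))
  exact congrArg (fun x : (UqBPlus q)ᵐᵒᵖ => pairing q x.unop) (UqBPlus.lift_K _ _ _)

theorem rho_Kinv : rho q ((UqBPlus.K q)⁻¹ : (UqBPlus q)ˣ) =
    actR (toConv (chi q).toLinearMap) := by
  refine congrArg actR (Eq.trans ?_ (pairing_K q))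
  exact congrArg (fun x : (UqBPlus q)ᵐᵒᵖ => pairing q x.unop) (UqBPlus.lift_Kinv _ _ _)

theorem rho_E : rho q (UqBPlus.E q) =
    actR (-(toConv (pairE q) * toConv (chiInv q).toLinearMap)) := by
  refine congrArg actR ?_
  refine (congrArg (fun x : (UqBPlus q)ᵐᵒᵖ => pairing q x.unop) (UqBPlus.lift_E _ _ _)).trans ?_
  rw [MulOpposite.unop_op, map_neg, map_mul, pairing_E, pairing_Kinv]

theorem pairEInv_mul (a b : UqBMinus q) :
    (-(toConv (pairE q) * toConv (chiInv q).toLinearMap)) (a * b) =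
      (1 : WithConv (UqBMinus q →ₗ[L] L)) a *
        (-(toConv (pairE q) * toConv (chiInv q).toLinearMap)) b +
      (-(toConv (pairE q) * toConv (chiInv q).toLinearMap)) a *
        (toConv (chiInv q).toLinearMap) b := by
  have key : ∀ x y : UqBMinus q ⊗[L] UqBMinus q,
      LinearMap.mul' L L (TensorProduct.map (pairE q) (chiInv q).toLinearMap (x * y)) =
        LinearMap.mul' L L (TensorProduct.map (chi q).toLinearMap (chiInv q).toLinearMap x) *
          LinearMap.mul' L L (TensorProduct.map (pairE q) (chiInv q).toLinearMap y) +
        LinearMap.mul' L L (TensorProduct.map (pairE q) (chiInv q).toLinearMap x) *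
          LinearMap.mul' L L (TensorProduct.map (Coalgebra.counit (R := L))
            (chiInv q).toLinearMap y) := by
    intro x y
    induction x with
    | zero => simp
    | add a b ha hb => rw [add_mul, map_add, map_add, ha, hb]; simp; ring
    | tmul a b =>
      induction y with
      | zero => simp
      | add c d hc hd => rw [mul_add, map_add, map_add, hc, hd]; simp; ring
      | tmul c d => simp [pairE_mul]; ring
  have h1 : LinearMap.mul' L L (TensorProduct.map (chi q).toLinearMap (chiInv q).toLinearMap
      (Coalgebra.comul a)) = (1 : WithConv (UqBMinus q →ₗ[L] L)) a :=
    congrArg (fun f : WithConv (UqBMinus q →ₗ[L] L) => f a) (chiUnit q).val_inv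
  have h2 : LinearMap.mul' L L (TensorProduct.map
      (Coalgebra.counit (R := L)) (chiInv q).toLinearMap (Coalgebra.comul b)) = chiInv q b :=
    congrArg (fun f : WithConv (UqBMinus q →ₗ[L] L) => f b)
      (one_mul (toConv (chiInv q).toLinearMap))
  have := key (Coalgebra.comul a) (Coalgebra.comul b)
  rw [← Bialgebra.comul_mul, h1, h2] at this
  change -(LinearMap.mul' L L _) = _ * -(LinearMap.mul' L L _) + -(LinearMap.mul' L L _) * _
  refine (congrArg (fun t => -t) this).trans ?_
  rw [neg_add, mul_neg, neg_mul]
  rfl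

/-! ### The quantum double as an algebra -/

/-- The algebraic quantum double `D(U_q(b₊), U_q(b₋))`, with underlying space
`U_q(b₋) ⊗ U_q(b₊)`. -/
def Double (q : Lˣ) : Type u := UqBMinus q ⊗[L] UqBPlus q

instance : AddCommGroup (Double q) := inferInstanceAs (AddCommGroup (UqBMinus q ⊗[L] UqBPlus q))
instance : Module L (Double q) := inferInstanceAs (Module L (UqBMinus q ⊗[L] UqBPlus q))

/-- Left multiplication by `b ⊗ 1`. -/
def leftB (q : Lˣ) : UqBMinus q →ₐ[L] Module.End L (UqBMinus q ⊗[L] UqBPlus q) :=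
  (onB q).comp (Algebra.lmul L (UqBMinus q))

@[simp] theorem leftB_tmul (b b' : UqBMinus q) (a : UqBPlus q) :
    leftB q b (b' ⊗ₜ[L] a) = (b * b') ⊗ₜ[L] a := rfl

/-- The product of the quantum double,
`(b ⊗ a)(b' ⊗ a') = ∑ b b'₍₂₎ σ̄(a₍₁₎, b'₍₁₎) σ(a₍₃₎, b'₍₃₎) ⊗ a₍₂₎ a'`,
as the linear map sending an element to its left multiplication operator. -/
def doubleMul (q : Lˣ) : UqBMinus q ⊗[L] UqBPlus q →ₗ[L]
    Module.End L (UqBMinus q ⊗[L] UqBPlus q) :=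
  TensorProduct.lift ((LinearMap.mul L (Module.End L (UqBMinus q ⊗[L] UqBPlus q))).compl₁₂
    (leftB q).toLinearMap (crossAct q).toLinearMap)

@[simp] theorem doubleMul_tmul (b : UqBMinus q) (a : UqBPlus q) :
    doubleMul q (b ⊗ₜ a) = leftB q b * crossAct q a := rfl

theorem crossAct_mul_leftB_groupLike (g : UqBPlus q)
    (hg : Coalgebra.comul (R := L) g = g ⊗ₜ g)
    (hl : ∀ b b', lam q g (b * b') = lam q g b * lam q g b')
    (hr : ∀ b b', rho q g (b * b') = rho q g b * rho q g b') (b : UqBMinus q) :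
    crossAct q g * leftB q b = leftB q (rho q g (lam q g b)) * crossAct q g := by
  apply TensorProduct.ext'
  intro b' a'
  rw [Module.End.mul_apply, Module.End.mul_apply, leftB_tmul, crossAct_groupLike q g hg,
    crossAct_groupLike q g hg, leftB_tmul, hl, hr]

theorem lam_E_mul (b b' : UqBMinus q) : lam q (UqBPlus.E q) (b * b') =
    lam q (UqBPlus.K q : UqBPlus q) b * lam q (UqBPlus.E q) b' + lam q (UqBPlus.E q) b * b' := by
  rw [lam_K, lam_E]
  have := actL_skew (f := toConv (pairE q)) (u := toConv (chi q).toLinearMap) (v := 1)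
    (fun a b => pairE_mul a b) b b'
  rwa [actL_one] at this

theorem rho_E_mul (b b' : UqBMinus q) : rho q (UqBPlus.E q) (b * b') =
    b * rho q (UqBPlus.E q) b' +
      rho q (UqBPlus.E q) b * rho q (UqBPlus.K q : UqBPlus q) b' := by
  rw [rho_K, rho_E]
  have := actR_skew (pairEInv_mul q) b b'
  rwa [actR_one] at this

theorem crossAct_E_mul_leftB (b : UqBMinus q) :
    crossAct q (UqBPlus.E q) * leftB q b =
      leftB q (rho q (UqBPlus.E q) (lam q (UqBPlus.K q : UqBPlus q) b)) *
        crossAct q (UqBPlus.K q : UqBPlus q) +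
      leftB q (lam q (UqBPlus.K q : UqBPlus q) b) * crossAct q (UqBPlus.E q) +
      leftB q (lam q (UqBPlus.E q) b) := by
  have h1 : ∀ b b', lam q (UqBPlus.K q : UqBPlus q) (b * b') =
      lam q (UqBPlus.K q : UqBPlus q) b * lam q (UqBPlus.K q : UqBPlus q) b' := by
    intro b b'; rw [lam_K]; exact actL_algHom _ _ _
  apply TensorProduct.ext'
  intro b' a'
  simp only [LinearMap.add_apply, Module.End.mul_apply, leftB_tmul, crossAct_E,
    crossAct_groupLike q _ (UqBPlus.comul_K q), h1, lam_E_mul, rho_E_mul, map_add,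
    TensorProduct.add_tmul]
  abel

theorem doubleMul_crossAct (a : UqBPlus q) (y : UqBMinus q ⊗[L] UqBPlus q) :
    doubleMul q (crossAct q a y) = crossAct q a * doubleMul q y := by
  let S : Subalgebra L (UqBPlus q) :=
    { carrier := {a | ∀ y, doubleMul q (crossAct q a y) = crossAct q a * doubleMul q y}
      mul_mem' := by
        intro a b ha hb y
        rw [map_mul, Module.End.mul_apply, ha, hb, mul_assoc]
      add_mem' := by
        intro a b ha hb y
        rw [map_add, LinearMap.add_apply, map_add, ha, hb, add_mul]
      algebraMap_mem' := by
        intro r y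
        simp [Algebra.algebraMap_eq_smul_one] }
  have hgl : ∀ g : UqBPlus q, Coalgebra.comul (R := L) g = g ⊗ₜ g →
      (∀ b b', lam q g (b * b') = lam q g b * lam q g b') →
      (∀ b b', rho q g (b * b') = rho q g b * rho q g b') → g ∈ S := by
    intro g h1 h2 h3 y
    induction y with
    | zero => simp
    | add c d hc hd => rw [map_add, map_add, hc, hd, map_add, mul_add]
    | tmul b a' =>
      rw [crossAct_groupLike q g h1, doubleMul_tmul, doubleMul_tmul, ← mul_assoc,
        crossAct_mul_leftB_groupLike q g h1 h2 h3, map_mul, mul_assoc]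
  have hS : S = ⊤ := by
    apply UqBPlus.eq_top
    · exact hgl _ (UqBPlus.comul_K q) (fun b b' => by rw [lam_K]; exact actL_algHom _ _ _)
        (fun b b' => by rw [rho_K]; exact actR_algHom _ _ _)
    · exact hgl _ (UqBPlus.comul_Kinv q) (fun b b' => by rw [lam_Kinv]; exact actL_algHom _ _ _)
        (fun b b' => by rw [rho_Kinv]; exact actR_algHom _ _ _)
    · intro y
      induction y with
      | zero => simp
      | add c d hc hd => rw [map_add, map_add, hc, hd, map_add, mul_add]
      | tmul b a' =>
        rw [crossAct_E, map_add, map_add, doubleMul_tmul, doubleMul_tmul, doubleMul_tmul,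
          doubleMul_tmul, ← mul_assoc, crossAct_E_mul_leftB, map_mul, map_mul]
        simp only [add_mul, mul_assoc]
  have : a ∈ S := hS ▸ Algebra.mem_top
  exact this y

theorem doubleMul_mul (x y : UqBMinus q ⊗[L] UqBPlus q) :
    doubleMul q (doubleMul q x y) = doubleMul q x * doubleMul q y := by
  induction x with
  | zero => simp
  | add c d hc hd => rw [map_add, LinearMap.add_apply, map_add, hc, hd, add_mul]
  | tmul b a =>
    rw [doubleMul_tmul, Module.End.mul_apply, mul_assoc, ← doubleMul_crossAct]
    generalize crossAct q a y = z
    induction z with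
    | zero => simp
    | add c d hc hd => rw [map_add, map_add, hc, hd, map_add, mul_add]
    | tmul b' a' => rw [leftB_tmul, doubleMul_tmul, doubleMul_tmul, map_mul, mul_assoc]

theorem actL_apply_one (f : WithConv (UqBMinus q →ₗ[L] L)) : actL f 1 = f 1 • 1 := by
  change LinearMap.mul' L _ (TensorProduct.map _ _ (Coalgebra.comul (1 : UqBMinus q))) = _
  rw [Bialgebra.comul_one, Algebra.TensorProduct.one_def]
  simp [eta, Algebra.algebraMap_eq_smul_one]

theorem actR_apply_one (f : WithConv (UqBMinus q →ₗ[L] L)) : actR f 1 = f 1 • 1 := by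
  change LinearMap.mul' L _ (TensorProduct.map _ _ (Coalgebra.comul (1 : UqBMinus q))) = _
  rw [Bialgebra.comul_one, Algebra.TensorProduct.one_def]
  simp [eta, Algebra.algebraMap_eq_smul_one]

theorem pairE_one : pairE q 1 = 0 := by
  simpa using pairE_mul (1 : UqBMinus q) 1

theorem crossAct_one (a : UqBPlus q) (a' : UqBPlus q) :
    crossAct q a (1 ⊗ₜ a') = 1 ⊗ₜ (a * a') := by
  have hu : ∀ u : UqBMinus q →ₐ[L] L, (toConv u.toLinearMap) (1 : UqBMinus q) = 1 :=
    fun u => map_one u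
  have hE : (toConv (pairE q)) (1 : UqBMinus q) = 0 := pairE_one q
  have hE' : (-(toConv (pairE q) * toConv (chiInv q).toLinearMap)) (1 : UqBMinus q) = 0 := by
    have := pairEInv_mul q 1 1
    rwa [hu, mul_one, mul_one, LinearMap.convOne_apply, Bialgebra.counit_one,
      (algebraMap L L).map_one, one_mul, left_eq_add] at this
  let S : Subalgebra L (UqBPlus q) :=
    { carrier := {a | ∀ a', crossAct q a (1 ⊗ₜ a') = 1 ⊗ₜ (a * a')}
      mul_mem' := by
        intro a b ha hb a'
        rw [map_mul, Module.End.mul_apply, hb, ha, mul_assoc]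
      add_mem' := by
        intro a b ha hb a'
        rw [map_add, LinearMap.add_apply, ha, hb, add_mul, TensorProduct.tmul_add]
      algebraMap_mem' := by
        intro r a'
        simp [Algebra.algebraMap_eq_smul_one] }
  have hS : S = ⊤ := by
    apply UqBPlus.eq_top
    · intro a'
      rw [crossAct_groupLike q _ (UqBPlus.comul_K q), lam_K, rho_K, actL_apply_one, hu, one_smul,
        actR_apply_one, hu, one_smul]
    · intro a'
      rw [crossAct_groupLike q _ (UqBPlus.comul_Kinv q), lam_Kinv, rho_Kinv, actL_apply_one, hu,
        one_smul, actR_apply_one, hu, one_smul]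
    · intro a'
      rw [crossAct_E, lam_K, lam_E, rho_E, actL_apply_one, hu, one_smul, actL_apply_one, hE,
        actR_apply_one, hE']
      simp
  have : a ∈ S := hS ▸ Algebra.mem_top
  exact this a'

theorem doubleMul_one (x : UqBMinus q ⊗[L] UqBPlus q) : doubleMul q x (1 ⊗ₜ 1) = x := by
  induction x with
  | zero => simp
  | add c d hc hd => rw [map_add, LinearMap.add_apply, hc, hd]
  | tmul b a =>
    rw [doubleMul_tmul, Module.End.mul_apply, crossAct_one, leftB_tmul, mul_one, mul_one]

instance : Ring (Double q) :=
  { (inferInstance : AddCommGroup (Double q)) with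
    mul := fun x y => doubleMul q x y
    one := (1 : UqBMinus q) ⊗ₜ[L] (1 : UqBPlus q)
    left_distrib := fun x y z => map_add (doubleMul q x) y z
    right_distrib := fun x y z => LinearMap.map_add₂ (doubleMul q) x y z
    zero_mul := fun x => LinearMap.map_zero₂ (doubleMul q) x
    mul_zero := fun x => map_zero (doubleMul q x)
    mul_assoc := fun x y z => congrArg (fun f => f z) (doubleMul_mul q x y)
    one_mul := fun x => congrArg (fun f => f x)
      (show doubleMul q (1 ⊗ₜ 1) = 1 by rw [doubleMul_tmul, map_one, map_one, one_mul])
    mul_one := fun x => doubleMul_one q x }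

instance : Algebra L (Double q) :=
  Algebra.ofModule (fun r x y => LinearMap.map_smul₂ (doubleMul q) r x y)
    (fun r x y => map_smul (doubleMul q x) r y)

end Borel

/-! ### Gauss norms -/

section GaussNorm

variable {L : Type u} [NormedField L] {ι ι' ι'' : Type*} {V V' V'' : Type*}
  [AddCommGroup V] [Module L V] [AddCommGroup V'] [Module L V'] [AddCommGroup V''] [Module L V'']

/-- `x` is a finite combination `∑ cᵢ vᵢ` with `|cᵢ| wᵢ ≤ r` for all `i`. -/
def GaussLE (v : ι → V) (w : ι → ℝ≥0) (r : ℝ≥0) (x : V) : Prop :=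
  ∃ c : ι →₀ L, Finsupp.linearCombination L v c = x ∧ ∀ i, ‖c i‖₊ * w i ≤ r

/-- The weighted Gauss norm: if the `vᵢ` form a basis, then `∑ cᵢ vᵢ` has norm
`max |cᵢ| wᵢ`. -/
def gaussNorm (L : Type u) [NormedField L] [Module L V] (v : ι → V) (w : ι → ℝ≥0) (x : V) : ℝ≥0 :=
  sInf {r | GaussLE (L := L) v w r x}

variable {v : ι → V} {w : ι → ℝ≥0} {v' : ι' → V'} {w' : ι' → ℝ≥0} {v'' : ι'' → V''}
  {w'' : ι'' → ℝ≥0} {r s : ℝ≥0} {x y : V}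

theorem GaussLE.mono (h : GaussLE (L := L) v w r x) (hrs : r ≤ s) : GaussLE (L := L) v w s x := by
  obtain ⟨c, hc, hb⟩ := h
  exact ⟨c, hc, fun i => (hb i).trans hrs⟩

theorem GaussLE.zero : GaussLE (L := L) v w r 0 := ⟨0, by simp, by simp⟩

theorem GaussLE.smul (a : L) (h : GaussLE (L := L) v w r x) :
    GaussLE (L := L) v w (‖a‖₊ * r) (a • x) := by
  obtain ⟨c, hc, hb⟩ := h
  refine ⟨a • c, by rw [map_smul, hc], fun i => ?_⟩
  rw [Finsupp.smul_apply, smul_eq_mul, nnnorm_mul, mul_assoc]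
  gcongr
  exact hb i

theorem GaussLE.single (i : ι) : GaussLE (L := L) v w (w i) (v i) := by
  classical
  refine ⟨Finsupp.single i 1, by simp, fun j => ?_⟩
  by_cases h : i = j
  · subst h; simp
  · simp [h]

theorem GaussLE.add [IsUltrametricDist L] (hx : GaussLE (L := L) v w r x)
    (hy : GaussLE (L := L) v w r y) : GaussLE (L := L) v w r (x + y) := by
  obtain ⟨c, hc, hb⟩ := hx
  obtain ⟨d, hd, hb'⟩ := hy
  refine ⟨c + d, by rw [map_add, hc, hd], fun i => ?_⟩
  rcases le_total ‖c i‖₊ ‖d i‖₊ with h | h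
  · refine le_trans ?_ (hb' i)
    gcongr
    exact (IsUltrametricDist.nnnorm_add_le_max (c i) (d i)).trans (max_le h le_rfl)
  · refine le_trans ?_ (hb i)
    gcongr
    exact (IsUltrametricDist.nnnorm_add_le_max (c i) (d i)).trans (max_le le_rfl h)

theorem GaussLE.map [IsUltrametricDist L] (X : V →ₗ[L] V') (C : ℝ≥0)
    (hX : ∀ i, GaussLE (L := L) v' w' (C * w i) (X (v i))) (hx : GaussLE (L := L) v w r x) :
    GaussLE (L := L) v' w' (C * r) (X x) := by
  obtain ⟨c, rfl, hb⟩ := hx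
  rw [Finsupp.linearCombination_apply, Finsupp.sum, map_sum]
  refine Finset.sum_induction _ (GaussLE (L := L) v' w' (C * r)) (fun _ _ => GaussLE.add)
    GaussLE.zero fun i _ => ?_
  rw [map_smul]
  refine ((hX i).smul (c i)).mono ?_
  rw [mul_left_comm]
  gcongr
  exact hb i

theorem GaussLE.map₂ [IsUltrametricDist L] (X : V →ₗ[L] V' →ₗ[L] V'')
    (hX : ∀ i j, GaussLE (L := L) v'' w'' (w i * w' j) (X (v i) (v' j)))
    (hx : GaussLE (L := L) v w r x) {x' : V'} (hx' : GaussLE (L := L) v' w' s x') :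
    GaussLE (L := L) v'' w'' (r * s) (X x x') := by
  have h1 : ∀ i, GaussLE (L := L) v'' w'' (s * w i) (X.flip x' (v i)) := fun i => by
    rw [mul_comm]
    exact GaussLE.map (X (v i)) (w i) (hX i) hx'
  rw [mul_comm]
  exact GaussLE.map (X.flip x') s h1 hx

theorem gaussNorm_le (h : GaussLE (L := L) v w r x) : gaussNorm L v w x ≤ r :=
  csInf_le (OrderBot.bddBelow _) h

theorem GaussLE.of_lt (hs : ∃ t, GaussLE (L := L) v w t x) (h : gaussNorm L v w x < r) :
    GaussLE (L := L) v w r x := by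
  obtain ⟨t, ht, htr⟩ := exists_lt_of_csInf_lt hs h
  exact GaussLE.mono ht htr.le

end GaussNorm

/-- The standing data: `q ∈ L` with `|q| = 1` and `q ≠ q⁻¹`, and a radius
`R ∈ |L|` with `R > |(q⁻¹ - q)⁻¹|`. -/
structure Datum (L : Type u) [NormedField L] where
  q : Lˣ
  R : ℝ≥0
  norm_q : ‖(q : L)‖ = 1
  q_ne_inv : ((q⁻¹ : Lˣ) : L) - (q : L) ≠ 0
  R_mem : ∃ s : L, ‖s‖ = R
  lt_R : ‖(((q⁻¹ : Lˣ) : L) - (q : L))⁻¹‖ < R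

section DoubleNorm

variable {L : Type u} [NormedField L]

/-- The monomials `F^i K₋^j` of `U_q(b₋)`. -/
def monB (q : Lˣ) (n : ℕ × ℤ) : UqBMinus q :=
  UqBMinus.F q ^ n.1 * ((UqBMinus.K q ^ n.2 : (UqBMinus q)ˣ) : UqBMinus q)

/-- The monomials `E^i K^j` of `U_q(b₊)`. -/
def monA (q : Lˣ) (n : ℕ × ℤ) : UqBPlus q :=
  UqBPlus.E q ^ n.1 * ((UqBPlus.K q ^ n.2 : (UqBPlus q)ˣ) : UqBPlus q)

/-- The monomials `F^i K₋^j ⊗ E^k K^l` of the double. -/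
def monD (q : Lˣ) (n : (ℕ × ℤ) × (ℕ × ℤ)) : UqBMinus q ⊗[L] UqBPlus q :=
  monB q n.1 ⊗ₜ monA q n.2

/-- The weight of a monomial of `U_q(b_±, R)`. -/
def wt (R : ℝ≥0) (n : ℕ × ℤ) : ℝ≥0 := R ^ n.1

/-- The weight of a monomial of the double: the product of the weights. -/
def wtD (R : ℝ≥0) (n : (ℕ × ℤ) × (ℕ × ℤ)) : ℝ≥0 := wt R n.1 * wt R n.2


variable (P : Datum L)

namespace Datum

theorem nnnorm_q : ‖(P.q : L)‖₊ = 1 := by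
  ext; simpa using P.norm_q

theorem nnnorm_q_inv : ‖((P.q⁻¹ : Lˣ) : L)‖₊ = 1 := by
  rw [Units.val_inv_eq_inv_val, nnnorm_inv, nnnorm_q, inv_one]

/-- The value `⟨E, F⟩`. -/
def c : L := (((P.q⁻¹ : Lˣ) : L) - (P.q : L))⁻¹

variable [IsUltrametricDist L]

theorem one_le_R : 1 ≤ P.R := by
  have h1 : ‖((P.q⁻¹ : Lˣ) : L) - (P.q : L)‖₊ ≤ 1 := by
    have := IsUltrametricDist.nnnorm_add_le_max ((P.q⁻¹ : Lˣ) : L) (-(P.q : L))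
    rwa [nnnorm_neg, nnnorm_q, nnnorm_q_inv, max_self, ← sub_eq_add_neg] at this
  have h2 : ‖(((P.q⁻¹ : Lˣ) : L) - (P.q : L))⁻¹‖₊ < P.R := by
    have := P.lt_R
    exact_mod_cast this
  rw [nnnorm_inv] at h2
  refine le_trans ?_ h2.le
  exact (one_le_inv₀ (by simpa [pos_iff_ne_zero] using P.q_ne_inv)).2 h1

theorem nnnorm_c_le : ‖P.c‖₊ ≤ P.R * P.R := by
  have h2 : ‖P.c‖₊ < P.R := by
    have := P.lt_R
    exact_mod_cast this
  calc ‖P.c‖₊ ≤ P.R := h2.le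
    _ = 1 * P.R := (one_mul _).symm
    _ ≤ _ := by gcongr; exact P.one_le_R

end Datum

open UqBMinus WithConv

theorem pairE_K (q : Lˣ) : pairE q (K q : UqBMinus q) = 0 := by
  change pairRep q _ 0 1 = 0; simp [pairRep, diagUnit]

theorem pairE_Kinv (q : Lˣ) : pairE q ((K q)⁻¹ : (UqBMinus q)ˣ) = 0 := by
  change pairRep q _ 0 1 = 0; simp [pairRep, diagUnit]

theorem pairE_F (q : Lˣ) : pairE q (F q) = (((q⁻¹ : Lˣ) : L) - (q : L))⁻¹ := by
  change pairRep q _ 0 1 = _; simp [pairRep]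

theorem actL_K (q : Lˣ) (f : WithConv (UqBMinus q →ₗ[L] L)) :
    actL f (K q : UqBMinus q) = f (K q : UqBMinus q) • (K q : UqBMinus q) := by
  change LinearMap.mul' L _ (TensorProduct.map _ _ (Coalgebra.comul _)) = _
  rw [comul_K]
  simp [eta, Algebra.smul_def, Algebra.commutes]

theorem actR_K (q : Lˣ) (f : WithConv (UqBMinus q →ₗ[L] L)) :
    actR f (K q : UqBMinus q) = f (K q : UqBMinus q) • (K q : UqBMinus q) := by
  change LinearMap.mul' L _ (TensorProduct.map _ _ (Coalgebra.comul _)) = _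
  rw [comul_K]
  simp [eta, Algebra.smul_def]

theorem actL_Kinv (q : Lˣ) (f : WithConv (UqBMinus q →ₗ[L] L)) :
    actL f ((K q)⁻¹ : (UqBMinus q)ˣ) =
      f ((K q)⁻¹ : (UqBMinus q)ˣ) • (((K q)⁻¹ : (UqBMinus q)ˣ) : UqBMinus q) := by
  change LinearMap.mul' L _ (TensorProduct.map _ _ (Coalgebra.comul _)) = _
  rw [comul_Kinv]
  simp [eta, Algebra.smul_def, Algebra.commutes]

theorem actR_Kinv (q : Lˣ) (f : WithConv (UqBMinus q →ₗ[L] L)) :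
    actR f ((K q)⁻¹ : (UqBMinus q)ˣ) =
      f ((K q)⁻¹ : (UqBMinus q)ˣ) • (((K q)⁻¹ : (UqBMinus q)ˣ) : UqBMinus q) := by
  change LinearMap.mul' L _ (TensorProduct.map _ _ (Coalgebra.comul _)) = _
  rw [comul_Kinv]
  simp [eta, Algebra.smul_def]

theorem actL_F (q : Lˣ) (f : WithConv (UqBMinus q →ₗ[L] L)) :
    actL f (F q) = f 1 • F q + f (F q) • (((K q)⁻¹ : (UqBMinus q)ˣ) : UqBMinus q) := by
  change LinearMap.mul' L _ (TensorProduct.map _ _ (Coalgebra.comul _)) = _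
  rw [comul_F]
  simp [eta, Algebra.smul_def, Algebra.commutes]

theorem actR_F (q : Lˣ) (f : WithConv (UqBMinus q →ₗ[L] L)) :
    actR f (F q) = f (F q) • 1 + f ((K q)⁻¹ : (UqBMinus q)ˣ) • F q := by
  change LinearMap.mul' L _ (TensorProduct.map _ _ (Coalgebra.comul _)) = _
  rw [comul_F]
  simp [eta, Algebra.smul_def]

theorem K_mul_F_pow (q : Lˣ) (n : ℕ) : (K q : UqBMinus q) * F q ^ n =
    (((q⁻¹ : Lˣ) : L) ^ 2) ^ n • (F q ^ n * K q) := by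
  induction n with
  | zero => simp
  | succ n ih =>
    rw [pow_succ, ← mul_assoc, ih, smul_mul_assoc, mul_assoc, K_mul_F, mul_smul_comm, smul_smul,
      ← pow_succ, mul_assoc]

theorem Kinv_mul_F_pow (q : Lˣ) (n : ℕ) : (((K q)⁻¹ : (UqBMinus q)ˣ) : UqBMinus q) * F q ^ n =
    ((q : L) ^ 2) ^ n • (F q ^ n * ((K q)⁻¹ : (UqBMinus q)ˣ)) := by
  induction n with
  | zero => simp
  | succ n ih =>
    rw [pow_succ, ← mul_assoc, ih, smul_mul_assoc, mul_assoc, Kinv_mul_F, mul_smul_comm, smul_smul,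
      ← pow_succ, mul_assoc]

theorem E_K_mul_pow (q : Lˣ) (n : ℕ) : (UqBPlus.K q : UqBPlus q) * UqBPlus.E q ^ n =
    ((q : L) ^ 2) ^ n • (UqBPlus.E q ^ n * UqBPlus.K q) := by
  induction n with
  | zero => simp
  | succ n ih =>
    rw [pow_succ, ← mul_assoc, ih, smul_mul_assoc, mul_assoc, UqBPlus.K_mul_E, mul_smul_comm,
      smul_smul, ← pow_succ, mul_assoc]

theorem E_Kinv_mul_pow (q : Lˣ) (n : ℕ) :
    (((UqBPlus.K q)⁻¹ : (UqBPlus q)ˣ) : UqBPlus q) * UqBPlus.E q ^ n =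
    (((q⁻¹ : Lˣ) : L) ^ 2) ^ n • (UqBPlus.E q ^ n * ((UqBPlus.K q)⁻¹ : (UqBPlus q)ˣ)) := by
  have h := E_K_mul_pow q n
  have h0 : (((q⁻¹ : Lˣ) : L) ^ 2) ^ n * ((q : L) ^ 2) ^ n = 1 := by
    rw [← mul_pow, ← mul_pow]; simp
  have h2 : UqBPlus.E q ^ n * (UqBPlus.K q : UqBPlus q) =
      (((q⁻¹ : Lˣ) : L) ^ 2) ^ n • ((UqBPlus.K q : UqBPlus q) * UqBPlus.E q ^ n) := by
    rw [h, smul_smul, h0, one_smul]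
  rw [← Units.mul_inv_cancel_right (_ * UqBPlus.E q ^ n) (UqBPlus.K q),
    mul_assoc _ (UqBPlus.E q ^ n), h2, mul_smul_comm, Units.inv_mul_cancel_left, smul_mul_assoc]

/-- Bounds in `U_q(b₋)`. -/
abbrev LEB (r : ℝ≥0) (b : UqBMinus P.q) : Prop := GaussLE (L := L) (monB P.q) (wt P.R) r b
/-- Bounds in `U_q(b₊)`. -/
abbrev LEA (r : ℝ≥0) (a : UqBPlus P.q) : Prop := GaussLE (L := L) (monA P.q) (wt P.R) r a
/-- Bounds in the double. -/
abbrev LED (r : ℝ≥0) (x : UqBMinus P.q ⊗[L] UqBPlus P.q) : Prop :=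
  GaussLE (L := L) (monD P.q) (wtD P.R) r x

variable {P} [IsUltrametricDist L] {r s : ℝ≥0}

theorem LEB.tmul {b : UqBMinus P.q} {a : UqBPlus P.q} (hb : LEB P r b) (ha : LEA P s a) :
    LED P (r * s) (b ⊗ₜ a) :=
  GaussLE.map₂ (TensorProduct.mk L _ _) (fun i j => GaussLE.single (v := monD P.q)
    (w := wtD P.R) (i, j)) hb ha

theorem LEB.mul_K {b : UqBMinus P.q} (hb : LEB P r b) (j : ℤ) :
    LEB P r (b * ((K P.q ^ j : (UqBMinus P.q)ˣ) : UqBMinus P.q)) := by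
  rw [← one_mul r]
  refine GaussLE.map ((LinearMap.mul L (UqBMinus P.q)).flip _) 1 (fun i => ?_) hb
  rw [one_mul]
  have : monB P.q i * ((K P.q ^ j : (UqBMinus P.q)ˣ) : UqBMinus P.q) =
      monB P.q (i.1, i.2 + j) := by
    simp [monB, mul_assoc, zpow_add]
  rw [LinearMap.flip_apply, LinearMap.mul_apply', this]
  exact GaussLE.single (i.1, i.2 + j)

theorem LEB.F_mul {b : UqBMinus P.q} (hb : LEB P r b) : LEB P (P.R * r) (F P.q * b) := by
  refine GaussLE.map (LinearMap.mul L (UqBMinus P.q) (F P.q)) P.R (fun i => ?_) hb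
  have : F P.q * monB P.q i = monB P.q (i.1 + 1, i.2) := by
    simp [monB, pow_succ', mul_assoc]
  rw [LinearMap.mul_apply', this]
  refine (GaussLE.single (i.1 + 1, i.2)).mono ?_
  simp [wt, pow_succ']

theorem LEB.K_mul {b : UqBMinus P.q} (hb : LEB P r b) : LEB P r ((K P.q : UqBMinus P.q) * b) := by
  rw [← one_mul r]
  refine GaussLE.map (LinearMap.mul L (UqBMinus P.q) (K P.q : UqBMinus P.q)) 1 (fun i => ?_) hb
  rw [LinearMap.mul_apply', monB, ← mul_assoc, K_mul_F_pow, smul_mul_assoc]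
  have h1 : LEB P (wt P.R i) (F P.q ^ i.1 * (K P.q : UqBMinus P.q) *
      ((K P.q ^ i.2 : (UqBMinus P.q)ˣ) : UqBMinus P.q)) := by
    have := LEB.mul_K (P := P) (GaussLE.single (i.1, 1)) i.2
    simpa [monB, wt] using this
  have := h1.smul ((((P.q⁻¹ : Lˣ) : L) ^ 2) ^ i.1)
  simpa [P.nnnorm_q] using this

theorem LEB.Kinv_mul {b : UqBMinus P.q} (hb : LEB P r b) :
    LEB P r ((((K P.q)⁻¹ : (UqBMinus P.q)ˣ) : UqBMinus P.q) * b) := by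
  rw [← one_mul r]
  refine GaussLE.map (LinearMap.mul L (UqBMinus P.q)
    (((K P.q)⁻¹ : (UqBMinus P.q)ˣ) : UqBMinus P.q)) 1 (fun i => ?_) hb
  rw [LinearMap.mul_apply', monB, ← mul_assoc, Kinv_mul_F_pow, smul_mul_assoc]
  have h1 : LEB P (wt P.R i) (F P.q ^ i.1 * (((K P.q)⁻¹ : (UqBMinus P.q)ˣ) : UqBMinus P.q) *
      ((K P.q ^ i.2 : (UqBMinus P.q)ˣ) : UqBMinus P.q)) := by
    have := LEB.mul_K (P := P) (GaussLE.single (i.1, -1)) i.2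
    simpa [monB, wt] using this
  have := h1.smul (((P.q : L) ^ 2) ^ i.1)
  simpa [P.nnnorm_q] using this

theorem LEA.mul_K {a : UqBPlus P.q} (ha : LEA P r a) (j : ℤ) :
    LEA P r (a * ((UqBPlus.K P.q ^ j : (UqBPlus P.q)ˣ) : UqBPlus P.q)) := by
  rw [← one_mul r]
  refine GaussLE.map ((LinearMap.mul L (UqBPlus P.q)).flip _) 1 (fun i => ?_) ha
  rw [one_mul]
  have : monA P.q i * ((UqBPlus.K P.q ^ j : (UqBPlus P.q)ˣ) : UqBPlus P.q) =
      monA P.q (i.1, i.2 + j) := by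
    simp [monA, mul_assoc, zpow_add]
  rw [LinearMap.flip_apply, LinearMap.mul_apply', this]
  exact GaussLE.single (i.1, i.2 + j)

theorem LEA.E_mul {a : UqBPlus P.q} (ha : LEA P r a) : LEA P (P.R * r) (UqBPlus.E P.q * a) := by
  refine GaussLE.map (LinearMap.mul L (UqBPlus P.q) (UqBPlus.E P.q)) P.R (fun i => ?_) ha
  have : UqBPlus.E P.q * monA P.q i = monA P.q (i.1 + 1, i.2) := by
    simp [monA, pow_succ', mul_assoc]
  rw [LinearMap.mul_apply', this]
  refine (GaussLE.single (i.1 + 1, i.2)).mono ?_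
  simp [wt, pow_succ']

theorem LEA.K_mul {a : UqBPlus P.q} (ha : LEA P r a) :
    LEA P r ((UqBPlus.K P.q : UqBPlus P.q) * a) := by
  rw [← one_mul r]
  refine GaussLE.map (LinearMap.mul L (UqBPlus P.q) (UqBPlus.K P.q : UqBPlus P.q)) 1
    (fun i => ?_) ha
  rw [LinearMap.mul_apply', monA, ← mul_assoc, E_K_mul_pow, smul_mul_assoc]
  have h1 : LEA P (wt P.R i) (UqBPlus.E P.q ^ i.1 * (UqBPlus.K P.q : UqBPlus P.q) *
      ((UqBPlus.K P.q ^ i.2 : (UqBPlus P.q)ˣ) : UqBPlus P.q)) := by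
    have := LEA.mul_K (P := P) (GaussLE.single (i.1, 1)) i.2
    simpa [monA, wt] using this
  have := h1.smul (((P.q : L) ^ 2) ^ i.1)
  simpa [P.nnnorm_q] using this

theorem LEA.Kinv_mul {a : UqBPlus P.q} (ha : LEA P r a) :
    LEA P r ((((UqBPlus.K P.q)⁻¹ : (UqBPlus P.q)ˣ) : UqBPlus P.q) * a) := by
  rw [← one_mul r]
  refine GaussLE.map (LinearMap.mul L (UqBPlus P.q)
    (((UqBPlus.K P.q)⁻¹ : (UqBPlus P.q)ˣ) : UqBPlus P.q)) 1 (fun i => ?_) ha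
  rw [LinearMap.mul_apply', monA, ← mul_assoc, E_Kinv_mul_pow, smul_mul_assoc]
  have h1 : LEA P (wt P.R i) (UqBPlus.E P.q ^ i.1 *
      (((UqBPlus.K P.q)⁻¹ : (UqBPlus P.q)ˣ) : UqBPlus P.q) *
      ((UqBPlus.K P.q ^ i.2 : (UqBPlus P.q)ˣ) : UqBPlus P.q)) := by
    have := LEA.mul_K (P := P) (GaussLE.single (i.1, -1)) i.2
    simpa [monA, wt] using this
  have := h1.smul ((((P.q⁻¹ : Lˣ) : L) ^ 2) ^ i.1)
  simpa [P.nnnorm_q] using this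

theorem LEB.zstep {h : Module.End L (UqBMinus P.q)} {c c' : L}
    (hK : ∀ b, h (b * (K P.q : UqBMinus P.q)) = c • (h b * (K P.q : UqBMinus P.q)))
    (hKi : ∀ b, h (b * (((K P.q)⁻¹ : (UqBMinus P.q)ˣ) : UqBMinus P.q)) =
      c' • (h b * (((K P.q)⁻¹ : (UqBMinus P.q)ˣ) : UqBMinus P.q)))
    (hc : ‖c‖₊ ≤ 1) (hc' : ‖c'‖₊ ≤ 1) {b : UqBMinus P.q} (hb : LEB P r (h b)) (j : ℤ) :
    LEB P r (h (b * ((K P.q ^ j : (UqBMinus P.q)ˣ) : UqBMinus P.q))) := by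
  induction j with
  | zero => simpa using hb
  | succ j ih =>
    rw [zpow_add_one, Units.val_mul, ← mul_assoc, hK]
    refine GaussLE.mono (GaussLE.smul c (by simpa using LEB.mul_K ih 1)) ?_
    exact mul_le_of_le_one_left (zero_le) hc
  | pred j ih =>
    rw [zpow_sub_one, Units.val_mul, ← mul_assoc, hKi]
    refine GaussLE.mono (GaussLE.smul c' (by simpa using LEB.mul_K ih (-1))) ?_
    exact mul_le_of_le_one_left (zero_le) hc'

theorem LEB.bound {h : Module.End L (UqBMinus P.q)} {c c' : L}
    (hK : ∀ b, h (b * (K P.q : UqBMinus P.q)) = c • (h b * (K P.q : UqBMinus P.q)))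
    (hKi : ∀ b, h (b * (((K P.q)⁻¹ : (UqBMinus P.q)ˣ) : UqBMinus P.q)) =
      c' • (h b * (((K P.q)⁻¹ : (UqBMinus P.q)ˣ) : UqBMinus P.q)))
    (hc : ‖c‖₊ ≤ 1) (hc' : ‖c'‖₊ ≤ 1) {C : ℝ≥0}
    (hF : ∀ n : ℕ, LEB P (C * P.R ^ n) (h (F P.q ^ n))) {b : UqBMinus P.q} (hb : LEB P r b) :
    LEB P (C * r) (h b) :=
  GaussLE.map h C (fun i => by
    have := LEB.zstep hK hKi hc hc' (hF i.1) i.2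
    simpa only [monB, wt] using this) hb

theorem LEB.bound_mul {h : Module.End L (UqBMinus P.q)} {c c' d : L} (h1 : h 1 = 1)
    (hm : ∀ b b', h (b * b') = h b * h b')
    (hK : h (K P.q : UqBMinus P.q) = c • (K P.q : UqBMinus P.q))
    (hKi : h (((K P.q)⁻¹ : (UqBMinus P.q)ˣ) : UqBMinus P.q) =
      c' • (((K P.q)⁻¹ : (UqBMinus P.q)ˣ) : UqBMinus P.q))
    (hF : h (F P.q) = d • F P.q)
    (hc : ‖c‖₊ ≤ 1) (hc' : ‖c'‖₊ ≤ 1) (hd : ‖d‖₊ ≤ 1) {b : UqBMinus P.q} (hb : LEB P r b) :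
    LEB P r (h b) := by
  rw [← one_mul r]
  refine LEB.bound (c := c) (c' := c') (fun b => by rw [hm, hK, mul_smul_comm])
    (fun b => by rw [hm, hKi, mul_smul_comm]) hc hc' (fun n => ?_) hb
  rw [one_mul]
  induction n with
  | zero =>
    rw [pow_zero (F P.q), h1]
    have := GaussLE.single (L := L) (v := monB P.q) (w := wt P.R) (0, 0)
    simpa [monB, wt] using this
  | succ n ih =>
    rw [pow_succ' (F P.q), hm, hF, smul_mul_assoc]
    refine GaussLE.mono (GaussLE.smul d (LEB.F_mul ih)) ?_
    rw [pow_succ']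
    exact mul_le_of_le_one_left (zero_le) hd

theorem LEB.one : LEB P 1 (1 : UqBMinus P.q) := by
  have := GaussLE.single (L := L) (v := monB P.q) (w := wt P.R) (0, 0)
  simpa [monB, wt] using this

theorem LEB.F_pow (n : ℕ) : LEB P (P.R ^ n) (F P.q ^ n) := by
  have := GaussLE.single (L := L) (v := monB P.q) (w := wt P.R) (n, 0)
  simpa [monB, wt] using this

theorem LEB.lam_K {b : UqBMinus P.q} (hb : LEB P r b) :
    LEB P r (lam P.q (UqBPlus.K P.q : UqBPlus P.q) b) := by
  rw [QuantumSL2.lam_K]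
  refine LEB.bound_mul (c := ((P.q⁻¹ : Lˣ) : L) ^ 2) (c' := (P.q : L) ^ 2) (d := 1)
    ?_ (actL_algHom _) ?_ ?_ ?_ ?_ ?_ ?_ hb
  · rw [actL_apply_one]; simp
  · rw [actL_K]; simp [chi]
  · rw [actL_Kinv]; simp [chi]
  · rw [actL_F]; simp [chi]
  all_goals simp [P.nnnorm_q]

theorem LEB.lam_Kinv {b : UqBMinus P.q} (hb : LEB P r b) :
    LEB P r (lam P.q ((UqBPlus.K P.q)⁻¹ : (UqBPlus P.q)ˣ) b) := by
  rw [QuantumSL2.lam_Kinv]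
  refine LEB.bound_mul (c := (P.q : L) ^ 2) (c' := ((P.q⁻¹ : Lˣ) : L) ^ 2) (d := 1)
    ?_ (actL_algHom _) ?_ ?_ ?_ ?_ ?_ ?_ hb
  · rw [actL_apply_one]; simp
  · rw [actL_K]; simp [chiInv]
  · rw [actL_Kinv]; simp [chiInv]
  · rw [actL_F]; simp [chiInv]
  all_goals simp [P.nnnorm_q]

theorem LEB.rho_K {b : UqBMinus P.q} (hb : LEB P r b) :
    LEB P r (rho P.q (UqBPlus.K P.q : UqBPlus P.q) b) := by
  rw [QuantumSL2.rho_K]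
  refine LEB.bound_mul (c := (P.q : L) ^ 2) (c' := ((P.q⁻¹ : Lˣ) : L) ^ 2)
    (d := ((P.q⁻¹ : Lˣ) : L) ^ 2) ?_ (actR_algHom _) ?_ ?_ ?_ ?_ ?_ ?_ hb
  · rw [actR_apply_one]; simp
  · rw [actR_K]; simp [chiInv]
  · rw [actR_Kinv]; simp [chiInv]
  · rw [actR_F]; simp [chiInv]
  all_goals simp [P.nnnorm_q]

theorem LEB.rho_Kinv {b : UqBMinus P.q} (hb : LEB P r b) :
    LEB P r (rho P.q ((UqBPlus.K P.q)⁻¹ : (UqBPlus P.q)ˣ) b) := by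
  rw [QuantumSL2.rho_Kinv]
  refine LEB.bound_mul (c := ((P.q⁻¹ : Lˣ) : L) ^ 2) (c' := (P.q : L) ^ 2)
    (d := (P.q : L) ^ 2) ?_ (actR_algHom _) ?_ ?_ ?_ ?_ ?_ ?_ hb
  · rw [actR_apply_one]; simp
  · rw [actR_K]; simp [chi]
  · rw [actR_Kinv]; simp [chi]
  · rw [actR_F]; simp [chi]
  all_goals simp [P.nnnorm_q]

theorem LEB.lam_E {b : UqBMinus P.q} (hb : LEB P r b) :
    LEB P (P.R * r) (lam P.q (UqBPlus.E P.q) b) := by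
  have hm : ∀ b b', lam P.q (UqBPlus.E P.q) (b * b') =
      lam P.q (UqBPlus.K P.q : UqBPlus P.q) b * lam P.q (UqBPlus.E P.q) b' +
        lam P.q (UqBPlus.E P.q) b * b' := lam_E_mul P.q
  have hK : lam P.q (UqBPlus.E P.q) (K P.q : UqBMinus P.q) = 0 := by
    rw [QuantumSL2.lam_E, actL_K]; simp [pairE_K]
  have hKi : lam P.q (UqBPlus.E P.q) (((K P.q)⁻¹ : (UqBMinus P.q)ˣ) : UqBMinus P.q) = 0 := by
    rw [QuantumSL2.lam_E, actL_Kinv]; simp [pairE_Kinv]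
  have hF : lam P.q (UqBPlus.E P.q) (F P.q) =
      P.c • (((K P.q)⁻¹ : (UqBMinus P.q)ˣ) : UqBMinus P.q) := by
    rw [QuantumSL2.lam_E, actL_F]; simp [pairE_F, pairE_one, Datum.c]
  have hKF : lam P.q (UqBPlus.K P.q : UqBPlus P.q) (F P.q) = F P.q := by
    rw [QuantumSL2.lam_K, actL_F]; simp [chi]
  refine LEB.bound (c := 1) (c' := 1) (fun b => by rw [hm, hK]; simp)
    (fun b => by rw [hm, hKi]; simp) (by simp) (by simp) (fun n => ?_) hb
  induction n with
  | zero =>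
    have : lam P.q (UqBPlus.E P.q) 1 = 0 := by
      rw [QuantumSL2.lam_E, actL_apply_one]; simp [pairE_one]
    rw [pow_zero (F P.q), this]; exact GaussLE.zero
  | succ n ih =>
    rw [pow_succ' (F P.q), hm, hF, hKF]
    refine GaussLE.add ?_ ?_
    · refine GaussLE.mono (LEB.F_mul ih) ?_
      rw [pow_succ']
    · rw [smul_mul_assoc]
      refine GaussLE.mono (GaussLE.smul P.c (LEB.Kinv_mul (LEB.F_pow n))) ?_
      rw [pow_succ', ← mul_assoc]
      gcongr
      exact P.nnnorm_c_le

theorem LEB.rho_E {b : UqBMinus P.q} (hb : LEB P r b) :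
    LEB P (P.R * r) (rho P.q (UqBPlus.E P.q) b) := by
  have hm : ∀ b b', rho P.q (UqBPlus.E P.q) (b * b') =
      b * rho P.q (UqBPlus.E P.q) b' + rho P.q (UqBPlus.E P.q) b *
        rho P.q (UqBPlus.K P.q : UqBPlus P.q) b' := rho_E_mul P.q
  have hv : ∀ b : UqBMinus P.q,
      (-(toConv (pairE P.q) * toConv (chiInv P.q).toLinearMap)) b =
        -(LinearMap.mul' L L (TensorProduct.map (pairE P.q) (chiInv P.q).toLinearMap
          (Coalgebra.comul b))) := fun b => rfl
  have hK : rho P.q (UqBPlus.E P.q) (K P.q : UqBMinus P.q) = 0 := by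
    rw [QuantumSL2.rho_E, actR_K, hv, comul_K]; simp [pairE_K]
  have hKi : rho P.q (UqBPlus.E P.q) (((K P.q)⁻¹ : (UqBMinus P.q)ˣ) : UqBMinus P.q) = 0 := by
    rw [QuantumSL2.rho_E, actR_Kinv, hv, comul_Kinv]; simp [pairE_Kinv]
  have hF : rho P.q (UqBPlus.E P.q) (F P.q) = (-P.c) • 1 := by
    rw [QuantumSL2.rho_E, actR_F, hv, hv, comul_Kinv, comul_F]
    simp [pairE_F, pairE_Kinv, Datum.c]
  have hKK : rho P.q (UqBPlus.K P.q : UqBPlus P.q) (K P.q : UqBMinus P.q) =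
      ((P.q : L) ^ 2) • (K P.q : UqBMinus P.q) := by
    rw [QuantumSL2.rho_K, actR_K]; simp [chiInv]
  have hKKi : rho P.q (UqBPlus.K P.q : UqBPlus P.q)
      (((K P.q)⁻¹ : (UqBMinus P.q)ˣ) : UqBMinus P.q) =
      (((P.q⁻¹ : Lˣ) : L) ^ 2) • (((K P.q)⁻¹ : (UqBMinus P.q)ˣ) : UqBMinus P.q) := by
    rw [QuantumSL2.rho_K, actR_Kinv]; simp [chiInv]
  refine LEB.bound (c := (P.q : L) ^ 2) (c' := ((P.q⁻¹ : Lˣ) : L) ^ 2)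
    (fun b => by rw [hm, hK, hKK]; simp)
    (fun b => by rw [hm, hKi, hKKi]; simp) (by simp [P.nnnorm_q]) (by simp [P.nnnorm_q])
    (fun n => ?_) hb
  induction n with
  | zero =>
    have : rho P.q (UqBPlus.E P.q) 1 = 0 := by
      rw [QuantumSL2.rho_E, actR_apply_one, hv, Bialgebra.comul_one,
        Algebra.TensorProduct.one_def]
      simp [pairE_one]
    rw [pow_zero (F P.q), this]; exact GaussLE.zero
  | succ n ih =>
    rw [pow_succ' (F P.q), hm, hF]
    refine GaussLE.add ?_ ?_
    · refine GaussLE.mono (LEB.F_mul ih) ?_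
      rw [pow_succ']
    · rw [smul_mul_assoc, one_mul]
      refine GaussLE.mono (GaussLE.smul (-P.c) (LEB.rho_K (LEB.F_pow n))) ?_
      rw [pow_succ', ← mul_assoc, nnnorm_neg]
      gcongr
      exact P.nnnorm_c_le

/-- An operator on the double has norm at most `C`. -/
def OpLE (P : Datum L) (C : ℝ≥0) (X : Module.End L (UqBMinus P.q ⊗[L] UqBPlus P.q)) : Prop :=
  ∀ r y, LED P r y → LED P (C * r) (X y)

theorem OpLE.of_mon {C : ℝ≥0} {X : Module.End L (UqBMinus P.q ⊗[L] UqBPlus P.q)}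
    (h : ∀ i j, LED P (C * (wt P.R i * wt P.R j)) (X (monB P.q i ⊗ₜ monA P.q j))) :
    OpLE P C X := fun _ _ hy => GaussLE.map X C (fun i => by
    have := h i.1 i.2
    simpa only [monD, wtD] using this) hy

theorem OpLE.mul {C C' : ℝ≥0} {X Y : Module.End L (UqBMinus P.q ⊗[L] UqBPlus P.q)}
    (hX : OpLE P C X) (hY : OpLE P C' Y) : OpLE P (C * C') (X * Y) := fun r y hy => by
  rw [mul_assoc]; exact hX _ _ (hY _ _ hy)

theorem OpLE.one : OpLE P 1 1 := fun r y hy => by simpa using hy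

theorem OpLE.pow {C : ℝ≥0} {X : Module.End L (UqBMinus P.q ⊗[L] UqBPlus P.q)}
    (hX : OpLE P C X) (n : ℕ) : OpLE P (C ^ n) (X ^ n) := by
  induction n with
  | zero => simpa using OpLE.one
  | succ n ih => rw [pow_succ, pow_succ]; exact ih.mul hX

theorem LEB.mon (i : ℕ × ℤ) : LEB P (wt P.R i) (monB P.q i) := GaussLE.single i
theorem LEA.mon (i : ℕ × ℤ) : LEA P (wt P.R i) (monA P.q i) := GaussLE.single i

theorem opLE_leftB_F : OpLE P P.R (leftB P.q (F P.q)) := OpLE.of_mon fun i j => by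
  rw [leftB_tmul, ← mul_assoc]
  exact LEB.tmul (LEB.F_mul (LEB.mon i)) (LEA.mon j)

theorem opLE_leftB_K (n : ℤ) :
    OpLE P 1 (leftB P.q ((K P.q ^ n : (UqBMinus P.q)ˣ) : UqBMinus P.q)) := by
  have h1 : OpLE P 1 (leftB P.q (K P.q : UqBMinus P.q)) := OpLE.of_mon fun i j => by
    rw [leftB_tmul, one_mul]
    exact LEB.tmul (LEB.K_mul (LEB.mon i)) (LEA.mon j)
  have h2 : OpLE P 1 (leftB P.q (((K P.q)⁻¹ : (UqBMinus P.q)ˣ) : UqBMinus P.q)) :=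
    OpLE.of_mon fun i j => by
      rw [leftB_tmul, one_mul]
      exact LEB.tmul (LEB.Kinv_mul (LEB.mon i)) (LEA.mon j)
  induction n with
  | zero => simpa using OpLE.one
  | succ n ih =>
    rw [zpow_add_one, Units.val_mul, map_mul]
    simpa using ih.mul h1
  | pred n ih =>
    rw [zpow_sub_one, Units.val_mul, map_mul]
    simpa using ih.mul h2

theorem opLE_crossAct_E : OpLE P P.R (crossAct P.q (UqBPlus.E P.q)) := OpLE.of_mon fun i j => by
  rw [crossAct_E]
  refine GaussLE.add (GaussLE.add ?_ ?_) ?_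
  · rw [← mul_assoc]
    exact LEB.tmul (LEB.rho_E (LEB.lam_K (LEB.mon i))) (LEA.K_mul (LEA.mon j))
  · rw [mul_left_comm]
    exact LEB.tmul (LEB.lam_K (LEB.mon i)) (LEA.E_mul (LEA.mon j))
  · rw [← mul_assoc]
    exact LEB.tmul (LEB.lam_E (LEB.mon i)) (LEA.mon j)

theorem opLE_crossAct_K (n : ℤ) :
    OpLE P 1 (crossAct P.q ((UqBPlus.K P.q ^ n : (UqBPlus P.q)ˣ) : UqBPlus P.q)) := by
  have h1 : OpLE P 1 (crossAct P.q (UqBPlus.K P.q : UqBPlus P.q)) := OpLE.of_mon fun i j => by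
    rw [crossAct_groupLike _ _ (UqBPlus.comul_K _), one_mul]
    exact LEB.tmul (LEB.rho_K (LEB.lam_K (LEB.mon i))) (LEA.K_mul (LEA.mon j))
  have h2 : OpLE P 1 (crossAct P.q (((UqBPlus.K P.q)⁻¹ : (UqBPlus P.q)ˣ) : UqBPlus P.q)) :=
    OpLE.of_mon fun i j => by
      rw [crossAct_groupLike _ _ (UqBPlus.comul_Kinv _), one_mul]
      exact LEB.tmul (LEB.rho_Kinv (LEB.lam_Kinv (LEB.mon i))) (LEA.Kinv_mul (LEA.mon j))
  induction n with
  | zero => simpa using OpLE.one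
  | succ n ih =>
    rw [zpow_add_one, Units.val_mul, map_mul]
    simpa using ih.mul h1
  | pred n ih =>
    rw [zpow_sub_one, Units.val_mul, map_mul]
    simpa using ih.mul h2

theorem LED.mul {x y : UqBMinus P.q ⊗[L] UqBPlus P.q} (hx : LED P r x) (hy : LED P s y) :
    LED P (r * s) (doubleMul P.q x y) := by
  refine GaussLE.map₂ (doubleMul P.q) (fun i j => ?_) hx hy
  have h : OpLE P (wtD P.R i) (doubleMul P.q (monD P.q i)) := by
    rw [monD, doubleMul_tmul, monB, monA, map_mul, map_mul, map_pow, map_pow]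
    have := ((opLE_leftB_F (P := P)).pow i.1.1 |>.mul (opLE_leftB_K i.1.2)).mul
      ((opLE_crossAct_E (P := P)).pow i.2.1 |>.mul (opLE_crossAct_K i.2.2))
    simpa [wtD, wt] using this
  exact h _ _ (GaussLE.single j)

theorem exists_LEB (b : UqBMinus P.q) : ∃ t, LEB P t b := by
  let S : Subalgebra L (UqBMinus P.q) :=
    { carrier := {x | ∀ b, (∃ t, LEB P t b) → ∃ t, LEB P t (x * b)}
      mul_mem' := by
        intro x y hx hy b hb
        rw [mul_assoc]; exact hx _ (hy _ hb)
      add_mem' := by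
        intro x y hx hy b hb
        obtain ⟨t, ht⟩ := hx b hb
        obtain ⟨t', ht'⟩ := hy b hb
        rw [add_mul]
        exact ⟨max t t', (GaussLE.mono ht (le_max_left _ _)).add
          (GaussLE.mono ht' (le_max_right _ _))⟩
      algebraMap_mem' := by
        rintro c b ⟨t, ht⟩
        rw [← Algebra.smul_def]
        exact ⟨_, ht.smul c⟩ }
  have hS : S = ⊤ := UqBMinus.eq_top S (fun b ⟨t, ht⟩ => ⟨_, LEB.K_mul ht⟩)
    (fun b ⟨t, ht⟩ => ⟨_, LEB.Kinv_mul ht⟩) (fun b ⟨t, ht⟩ => ⟨_, LEB.F_mul ht⟩)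
  have : b ∈ S := hS ▸ Algebra.mem_top
  simpa using this 1 ⟨1, LEB.one⟩

theorem exists_LEA (a : UqBPlus P.q) : ∃ t, LEA P t a := by
  let S : Subalgebra L (UqBPlus P.q) :=
    { carrier := {x | ∀ b, (∃ t, LEA P t b) → ∃ t, LEA P t (x * b)}
      mul_mem' := by
        intro x y hx hy b hb
        rw [mul_assoc]; exact hx _ (hy _ hb)
      add_mem' := by
        intro x y hx hy b hb
        obtain ⟨t, ht⟩ := hx b hb
        obtain ⟨t', ht'⟩ := hy b hb
        rw [add_mul]
        exact ⟨max t t', (GaussLE.mono ht (le_max_left _ _)).add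
          (GaussLE.mono ht' (le_max_right _ _))⟩
      algebraMap_mem' := by
        rintro c b ⟨t, ht⟩
        rw [← Algebra.smul_def]
        exact ⟨_, ht.smul c⟩ }
  have hS : S = ⊤ := UqBPlus.eq_top S (fun b ⟨t, ht⟩ => ⟨_, LEA.K_mul ht⟩)
    (fun b ⟨t, ht⟩ => ⟨_, LEA.Kinv_mul ht⟩) (fun b ⟨t, ht⟩ => ⟨_, LEA.E_mul ht⟩)
  have : a ∈ S := hS ▸ Algebra.mem_top
  have h1 : LEA P 1 (1 : UqBPlus P.q) := by simpa [monA, wt] using LEA.mon (P := P) (0, 0)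
  simpa using this 1 ⟨1, h1⟩

theorem exists_LED (x : UqBMinus P.q ⊗[L] UqBPlus P.q) : ∃ t, LED P t x := by
  induction x with
  | zero => exact ⟨0, GaussLE.zero⟩
  | add x y hx hy =>
    obtain ⟨t, ht⟩ := hx
    obtain ⟨t', ht'⟩ := hy
    exact ⟨max t t', (GaussLE.mono ht (le_max_left _ _)).add
      (GaussLE.mono ht' (le_max_right _ _))⟩
  | tmul b a =>
    obtain ⟨t, ht⟩ := exists_LEB b
    obtain ⟨t', ht'⟩ := exists_LEA a
    exact ⟨_, LEB.tmul ht ht'⟩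

theorem LED.of_lt {x : UqBMinus P.q ⊗[L] UqBPlus P.q}
    (h : gaussNorm L (monD P.q) (wtD P.R) x < r) : LED P r x :=
  GaussLE.of_lt (exists_LED x) h

end DoubleNorm

/-! ### The completed double -/

section Completion

variable {L : Type u} [NormedField L]

/-- The algebraic double `D(U_q(b₊), U_q(b₋))`, to be equipped with the tensor product of the
Gauss `R`-norms. -/
def NormedDouble (P : Datum L) : Type u := Double P.q

variable (P : Datum L)

instance : Ring (NormedDouble P) := inferInstanceAs (Ring (Double P.q))
instance : Algebra L (NormedDouble P) := inferInstanceAs (Algebra L (Double P.q))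

/-- The tensor product norm: `F^i K₋^j ⊗ E^k K^l` are orthogonal of norm `R^(i+k)`. -/
instance : Norm (NormedDouble P) where
  norm x := gaussNorm L (monD P.q) (wtD P.R) x

variable [IsUltrametricDist L]

variable {P} in
theorem NormedDouble.norm_add_le_max (x y : NormedDouble P) : ‖x + y‖ ≤ max ‖x‖ ‖y‖ := by
  change ((gaussNorm L (monD P.q) (wtD P.R) _ : ℝ≥0) : ℝ) ≤ max
    ((gaussNorm L (monD P.q) (wtD P.R) _ : ℝ≥0) : ℝ)
    ((gaussNorm L (monD P.q) (wtD P.R) _ : ℝ≥0) : ℝ)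
  rw [← NNReal.coe_max, NNReal.coe_le_coe]
  refine le_of_forall_gt_imp_ge_of_dense fun r hr => ?_
  obtain ⟨h1, h2⟩ := max_lt_iff.1 hr
  exact gaussNorm_le (GaussLE.add (LED.of_lt h1) (LED.of_lt h2))

theorem nnreal_le_mul {a b c : ℝ≥0} (h : ∀ a' > a, ∀ b' > b, c ≤ a' * b') : c ≤ a * b := by
  rw [← NNReal.coe_le_coe, NNReal.coe_mul]
  refine le_mul_of_forall_lt₀ fun a' ha b' hb => ?_
  lift a' to ℝ≥0 using a.2.trans ha.le
  lift b' to ℝ≥0 using b.2.trans hb.le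
  exact_mod_cast h a' (by exact_mod_cast ha) b' (by exact_mod_cast hb)

variable {P} in
theorem NormedDouble.norm_smul_le' (c : L) (x : NormedDouble P) : ‖c • x‖ ≤ ‖c‖ * ‖x‖ := by
  change ((gaussNorm L (monD P.q) (wtD P.R) _ : ℝ≥0) : ℝ) ≤
    (‖c‖₊ : ℝ) * ((gaussNorm L (monD P.q) (wtD P.R) _ : ℝ≥0) : ℝ)
  rw [← NNReal.coe_mul, NNReal.coe_le_coe]
  refine nnreal_le_mul fun a ha b hb => ?_
  exact gaussNorm_le (GaussLE.mono (GaussLE.smul c (LED.of_lt hb)) (by gcongr))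

variable {P} in
theorem NormedDouble.norm_mul_le' (x y : NormedDouble P) : ‖x * y‖ ≤ ‖x‖ * ‖y‖ := by
  change ((gaussNorm L (monD P.q) (wtD P.R) (doubleMul P.q x y) : ℝ≥0) : ℝ) ≤
    ((gaussNorm L (monD P.q) (wtD P.R) _ : ℝ≥0) : ℝ) *
    ((gaussNorm L (monD P.q) (wtD P.R) _ : ℝ≥0) : ℝ)
  rw [← NNReal.coe_mul, NNReal.coe_le_coe]
  refine nnreal_le_mul fun a ha b hb => ?_
  exact gaussNorm_le (LED.mul (LED.of_lt ha) (LED.of_lt hb))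

theorem NormedDouble.norm_nonneg' (x : NormedDouble P) : 0 ≤ ‖x‖ := NNReal.coe_nonneg _

/-- The norm of the double as a seminorm on the additive group. -/
def NormedDouble.seminorm : AddGroupSeminorm (NormedDouble P) where
  toFun x := ‖x‖
  map_zero' := le_antisymm (by simpa using norm_smul_le' (P := P) 0 0) (norm_nonneg' P 0)
  add_le' x y := (norm_add_le_max x y).trans
    (max_le_add_of_nonneg (norm_nonneg' P x) (norm_nonneg' P y))
  neg' x := by
    have h : ∀ x : NormedDouble P, ‖-x‖ ≤ ‖x‖ := fun x => by
      simpa using norm_smul_le' (P := P) (-1) x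
    exact le_antisymm (h x) (by simpa using h (-x))

instance : SeminormedRing (NormedDouble P) :=
  { (inferInstance : Ring (NormedDouble P)),
    (NormedDouble.seminorm P).toSeminormedAddCommGroup with
    norm := fun x => ‖x‖
    norm_mul_le := NormedDouble.norm_mul_le' }

instance : NormedSpace L (NormedDouble P) where
  norm_smul_le := NormedDouble.norm_smul_le'

/-- The completed quantum double `D(U_q(b₊, R), U_q(b₋, R))`. -/
abbrev CompletedDouble : Type u := UniformSpace.Completion (NormedDouble P)

end Completion

section Elements

variable {L : Type u} [NormedField L] [IsUltrametricDist L] (P : Datum L)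

theorem CompletedDouble.norm_add_le_max (x y : CompletedDouble P) : ‖x + y‖ ≤ max ‖x‖ ‖y‖ := by
  induction x, y using UniformSpace.Completion.induction_on₂ with
  | hp =>
    exact isClosed_le (continuous_norm.comp (continuous_fst.add continuous_snd))
      ((continuous_norm.comp continuous_fst).max (continuous_norm.comp continuous_snd))
  | ih a b =>
    rw [← UniformSpace.Completion.coe_add, UniformSpace.Completion.norm_coe,
      UniformSpace.Completion.norm_coe, UniformSpace.Completion.norm_coe]
    exact NormedDouble.norm_add_le_max a b

instance : IsUltrametricDist (CompletedDouble P) :=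
  IsUltrametricDist.isUltrametricDist_of_forall_norm_add_le_max_norm
    (CompletedDouble.norm_add_le_max P)

theorem NormedDouble.norm_one_eq : ‖(1 : NormedDouble P)‖ = 1 := by
  let φ : UqBMinus P.q ⊗[L] UqBPlus P.q →ₗ[L] L :=
    LinearMap.mul' L L ∘ₗ TensorProduct.map Coalgebra.counit Coalgebra.counit
  have h1 : φ ((1 : UqBMinus P.q) ⊗ₜ (1 : UqBPlus P.q)) = 1 := by simp [φ]
  have hB : ∀ i : ℕ × ℤ, ‖(Coalgebra.counit (R := L) (monB P.q i) : L)‖₊ ≤ 1 := fun i => by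
    change ‖UqBMinus.counitHom P.q (monB P.q i)‖₊ ≤ 1
    have hK : Units.map (UqBMinus.counitHom P.q : UqBMinus P.q →* L) (UqBMinus.K P.q) = 1 :=
      Units.ext (by simp [UqBMinus.counitHom])
    have hK' : UqBMinus.counitHom P.q ((UqBMinus.K P.q ^ i.2 : (UqBMinus P.q)ˣ) : UqBMinus P.q) = 1 := by
      have := congrArg (fun u : Lˣ => ((u ^ i.2 : Lˣ) : L)) hK
      simpa [← map_zpow] using this
    have hX : UqBMinus.counitHom P.q (UqBMinus.F P.q) = 0 := by simp [UqBMinus.counitHom]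
    rw [monB, map_mul, map_pow, hK', hX, mul_one, nnnorm_pow, nnnorm_zero]
    exact pow_le_one₀ le_rfl zero_le_one
  have hA : ∀ i : ℕ × ℤ, ‖(Coalgebra.counit (R := L) (monA P.q i) : L)‖₊ ≤ 1 := fun i => by
    change ‖UqBPlus.counitHom P.q (monA P.q i)‖₊ ≤ 1
    have hK : Units.map (UqBPlus.counitHom P.q : UqBPlus P.q →* L) (UqBPlus.K P.q) = 1 :=
      Units.ext (by simp [UqBPlus.counitHom])
    have hK' : UqBPlus.counitHom P.q ((UqBPlus.K P.q ^ i.2 : (UqBPlus P.q)ˣ) : UqBPlus P.q) = 1 := by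
      have := congrArg (fun u : Lˣ => ((u ^ i.2 : Lˣ) : L)) hK
      simpa [← map_zpow] using this
    have hX : UqBPlus.counitHom P.q (UqBPlus.E P.q) = 0 := by simp [UqBPlus.counitHom]
    rw [monA, map_mul, map_pow, hK', hX, mul_one, nnnorm_pow, nnnorm_zero]
    exact pow_le_one₀ le_rfl zero_le_one
  have hle : ∀ r x, LED P r x → ‖φ x‖₊ ≤ r := fun r x hx => by
    have h := GaussLE.map (L := L) (v' := fun _ : Unit => (1 : L)) (w' := fun _ => 1) φ 1
      (fun i => ⟨Finsupp.single () (φ (monD P.q i)), by simp, fun _ => ?_⟩) hx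
    · obtain ⟨c, hc, hb⟩ := h
      have := hb ()
      rw [← hc]
      simpa [Finsupp.linearCombination_apply, Finsupp.sum_fintype] using this
    · have hw : ∀ n, 1 ≤ wt P.R n := fun n => one_le_pow₀ P.one_le_R
      have h2 : 1 ≤ wtD P.R i := one_le_mul (hw _) (hw _)
      have h3 : ‖φ (monD P.q i)‖₊ ≤ 1 := by
        simp only [φ, monD, LinearMap.comp_apply, TensorProduct.map_tmul, LinearMap.mul'_apply,
          nnnorm_mul]
        exact mul_le_one' (hB _) (hA _)
      simpa using h3.trans h2
  refine le_antisymm ?_ ?_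
  · have h0 : LED P 1 ((1 : UqBMinus P.q) ⊗ₜ (1 : UqBPlus P.q)) := by
      simpa [monD, monB, monA, wtD, wt] using
        GaussLE.single (L := L) (v := monD P.q) (w := wtD P.R) ((0, 0), (0, 0))
    have := gaussNorm_le h0
    exact_mod_cast this
  · have : (1 : ℝ≥0) ≤ gaussNorm L (monD P.q) (wtD P.R) ((1 : UqBMinus P.q) ⊗ₜ (1 : UqBPlus P.q)) :=
      le_csInf (exists_LED _) fun r hr => by simpa [h1] using hle r _ hr
    exact_mod_cast this

instance : NormOneClass (CompletedDouble P) where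
  norm_one := by
    rw [← UniformSpace.Completion.coe_one, UniformSpace.Completion.norm_coe,
      NormedDouble.norm_one_eq]

theorem Datum.R_pos : 0 < (P.R : ℝ) := lt_of_lt_of_le one_pos (by exact_mod_cast P.one_le_R)

namespace CompletedDouble

/-- The generator `E = 1 ⊗ E` of the completed double. -/
def E : CompletedDouble P :=
  ((show NormedDouble P from (1 : UqBMinus P.q) ⊗ₜ[L] UqBPlus.E P.q : NormedDouble P) :)

/-- The generator `F = F ⊗ 1` of the completed double. -/
def F : CompletedDouble P :=
  ((show NormedDouble P from UqBMinus.F P.q ⊗ₜ[L] (1 : UqBPlus P.q) : NormedDouble P) :)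

/-- The generator `K = 1 ⊗ K` of the completed double. -/
def K : CompletedDouble P :=
  ((show NormedDouble P from (1 : UqBMinus P.q) ⊗ₜ[L] (UqBPlus.K P.q : UqBPlus P.q) :
    NormedDouble P) :)

/-- The generator `K₋ = K₋ ⊗ 1` of the completed double. -/
def Km : CompletedDouble P :=
  ((show NormedDouble P from (UqBMinus.K P.q : UqBMinus P.q) ⊗ₜ[L] (1 : UqBPlus P.q) :
    NormedDouble P) :)

variable {P} in
theorem norm_coe_le {r : ℝ≥0} {x : NormedDouble P} (h : LED P r x) :
    ‖(x : CompletedDouble P)‖ ≤ r := by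
  rw [UniformSpace.Completion.norm_coe]
  exact NNReal.coe_le_coe.2 (gaussNorm_le h)

theorem norm_E_le : ‖E P‖ ≤ P.R := norm_coe_le (by
  simpa [monD, monB, monA, wtD, wt] using
    GaussLE.single (L := L) (v := monD P.q) (w := wtD P.R) ((0, 0), (1, 0)))

theorem norm_F_le : ‖F P‖ ≤ P.R := norm_coe_le (by
  simpa [monD, monB, monA, wtD, wt] using
    GaussLE.single (L := L) (v := monD P.q) (w := wtD P.R) ((1, 0), (0, 0)))

theorem norm_K_le : ‖K P‖ ≤ 1 := norm_coe_le (r := 1) (by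
  simpa [monD, monB, monA, wtD, wt] using
    GaussLE.single (L := L) (v := monD P.q) (w := wtD P.R) ((0, 0), (0, 1)))

theorem norm_Km_le : ‖Km P‖ ≤ 1 := norm_coe_le (r := 1) (by
  simpa [monD, monB, monA, wtD, wt] using
    GaussLE.single (L := L) (v := monD P.q) (w := wtD P.R) ((0, 1), (0, 0)))

theorem norm_smul_one_le (c : L) : ‖c • (1 : CompletedDouble P)‖ ≤ ‖c‖ := by
  rw [norm_smul, norm_one, mul_one]

/-- The closed two-sided ideal `I_q` generated by `K - K₋`. -/
def Iq : Ideal (CompletedDouble P) :=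
  sInf {I | I.IsTwoSided ∧ IsClosed (I : Set (CompletedDouble P)) ∧ K P - Km P ∈ I}

instance : (Iq P).IsTwoSided := ⟨fun {a} b ha => by
  rw [Iq, Submodule.mem_sInf] at ha ⊢
  rintro I ⟨h1, h2, h3⟩
  exact h1.mul_mem_of_left b (ha I ⟨h1, h2, h3⟩)⟩

end CompletedDouble

/-- The Banach algebra `U_q(sl₂, R) = D(U_q(b₊, R), U_q(b₋, R)) / I_q`. -/
def UqSL2 : Type u := CompletedDouble P ⧸ CompletedDouble.Iq P

instance : Ring (UqSL2 P) := inferInstanceAs (Ring (CompletedDouble P ⧸ CompletedDouble.Iq P))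

/-- The projection from the completed double. -/
def UqSL2.mk : CompletedDouble P →+* UqSL2 P := Ideal.Quotient.mk (CompletedDouble.Iq P)

/-- The quotient norm. -/
instance : Norm (UqSL2 P) := inferInstanceAs (Norm (CompletedDouble P ⧸ CompletedDouble.Iq P))

end Elements

/-! ### The associated graded ring of the norm filtration -/

section Graded

/-- The multiplicative monoid of positive real numbers. -/
abbrev PosReal : Type := {r : ℝ // 0 < r}

variable (A : Type*) [NormedRing A] [IsUltrametricDist A]

theorem norm_sum_le_of_ultra {A ι : Type*} [NormedRing A] [IsUltrametricDist A] (s : Finset ι)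
    (f : ι → A) {C : ℝ} (hC : 0 ≤ C) (h : ∀ i ∈ s, ‖f i‖ ≤ C) : ‖∑ i ∈ s, f i‖ ≤ C :=
  IsUltrametricDist.norm_sum_le_of_forall_le_of_nonneg hC h

theorem norm_sum_lt_of_ultra {A ι : Type*} [NormedRing A] [IsUltrametricDist A] (s : Finset ι)
    (f : ι → A) {C : ℝ} (hC : 0 < C) (h : ∀ i ∈ s, ‖f i‖ < C) : ‖∑ i ∈ s, f i‖ < C := by
  refine Finset.sum_induction f (fun a => ‖a‖ < C) (fun a b ha hb => ?_) (by simpa) h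
  exact (IsUltrametricDist.norm_add_le_max a b).trans_lt (max_lt ha hb)

theorem coeff_mul_norm_le (f g : MonoidAlgebra A PosReal) (hf : ∀ r, ‖f.coeff r‖ ≤ r)
    (hg : ∀ r, ‖g.coeff r‖ ≤ r) (r : PosReal) : ‖(f * g).coeff r‖ ≤ r := by
  classical
  rw [MonoidAlgebra.coeff_mul]
  refine norm_sum_le_of_ultra _ _ r.2.le fun i _ => norm_sum_le_of_ultra _ _ r.2.le fun j _ => ?_
  change ‖if i * j = r then f.coeff i * g.coeff j else 0‖ ≤ _
  split_ifs with h
  · rw [← h]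
    exact (norm_mul_le _ _).trans
      (mul_le_mul (hf i) (hg j) (norm_nonneg _) i.2.le)
  · simpa using r.2.le

theorem coeff_mul_norm_lt (f g : MonoidAlgebra A PosReal)
    (h : (∀ r, ‖f.coeff r‖ ≤ r) ∧ (∀ r, ‖g.coeff r‖ < r) ∨
      (∀ r, ‖f.coeff r‖ < r) ∧ (∀ r, ‖g.coeff r‖ ≤ r)) (r : PosReal) :
    ‖(f * g).coeff r‖ < r := by
  classical
  rw [MonoidAlgebra.coeff_mul]
  refine norm_sum_lt_of_ultra _ _ r.2 fun i _ => norm_sum_lt_of_ultra _ _ r.2 fun j _ => ?_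
  change ‖if i * j = r then f.coeff i * g.coeff j else 0‖ < _
  split_ifs with hij
  · rw [← hij]
    refine (norm_mul_le _ _).trans_lt ?_
    rcases h with ⟨hf, hg⟩ | ⟨hf, hg⟩
    · exact mul_lt_mul' (hf i) (hg j) (norm_nonneg _) i.2
    · exact (mul_le_mul_of_nonneg_left (hg j) (norm_nonneg _)).trans_lt
        (mul_lt_mul_of_pos_right (hf i) j.2)
  · simpa using r.2

variable [NormOneClass A]

/-- The Rees ring `⊕_{r > 0} F_r A` of the filtration `F_r A = {a | ‖a‖ ≤ r}`, as a ring of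
finite formal sums `∑ a_r T^r` with `a_r ∈ F_r A`. -/
def rees : Subring (MonoidAlgebra A PosReal) where
  carrier := {f | ∀ r, ‖f.coeff r‖ ≤ r}
  mul_mem' {f g} hf hg := coeff_mul_norm_le A f g hf hg
  one_mem' := fun r => by
    classical
    rw [MonoidAlgebra.one_def, MonoidAlgebra.coeff_single, Finsupp.single_apply]
    split_ifs with h
    · rw [← h, norm_one]; exact le_rfl
    · simpa using r.2.le
  add_mem' {f g} hf hg := fun r =>
    (IsUltrametricDist.norm_add_le_max _ _).trans (max_le (hf r) (hg r))
  zero_mem' := fun r => by simpa using r.2.le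
  neg_mem' {f} hf := fun r => by simpa using hf r

/-- The ideal `⊕_{r > 0} F_{<r} A` of the Rees ring, where `F_{<r} A = {a | ‖a‖ < r}`. -/
def reesIdeal : Ideal (rees A) where
  carrier := {f | ∀ r, ‖(f : MonoidAlgebra A PosReal).coeff r‖ < r}
  add_mem' {f g} hf hg := fun r =>
    (IsUltrametricDist.norm_add_le_max _ _).trans_lt (max_lt (hf r) (hg r))
  zero_mem' := fun r => by simpa using r.2
  smul_mem' f g hg := coeff_mul_norm_lt A f g (Or.inl ⟨f.2, hg⟩)

instance : (reesIdeal A).IsTwoSided :=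
  ⟨fun {f} g hf => coeff_mul_norm_lt A f g (Or.inr ⟨hf, g.2⟩)⟩

/-- The associated graded ring `Gr A = ⊕_{r > 0} F_r A / F_{<r} A`. -/
def Gr : Type _ := rees A ⧸ reesIdeal A

instance : Ring (Gr A) := inferInstanceAs (Ring (rees A ⧸ reesIdeal A))

variable {A}

/-- The homogeneous element of degree `r` of the Rees ring defined by `a ∈ F_r A`. -/
def reesSingle (a : A) (r : ℝ) (hr : 0 < r) (ha : ‖a‖ ≤ r) : rees A :=
  ⟨MonoidAlgebra.single ⟨r, hr⟩ a, fun s => by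
    classical
    rw [MonoidAlgebra.coeff_single, Finsupp.single_apply]
    split_ifs with h
    · rw [← h]; exact ha
    · simpa using s.2.le⟩

/-- The class of `a ∈ F_r A` in `F_r A / F_{<r} A`, the degree `r` part of `Gr A`. -/
def symbol (a : A) (r : ℝ) (hr : 0 < r) (ha : ‖a‖ ≤ r) : Gr A :=
  Ideal.Quotient.mk (reesIdeal A) (reesSingle a r hr ha)

end Graded

/-! ### Skew polynomial rings -/

section Skew

/-- The skew polynomial ring `S[x, β, 0]` of an automorphism `β` of `S`, with `x a = β(a) x`. -/
def SkewPoly {S : Type*} [Ring S] (_β : S ≃+* S) : Type _ := SkewPolynomial S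

variable {S : Type*} [Ring S] (β : S ≃+* S)

instance : Ring (SkewPoly β) :=
  letI : MulSemiringAction (Multiplicative ℕ) S :=
    MulSemiringAction.compHom S (powersHom (S →+* S) (β : S →+* S))
  inferInstanceAs (Ring (SkewMonoidAlgebra S (Multiplicative ℕ)))

/-- Constants of the skew polynomial ring. -/
def SkewPoly.C : S →+* SkewPoly β :=
  letI : MulSemiringAction (Multiplicative ℕ) S :=
    MulSemiringAction.compHom S (powersHom (S →+* S) (β : S →+* S))
  (SkewPolynomial.CRingHom : S →+* SkewPolynomial S)

/-- The variable of the skew polynomial ring. -/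
def SkewPoly.X : SkewPoly β := (SkewPolynomial.X : SkewPolynomial S)

theorem SkewPoly.X_mul_C (a : S) :
    SkewPoly.X β * SkewPoly.C β a = SkewPoly.C β (β a) * SkewPoly.X β := by
  let _ : MulSemiringAction (Multiplicative ℕ) S :=
    MulSemiringAction.compHom S (powersHom (S →+* S) (β : S →+* S))
  have h : (SkewPolynomial.X : SkewPolynomial S) * SkewPolynomial.C a =
      SkewPolynomial.C (SkewPolynomial.φ a) * SkewPolynomial.X := by
    rw [SkewPolynomial.C_mul_X_eq_monomial, ← SkewPolynomial.monomial_zero_left,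
      SkewPolynomial.X_mul_monomial]
  exact h

end Skew

/-! ### Discretely valued fields -/

section Residue

variable {L : Type u} [NormedField L]

/-- `π` is a uniformizer of `L`; such an element exists if and only if `L` is discretely valued. -/
def IsUniformizer (π : L) : Prop := 0 < ‖π‖ ∧ ‖π‖ < 1 ∧ ∀ x : L, ‖x‖ < 1 → ‖x‖ ≤ ‖π‖

variable (L) [IsUltrametricDist L]

/-- The residue field of `L`. -/
abbrev Residue : Type u :=
  IsLocalRing.ResidueField (NormedField.valuation (K := L)).valuationSubring

variable {L}

/-- The image in the residue field of an element `c` with `|c| ≤ 1`. -/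
def res (c : L) (hc : ‖c‖ ≤ 1) : Residue L :=
  IsLocalRing.residue (NormedField.valuation (K := L)).valuationSubring ⟨c, hc⟩

variable (L)

/-- The Laurent polynomial ring `k[π^±1][K^±1, K₋^±1]` over the residue field `k`. -/
def Torus : Type u := LaurentPolynomial (LaurentPolynomial (LaurentPolynomial (Residue L)))

instance : CommRing (Torus L) :=
  inferInstanceAs (CommRing (LaurentPolynomial (LaurentPolynomial (LaurentPolynomial (Residue L)))))

variable {L}

namespace Torus

/-- Inclusion of the Laurent polynomial ring `k[π^±1]`. -/
def const : LaurentPolynomial (Residue L) →+* Torus L :=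
  ((LaurentPolynomial.C : LaurentPolynomial (LaurentPolynomial (Residue L)) →+*
    LaurentPolynomial (LaurentPolynomial (LaurentPolynomial (Residue L)))).comp
    (LaurentPolynomial.C : LaurentPolynomial (Residue L) →+*
      LaurentPolynomial (LaurentPolynomial (Residue L))) :)

/-- The element `K`. -/
def K : Torus L :=
  (LaurentPolynomial.C (LaurentPolynomial.T 1) :
    LaurentPolynomial (LaurentPolynomial (LaurentPolynomial (Residue L))))

/-- The element `K₋`. -/
def Km : Torus L :=
  (LaurentPolynomial.T 1 : LaurentPolynomial (LaurentPolynomial (LaurentPolynomial (Residue L))))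

/-- A scalar of the residue field. -/
def scalar (c : Residue L) : Torus L := const (LaurentPolynomial.C c)

end Torus

end Residue

end QuantumSL2

end

open QuantumSL2

set_option linter.unusedSectionVars false
noncomputable section

open scoped TensorProduct NNReal Topology

namespace QuantumSL2

universe u

/-! Everything is read off from the graded ring of the norm filtration. The monomials `F^i K₋^j ⊗
E^k K^l` form a basis of the algebraic double, because the left regular representation separates the
monomials of each Borel algebra; hence the Gauss norm is the maximum of the weighted coefficients.
All rules for exchanging two generators involve only scalars `q^{±2}` or `1` of norm one, except `E
F = F E + c (K₋⁻¹ - K)` with `c = (q⁻¹ - q)⁻¹`. Since `|c| < R ≤ R²`, the correction is invisible in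
degree `R²`, and the symbols of `E` and `F` commute.

The universal properties of Laurent and skew polynomial rings therefore give a homomorphism
`skewHom` from the iterated skew polynomial ring to `Gr D`. It is surjective because the double is
dense in `D` and its monomials are orthogonal (`skewHom_surjective`). It is injective because
residues of rescaled coordinates define functionals on `Gr D` which recover all coefficients
(`grCoeff_skewHom`).

Properties of the graded ring then lift to `D`. It is left and right noetherian by the Hilbert basis
argument `isNoetherianRing_of_normalizing`. Since `R ∈ |L|`, the norm of `D` has values in `|π|^ℤ ∪
{0}`, so approximating with generators of the symbol ideal gains a factor `|π|` each time, and
completeness turns this into finite generation (`isNoetherianRing_of_gr`). Absence of zero divisors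
makes the norm multiplicative. If `|1 - q| < 1`, both automorphisms are trivial and `Gr D` is
commutative.

For the quotient, `z = K₋ K⁻¹ - 1` is central of norm one, since `K` and `K₋` exchange with every
generator by the same scalar. Multiplication by `z` is an isometry, so `I_q = z D`. The symbol of
`z` generates a completely prime ideal of `Gr D`: the quotient of the torus by it is evaluation at
`K₋ = K`, and primality passes through skew extensions (`SkewPoly.C_dvd_or_dvd`). Hence
representatives of minimal norm multiply to a representative of minimal norm, which is the
multiplicativity of the quotient norm (`quotient_norm_mul`). -/

/-! ### Hilbert's basis theorem for extensions by a normalizing element -/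

section Hilbert

variable {S T : Type*} [Ring S] [Ring T] (C : S →+* T) (x : T)

/-- The additive subgroup of sums of `x ^ i * C a` with `i < n`. -/
def degLT (n : ℕ) : AddSubgroup T := AddSubgroup.closure {y | ∃ i < n, ∃ a, y = x ^ i * C a}

theorem degLT_mono {m n : ℕ} (h : m ≤ n) : degLT C x m ≤ degLT C x n :=
  AddSubgroup.closure_mono fun _ ⟨i, hi, a, ha⟩ => ⟨i, hi.trans_le h, a, ha⟩

theorem pow_mul_mem_degLT {i n : ℕ} (h : i < n) (a : S) : x ^ i * C a ∈ degLT C x n :=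
  AddSubgroup.subset_closure ⟨i, h, a, rfl⟩

theorem mem_degLT_zero {t : T} (ht : t ∈ degLT C x 0) : t = 0 := by
  have h : {y | ∃ i < 0, ∃ a, y = x ^ i * C a} = (∅ : Set T) := by ext; simp
  rw [degLT, h, AddSubgroup.closure_empty] at ht
  simpa using ht

theorem exists_of_mem_degLT_succ {n : ℕ} {t : T} (ht : t ∈ degLT C x (n + 1)) :
    ∃ a, ∃ s ∈ degLT C x n, t = x ^ n * C a + s := by
  induction ht using AddSubgroup.closure_induction with
  | mem y hy =>
    obtain ⟨i, hi, a, rfl⟩ := hy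
    rcases Nat.lt_succ_iff_lt_or_eq.1 hi with h | rfl
    · exact ⟨0, _, pow_mul_mem_degLT C x h a, by simp⟩
    · exact ⟨a, 0, zero_mem _, by simp⟩
  | zero => exact ⟨0, 0, zero_mem _, by simp⟩
  | add y z _ _ hy hz =>
    obtain ⟨a, s, hs, rfl⟩ := hy
    obtain ⟨b, s', hs', rfl⟩ := hz
    exact ⟨a + b, s + s', add_mem hs hs', by rw [map_add, mul_add]; abel⟩
  | neg y _ hy =>
    obtain ⟨a, s, hs, rfl⟩ := hy
    exact ⟨-a, -s, neg_mem hs, by rw [map_neg, mul_neg]; abel⟩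

theorem mul_mem_degLT_succ {n : ℕ} {t : T} (ht : t ∈ degLT C x n) : x * t ∈ degLT C x (n + 1) := by
  induction ht using AddSubgroup.closure_induction with
  | mem y hy =>
    obtain ⟨i, hi, a, rfl⟩ := hy
    rw [← mul_assoc, ← pow_succ']
    exact pow_mul_mem_degLT C x (by omega) a
  | zero => simp
  | add y z _ _ hy hz => rw [mul_add]; exact add_mem hy hz
  | neg y _ hy => rw [mul_neg]; exact neg_mem hy

variable {C x}

theorem exists_pow_mul_eq (h : ∀ a, ∃ b, x * C a = C b * x) (n : ℕ) (a : S) :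
    ∃ b, x ^ n * C a = C b * x ^ n := by
  induction n with
  | zero => exact ⟨a, by simp⟩
  | succ n ih =>
    obtain ⟨b, hb⟩ := ih
    obtain ⟨c, hc⟩ := h b
    exact ⟨c, by rw [pow_succ', mul_assoc, hb, ← mul_assoc, hc, mul_assoc]⟩

theorem exists_mul_pow_eq (h : ∀ a, ∃ b, C a * x = x * C b) (n : ℕ) (a : S) :
    ∃ b, C a * x ^ n = x ^ n * C b := by
  induction n with
  | zero => exact ⟨a, by simp⟩
  | succ n ih =>
    obtain ⟨b, hb⟩ := ih
    obtain ⟨c, hc⟩ := h b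
    exact ⟨c, by rw [pow_succ, ← mul_assoc, hb, mul_assoc, hc, mul_assoc]⟩

/-- Coefficients stand to the right of the powers of `x`, so a constant on the left first has to be
moved through `x ^ i`; this changes the constant but not the degree. -/
theorem C_mul_mem_degLT (h : ∀ a, ∃ b, C a * x = x * C b) {n : ℕ} (a : S) {t : T}
    (ht : t ∈ degLT C x n) : C a * t ∈ degLT C x n := by
  induction ht using AddSubgroup.closure_induction with
  | mem y hy =>
    obtain ⟨i, hi, b, rfl⟩ := hy
    obtain ⟨c, hc⟩ := exists_mul_pow_eq h i a
    rw [← mul_assoc, hc, mul_assoc, ← map_mul]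
    exact pow_mul_mem_degLT C x hi _
  | zero => simp
  | add y z _ _ hy hz => rw [mul_add]; exact add_mem hy hz
  | neg y _ hy => rw [mul_neg]; exact neg_mem hy

/-- The left ideal of coefficients of `x ^ n` of elements of `I` of degree at most `n`. -/
def leadingIdeal (h1 : ∀ a, ∃ b, x * C a = C b * x) (h2 : ∀ a, ∃ b, C a * x = x * C b)
    (I : Ideal T) (n : ℕ) : Ideal S where
  carrier := {a | ∃ t ∈ degLT C x n, x ^ n * C a + t ∈ I}
  add_mem' := by
    rintro a b ⟨s, hs, ha⟩ ⟨t, ht, hb⟩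
    refine ⟨s + t, add_mem hs ht, ?_⟩
    have := add_mem ha hb
    rwa [add_add_add_comm, ← mul_add, ← map_add] at this
  zero_mem' := ⟨0, zero_mem _, by simp⟩
  smul_mem' := by
    rintro b a ⟨t, ht, ha⟩
    -- With `x ^ n * C b = C c * x ^ n`, left multiplication by `C c` turns the leading coefficient
    -- `a` into `b * a`.
    obtain ⟨c, hc⟩ := exists_pow_mul_eq h1 n b
    refine ⟨C c * t, C_mul_mem_degLT h2 c ht, ?_⟩
    have := I.mul_mem_left (C c) ha
    rwa [mul_add, ← mul_assoc, ← hc, mul_assoc, ← map_mul] at this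

section Leading

variable (h1 : ∀ a, ∃ b, x * C a = C b * x) (h2 : ∀ a, ∃ b, C a * x = x * C b)

/-- Left multiplication by `x` raises the degree by one and keeps the leading coefficient, because
coefficients are written on the right. -/
theorem leadingIdeal_mono {I I' : Ideal T} (hI : I ≤ I') {m n : ℕ} (h : m ≤ n) :
    leadingIdeal h1 h2 I m ≤ leadingIdeal h1 h2 I' n := by
  have hstep : ∀ m, leadingIdeal h1 h2 I m ≤ leadingIdeal h1 h2 I (m + 1) := by
    rintro m a ⟨t, ht, ha⟩
    refine ⟨x * t, mul_mem_degLT_succ C x ht, ?_⟩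
    have := I.mul_mem_left x ha
    rwa [mul_add, ← mul_assoc, ← pow_succ'] at this
  refine (monotone_nat_of_le_succ (f := leadingIdeal h1 h2 I) hstep h).trans ?_
  rintro a ⟨t, ht, ha⟩
  exact ⟨t, ht, hI ha⟩

/-- An element of `I'` of given degree has the same leading term as some element of `I`; the
difference lies in `I'` and has smaller degree. This is how an ascending chain is controlled by its
leading ideals. -/
theorem le_of_leadingIdeal_le (h3 : ∀ t, ∃ n, t ∈ degLT C x n) {I I' : Ideal T} (hI : I ≤ I')
    (h : ∀ n, leadingIdeal h1 h2 I' n ≤ leadingIdeal h1 h2 I n) : I' ≤ I := by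
  have key : ∀ n, ∀ t ∈ degLT C x n, t ∈ I' → t ∈ I := by
    intro n
    induction n with
    | zero => intro t ht _; rw [mem_degLT_zero C x ht]; exact zero_mem _
    | succ n ih =>
      intro t ht htI
      obtain ⟨a, s, hs, rfl⟩ := exists_of_mem_degLT_succ C x ht
      obtain ⟨s', hs', hsI⟩ := h n ⟨s, hs, htI⟩
      have h' : s - s' ∈ I := ih _ (sub_mem hs hs') (by
        have := sub_mem htI (hI hsI)
        rwa [add_sub_add_left_eq_sub] at this)
      have := add_mem hsI h'
      rwa [add_assoc, add_sub_cancel] at this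
  intro t ht
  obtain ⟨n, hn⟩ := h3 t
  exact key n t hn ht

end Leading

/-- Hilbert's basis theorem for a ring `T` generated by the image of a left noetherian ring `S` and
an element `x` which normalizes this image. -/
theorem isNoetherianRing_of_normalizing [IsNoetherianRing S]
    (h1 : ∀ a, ∃ b, x * C a = C b * x) (h2 : ∀ a, ∃ b, C a * x = x * C b)
    (h3 : ∀ t, ∃ n, t ∈ degLT C x n) : IsNoetherianRing T := by
  rw [IsNoetherianRing, ← monotone_stabilizes_iff_noetherian]
  intro f
  have hS := (monotone_stabilizes_iff_noetherian (R := S) (M := S)).2 inferInstance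
  let J : ℕ → ℕ → Ideal S := fun k n => leadingIdeal h1 h2 (f k) n
  have hJ : ∀ {k k' n n'}, k ≤ k' → n ≤ n' → J k n ≤ J k' n' := fun hk hn =>
    leadingIdeal_mono h1 h2 (f.monotone hk) hn
  -- The diagonal chain controls all degrees `n ≥ N` at once. Only the finitely many degrees below
  -- `N` need their own stabilization index `M n`.
  obtain ⟨N, hN⟩ := hS ⟨fun k => J k k, fun _ _ h => hJ h h⟩
  choose M hM using fun n => hS ⟨fun k => J k n, fun _ _ h => hJ h le_rfl⟩
  let M' := max N ((Finset.range N).sup M)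
  refine ⟨M', fun k hk => le_antisymm (f.monotone hk) ?_⟩
  refine le_of_leadingIdeal_le h1 h2 h3 (f.monotone hk) fun n => ?_
  change J k n ≤ J M' n
  rcases lt_or_ge n N with hn | hn
  · have hle : M n ≤ M' := (Finset.le_sup (Finset.mem_range.2 hn)).trans (le_max_right _ _)
    exact ((hM n k (hle.trans hk)).symm.trans (hM n M' hle)).le
  -- For `n ≥ N` the ideal `J k n` is squeezed under a diagonal term beyond `N`, and that term
  -- equals `J N N`.
  · calc J k n ≤ J (max k n) (max k n) := hJ (le_max_left _ _) (le_max_right _ _)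
      _ = J N N := (hN _ (hn.trans (le_max_right _ _))).symm
      _ ≤ J M' n := hJ (le_max_left _ _) hn

/-- Passing to opposite rings exchanges the hypotheses `h1` and `h2`. Only the degree condition
needs work: the coefficients have to be moved from the right of `x ^ i` to the left. -/
theorem isNoetherianRing_op_of_normalizing [IsNoetherianRing Sᵐᵒᵖ]
    (h1 : ∀ a, ∃ b, x * C a = C b * x) (h2 : ∀ a, ∃ b, C a * x = x * C b)
    (h3 : ∀ t, ∃ n, t ∈ degLT C x n) : IsNoetherianRing Tᵐᵒᵖ := by
  refine isNoetherianRing_of_normalizing (C := C.op) (x := MulOpposite.op x)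
    (fun a => ?_) (fun a => ?_) (fun t => ?_)
  · obtain ⟨b, hb⟩ := h2 a.unop
    exact ⟨MulOpposite.op b, MulOpposite.unop_injective (by simpa using hb)⟩
  · obtain ⟨b, hb⟩ := h1 a.unop
    exact ⟨MulOpposite.op b, MulOpposite.unop_injective (by simpa using hb)⟩
  · obtain ⟨n, hn⟩ := h3 t.unop
    refine ⟨n, ?_⟩
    rw [← MulOpposite.op_unop t]
    generalize t.unop = s at hn
    induction hn using AddSubgroup.closure_induction with
    | mem y hy =>
      obtain ⟨i, hi, a, rfl⟩ := hy
      obtain ⟨b, hb⟩ := exists_pow_mul_eq h1 i a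
      rw [hb]
      have := pow_mul_mem_degLT C.op (MulOpposite.op x) hi (MulOpposite.op b)
      simpa using this
    | zero => simp
    | add y z _ _ hy hz => rw [MulOpposite.op_add]; exact add_mem hy hz
    | neg y _ hy => rw [MulOpposite.op_neg]; exact neg_mem hy

end Hilbert

/-! ### Skew polynomial rings -/

namespace SkewPoly

variable {S : Type*} [Ring S] (β : S ≃+* S)

/-- The `n`-th coefficient of a skew polynomial, coefficients being written on the left. -/
def coeff (n : ℕ) : SkewPoly β →+ S where
  toFun f := SkewMonoidAlgebra.coeff (show SkewPolynomial S from f) (Multiplicative.ofAdd n)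
  map_zero' := rfl
  map_add' f g := by
    change SkewMonoidAlgebra.coeff
      ((show SkewPolynomial S from f) + (show SkewPolynomial S from g)) _ = _
    rw [SkewMonoidAlgebra.coeff_add]; rfl

/-- The monomial `a X ^ n`. -/
def monomial (n : ℕ) : S →+ SkewPoly β where
  toFun a := (SkewMonoidAlgebra.single (Multiplicative.ofAdd n) a : SkewPolynomial S)
  map_zero' := SkewMonoidAlgebra.single_zero _
  map_add' := SkewMonoidAlgebra.single_add _

variable {β}

theorem coeff_monomial (m n : ℕ) (a : S) : coeff β m (monomial β n a) = if n = m then a else 0 :=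
  SkewPolynomial.coeff_monomial

@[ext] theorem ext {f g : SkewPoly β} (h : ∀ n, coeff β n f = coeff β n g) : f = g :=
  SkewMonoidAlgebra.ext (k := S) (G := Multiplicative ℕ) fun n => h n.toAdd

theorem induction {motive : SkewPoly β → Prop} (f : SkewPoly β)
    (add : ∀ f g, motive f → motive g → motive (f + g))
    (monomial : ∀ n a, motive (monomial β n a)) : motive f :=
  SkewPolynomial.induction (R := S) (motive := motive) f
    (by have h := monomial 0 0; rwa [map_zero] at h) fun n a g _ _ hg => add _ _ (monomial n a) hg

theorem exists_coeff_eq_zero (f : SkewPoly β) : ∃ N, ∀ n, N ≤ n → coeff β n f = 0 := by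
  induction f using induction with
  | add f g hf hg =>
    obtain ⟨N, hN⟩ := hf
    obtain ⟨M, hM⟩ := hg
    refine ⟨max N M, fun n hn => ?_⟩
    rw [map_add, hN n (le_of_max_le_left hn), hM n (le_of_max_le_right hn), add_zero]
  | monomial m a =>
    refine ⟨m + 1, fun n hn => ?_⟩
    rw [coeff_monomial, if_neg (by omega)]

theorem monomial_mul_monomial (m n : ℕ) (a b : S) :
    monomial β m a * monomial β n b = monomial β (m + n) (a * (β^[m]) b) := by
  let _ : MulSemiringAction (Multiplicative ℕ) S :=
    MulSemiringAction.compHom S (powersHom (S →+* S) (β : S →+* S))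
  exact SkewPolynomial.monomial_mul_monomial m n a b

theorem C_eq_monomial (a : S) : C β a = monomial β 0 a := rfl

theorem X_eq_monomial : X β = monomial β 1 1 := rfl

theorem X_pow (n : ℕ) : X β ^ n = monomial β n 1 := by
  induction n with
  | zero => rfl
  | succ n ih => rw [pow_succ, ih, X_eq_monomial, monomial_mul_monomial, iterate_map_one, mul_one]

theorem C_mul_monomial (n : ℕ) (a b : S) : C β a * monomial β n b = monomial β n (a * b) := by
  rw [C_eq_monomial, monomial_mul_monomial, zero_add, Function.iterate_zero, id_eq]

theorem monomial_eq (n : ℕ) (a : S) : monomial β n a = C β a * X β ^ n := by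
  rw [X_pow, C_mul_monomial, mul_one]

theorem coeff_C_mul (n : ℕ) (a : S) (f : SkewPoly β) :
    coeff β n (C β a * f) = a * coeff β n f := by
  induction f using induction with
  | add f g hf hg => rw [mul_add, map_add, hf, hg, map_add, mul_add]
  | monomial m b => rw [C_mul_monomial, coeff_monomial, coeff_monomial, mul_ite, mul_zero]

theorem C_injective : Function.Injective (C β) := fun a b h => by
  have := congrArg (coeff β 0) h
  simpa [C_eq_monomial, coeff_monomial] using this

section Lift

variable {B : Type*} [Ring B] (f : S →+* B) (x : B) (h : ∀ a, x * f a = f (β a) * x)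

/-- The universal property of the skew polynomial ring. -/
def lift : SkewPoly β →+* B :=
  letI : MulSemiringAction (Multiplicative ℕ) S :=
    MulSemiringAction.compHom S (powersHom (S →+* S) (β : S →+* S))
  (SkewMonoidAlgebra.liftNCRingHom f (powersHom B x) (by
    intro a n
    change f (((β : S →+* S) ^ n.toAdd) a) * x ^ n.toAdd = x ^ n.toAdd * f a
    -- The element `a` varies in the induction, because moving one factor `x` past `f a` replaces
    -- `a` by `β a`.
    induction n.toAdd generalizing a with
    | zero => simp
    | succ n ih =>
      rw [pow_succ x, mul_assoc (x ^ n), h, ← mul_assoc (x ^ n), ← ih, mul_assoc]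
      rfl) : SkewPolynomial S →+* B)

theorem lift_monomial (n : ℕ) (a : S) : lift f x h (monomial β n a) = f a * x ^ n :=
  SkewMonoidAlgebra.liftNC_single _ _ _ _

@[simp] theorem lift_C (a : S) : lift f x h (C β a) = f a := by
  rw [C_eq_monomial, lift_monomial, pow_zero, mul_one]

@[simp] theorem lift_X : lift f x h (X β) = x := by
  rw [X_eq_monomial, lift_monomial, pow_one, map_one, one_mul]

end Lift

theorem ringHom_ext {B : Type*} [Ring B] {f g : SkewPoly β →+* B}
    (h : ∀ a, f (C β a) = g (C β a)) (hX : f (X β) = g (X β)) : f = g := by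
  ext p
  induction p using induction with
  | add p r hp hr => rw [map_add, map_add, hp, hr]
  | monomial n a => rw [monomial_eq, map_mul, map_mul, map_pow, map_pow, h, hX]

/-- An automorphism of `S` commuting with `β` acts on the coefficients of skew polynomials. -/
def mapEquiv (τ : S ≃+* S) (hτ : ∀ a, τ (β a) = β (τ a)) : SkewPoly β ≃+* SkewPoly β :=
  RingEquiv.ofRingHom
    (lift ((C β).comp (τ : S →+* S)) (X β) fun a => by simp [X_mul_C, hτ])
    (lift ((C β).comp (τ.symm : S →+* S)) (X β) fun a => by
      have : τ.symm (β a) = β (τ.symm a) := by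
        rw [RingEquiv.symm_apply_eq, hτ, RingEquiv.apply_symm_apply]
      simp [X_mul_C, this])
    (ringHom_ext (by simp) (by simp)) (ringHom_ext (by simp) (by simp))

section MapEquiv

variable (τ : S ≃+* S) (hτ : ∀ a, τ (β a) = β (τ a))

@[simp] theorem mapEquiv_C (a : S) : mapEquiv τ hτ (C β a) = C β (τ a) :=
  lift_C _ _ (fun a => by simp [X_mul_C, hτ]) a

@[simp] theorem mapEquiv_X : mapEquiv τ hτ (X β) = X β :=
  lift_X _ _ (fun a => by simp [X_mul_C, hτ])

end MapEquiv

/-- Skew polynomials carry their coefficients on the left, `degLT` on the right; invertibility of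
`β` allows the exchange. -/
theorem mem_degLT (f : SkewPoly β) : ∃ n, f ∈ degLT (C β) (X β) n := by
  induction f using induction with
  | add f g hf hg =>
    obtain ⟨N, hN⟩ := hf
    obtain ⟨M, hM⟩ := hg
    exact ⟨max N M, add_mem (degLT_mono _ _ (le_max_left _ _) hN)
      (degLT_mono _ _ (le_max_right _ _) hM)⟩
  | monomial n a =>
    obtain ⟨b, hb⟩ := exists_mul_pow_eq (C := C β) (x := X β)
      (fun a => ⟨β.symm a, by rw [X_mul_C, RingEquiv.apply_symm_apply]⟩) n a
    rw [monomial_eq, hb]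
    exact ⟨n + 1, pow_mul_mem_degLT _ _ (Nat.lt_succ_self n) b⟩

instance isNoetherianRing [IsNoetherianRing S] : IsNoetherianRing (SkewPoly β) :=
  isNoetherianRing_of_normalizing (fun a => ⟨β a, X_mul_C β a⟩)
    (fun a => ⟨β.symm a, by rw [X_mul_C, RingEquiv.apply_symm_apply]⟩) mem_degLT

instance isNoetherianRing_op [IsNoetherianRing Sᵐᵒᵖ] : IsNoetherianRing (SkewPoly β)ᵐᵒᵖ :=
  isNoetherianRing_op_of_normalizing (fun a => ⟨β a, X_mul_C β a⟩)
    (fun a => ⟨β.symm a, by rw [X_mul_C, RingEquiv.apply_symm_apply]⟩) mem_degLT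

theorem mul_comm_of_forall (hS : ∀ a b : S, a * b = b * a) (hβ : ∀ a, β a = a)
    (f g : SkewPoly β) : f * g = g * f := by
  have hβ' : ∀ n a, (β^[n]) a = a := fun n a => Function.iterate_fixed (hβ a) n
  induction f using induction with
  | add f f' hf hf' => rw [add_mul, mul_add, hf, hf']
  | monomial m a =>
    induction g using induction with
    | add g g' hg hg' => rw [add_mul, mul_add, hg, hg']
    | monomial n b =>
      rw [monomial_mul_monomial, monomial_mul_monomial, hβ', hβ', hS, add_comm]

/-! #### Divisibility by constants -/

section Dvd

theorem C_dvd_iff {z : S} {f : SkewPoly β} : C β z ∣ f ↔ ∀ n, z ∣ coeff β n f := by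
  refine ⟨?_, fun h => ?_⟩
  · rintro ⟨g, rfl⟩ n
    rw [coeff_C_mul]
    exact dvd_mul_right _ _
  · obtain ⟨N, hN⟩ := exists_coeff_eq_zero f
    choose c hc using h
    -- The quotient is formed coefficientwise and cut off at `N`: the chosen `c i` need not vanish
    -- where the coefficients of `f` do.
    refine ⟨∑ i ∈ Finset.range N, monomial β i (c i), ?_⟩
    ext n
    rw [coeff_C_mul, map_sum]
    simp only [coeff_monomial]
    rw [Finset.sum_ite_eq']
    split_ifs with hn
    · exact hc n
    · rw [hN n (by simpa using hn), mul_zero]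

/-- Only the pair of top monomials reaches degree `N + M`; the twist by `β^[N]` comes from moving `X
^ N` past the second coefficient. -/
theorem coeff_sum_mul_sum (N M : ℕ) (a b : ℕ → S) :
    coeff β (N + M) ((∑ i ∈ Finset.range (N + 1), monomial β i (a i)) *
      ∑ j ∈ Finset.range (M + 1), monomial β j (b j)) = a N * (β^[N]) (b M) := by
  rw [Finset.sum_mul_sum, map_sum, Finset.sum_eq_single N, map_sum, Finset.sum_eq_single M]
  · rw [monomial_mul_monomial, coeff_monomial, if_pos rfl]
  · intro j hj hne
    rw [monomial_mul_monomial, coeff_monomial, if_neg (by omega)]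
  · simp
  · intro i hi hne
    rw [map_sum]
    refine Finset.sum_eq_zero fun j hj => ?_
    rw [Finset.mem_range] at hi hj
    rw [monomial_mul_monomial, coeff_monomial, if_neg (by omega)]
  · simp

/-- The index `N` is the largest one whose coefficient is not divisible by `z`. It serves as the
degree of `f` modulo `z`, without forming the quotient ring. -/
theorem exists_top_not_dvd {z : S} {f : SkewPoly β} (hf : ¬ C β z ∣ f) :
    ∃ N, ¬ z ∣ coeff β N f ∧
      C β z ∣ f - ∑ i ∈ Finset.range (N + 1), monomial β i (coeff β i f) := by
  classical
  rw [C_dvd_iff, not_forall] at hf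
  obtain ⟨M, hM⟩ := exists_coeff_eq_zero f
  have hlt : ∀ n, ¬ z ∣ coeff β n f → n ≤ M := fun n hn => by
    by_contra h
    exact hn (by rw [hM n (by omega)]; exact dvd_zero z)
  obtain ⟨n, hn⟩ := hf
  refine ⟨Nat.findGreatest (fun n => ¬ z ∣ coeff β n f) M,
    Nat.findGreatest_spec (P := fun n => ¬ z ∣ coeff β n f) (hlt n hn) hn, ?_⟩
  rw [C_dvd_iff]
  intro m
  rw [map_sub, map_sum]
  simp only [coeff_monomial]
  rw [Finset.sum_ite_eq']
  split_ifs with h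
  · rw [sub_self]; exact dvd_zero z
  · rw [sub_zero]
    by_contra hm
    rw [Finset.mem_range, Nat.lt_succ_iff] at h
    exact h (Nat.le_findGreatest (hlt m hm) hm)

theorem C_central {z : S} (hz : ∀ a, z * a = a * z) (hβ : β z = z) (f : SkewPoly β) :
    C β z * f = f * C β z := by
  induction f using induction with
  | add f g hf hg => rw [mul_add, add_mul, hf, hg]
  | monomial n a =>
    rw [C_mul_monomial, C_eq_monomial, monomial_mul_monomial, Function.iterate_fixed hβ, hz,
      add_zero]

/-- A central `β`-invariant element generating a completely prime ideal of `S` generates a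
completely prime ideal of the skew polynomial ring. -/
theorem C_dvd_or_dvd {z : S} (hz : ∀ a, z * a = a * z) (hβ : β z = z)
    (hp : ∀ a b, z ∣ a * b → z ∣ a ∨ z ∣ b) {f g : SkewPoly β} (h : C β z ∣ f * g) :
    C β z ∣ f ∨ C β z ∣ g := by
  by_contra hcon
  rw [not_or] at hcon
  obtain ⟨N, hN, hf⟩ := exists_top_not_dvd hcon.1
  obtain ⟨M, hM, hg⟩ := exists_top_not_dvd hcon.2
  set f' := ∑ i ∈ Finset.range (N + 1), monomial β i (coeff β i f)
  set g' := ∑ i ∈ Finset.range (M + 1), monomial β i (coeff β i g)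
  -- Cutting off `f` and `g` above their degrees modulo `z` changes the product by a multiple of `C
  -- β z`. Centrality is needed for the error in `g`, which occurs on the right of `f'`.
  have h1 : C β z ∣ f' * g' := by
    have e : f' * g' = f * g - (f - f') * g - f' * (g - g') := by noncomm_ring
    rw [e]
    refine dvd_sub (dvd_sub h (hf.mul_right g)) ?_
    obtain ⟨k, hk⟩ := hg
    exact ⟨f' * k, by rw [hk, ← mul_assoc, ← C_central hz hβ f', mul_assoc]⟩
  have h2 := C_dvd_iff.1 h1 (N + M)
  rw [coeff_sum_mul_sum] at h2
  rcases hp _ _ h2 with h3 | ⟨c, hc⟩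
  · exact hN h3
  -- Divisibility of `β^[N]` of the coefficient is pulled back along `β.symm^[N]`, which fixes `z`.
  · refine hM ⟨(β.symm^[N]) c, ?_⟩
    have hi : Function.LeftInverse (β.symm^[N]) (β^[N]) :=
      Function.LeftInverse.iterate β.symm_apply_apply N
    have hβ' : β.symm z = z := by rw [RingEquiv.symm_apply_eq, hβ]
    rw [← hi (coeff β M g), hc, iterate_map_mul, Function.iterate_fixed hβ']

/-- This is the case `z = 0` of `C_dvd_or_dvd`, since only zero is divisible by zero. -/
theorem noZeroDivisors [NoZeroDivisors S] : NoZeroDivisors (SkewPoly β) where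
  eq_zero_or_eq_zero_of_mul_eq_zero {f g} h := by
    have := C_dvd_or_dvd (β := β) (z := 0) (by simp) (map_zero β) (by simp) (f := f) (g := g)
      (by rw [h]; exact dvd_zero _)
    simpa [map_zero, zero_dvd_iff] using this

end Dvd

end SkewPoly

/-! ### Laurent polynomials -/

section Laurent

open LaurentPolynomial

theorem laurent_isNoetherianRing (R : Type*) [CommRing R] [IsNoetherianRing R] :
    IsNoetherianRing (LaurentPolynomial R) :=
  IsLocalization.isNoetherianRing (Submonoid.powers (Polynomial.X : Polynomial R)) _ inferInstance

theorem laurent_ringHom_ext {R B : Type*} [Semiring R] [Ring B] {f g : LaurentPolynomial R →+* B}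
    (hC : ∀ a, f (C a) = g (C a)) (hT : f (T 1) = g (T 1)) : f = g := by
  let t : (LaurentPolynomial R)ˣ :=
    ⟨T 1, T (-1), by rw [← T_add]; simp, by rw [← T_add]; simp⟩
  have ht : Units.map (f : _ →* B) t = Units.map (g : _ →* B) t := Units.ext hT
  have hT' : f (T (-1)) = g (T (-1)) :=
    congrArg (fun u : Bˣ => ((u⁻¹ : Bˣ) : B)) ht
  refine RingHom.ext fun p => ?_
  induction p using LaurentPolynomial.induction_on with
  | h_C a => exact hC a
  | h_add hp hq => rw [map_add, map_add, hp, hq]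
  | h_C_mul_T n a h => rw [T_add, ← mul_assoc, map_mul, h, hT, ← map_mul]
  | h_C_mul_T_Z n a h => rw [T_sub, ← mul_assoc, map_mul, h, hT', ← map_mul]

variable {R : Type*} [CommRing R]

/-- The variable of the Laurent polynomial ring as a unit. -/
def laurentT (R : Type*) [CommRing R] : (LaurentPolynomial R)ˣ where
  val := T 1
  inv := T (-1)
  val_inv := by rw [← T_add]; simp
  inv_val := by rw [← T_add]; simp

@[simp] theorem val_laurentT : (laurentT R : LaurentPolynomial R) = T 1 := rfl

/-- The homomorphism of Laurent polynomial rings acting by `τ` on coefficients and sending `T` to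
`u T`. -/
def laurentHom (τ : R ≃+* R) (u : Rˣ) : LaurentPolynomial R →+* LaurentPolynomial R :=
  eval₂ (C.comp (τ : R →+* R))
    (Units.map (C : R →+* LaurentPolynomial R).toMonoidHom u * laurentT R)

@[simp] theorem laurentHom_C (τ : R ≃+* R) (u : Rˣ) (a : R) :
    laurentHom τ u (C a) = C (τ a) := by simp [laurentHom]

@[simp] theorem laurentHom_T (τ : R ≃+* R) (u : Rˣ) :
    laurentHom τ u (T 1) = C (u : R) * T 1 := by simp [laurentHom]

/-- The automorphism of Laurent polynomials acting by `τ` on coefficients and sending `T` to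
`u T`. -/
def laurentAut (τ : R ≃+* R) (u : Rˣ) : LaurentPolynomial R ≃+* LaurentPolynomial R :=
  RingEquiv.ofRingHom (laurentHom τ u)
    (laurentHom τ.symm (Units.map (τ.symm : R →+* R).toMonoidHom u⁻¹))
    (laurent_ringHom_ext (by simp) (by
      simp only [RingHom.comp_apply, laurentHom_T, map_mul, laurentHom_C, RingHom.id_apply]
      rw [← mul_assoc, ← map_mul]
      simp))
    (laurent_ringHom_ext (by simp) (by
      simp only [RingHom.comp_apply, laurentHom_T, map_mul, laurentHom_C, RingHom.id_apply]
      rw [← mul_assoc, ← map_mul]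
      have : τ.symm (u : R) * ((Units.map (τ.symm : R →+* R).toMonoidHom u⁻¹ : Rˣ) : R) = 1 := by
        change τ.symm (u : R) * τ.symm ((u⁻¹ : Rˣ) : R) = 1
        rw [← map_mul, Units.mul_inv, map_one]
      rw [this]; simp))

@[simp] theorem laurentAut_C (τ : R ≃+* R) (u : Rˣ) (a : R) :
    laurentAut τ u (C a) = C (τ a) := laurentHom_C τ u a

@[simp] theorem laurentAut_T (τ : R ≃+* R) (u : Rˣ) :
    laurentAut τ u (T 1) = C (u : R) * T 1 := laurentHom_T τ u

theorem laurentAut_id {τ : R ≃+* R} {u : Rˣ} (hτ : ∀ a, τ a = a) (hu : u = 1)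
    (f : LaurentPolynomial R) : laurentAut τ u f = f := by
  have : (laurentAut τ u : LaurentPolynomial R →+* LaurentPolynomial R) = RingHom.id _ :=
    laurent_ringHom_ext (by simp [hτ]) (by simp [hu])
  exact congrArg (fun g : LaurentPolynomial R →+* LaurentPolynomial R => g f) this

/-- The difference `T v⁻¹ - 1` divides exactly the Laurent polynomials vanishing at `v`. -/
theorem laurent_dvd_iff (v : Rˣ) (f : LaurentPolynomial R) :
    T 1 * C ((v⁻¹ : Rˣ) : R) - 1 ∣ f ↔ eval₂ (RingHom.id R) v f = 0 := by
  set z : LaurentPolynomial R := T 1 * C ((v⁻¹ : Rˣ) : R) - 1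
  refine ⟨?_, fun h => ?_⟩
  · rintro ⟨g, rfl⟩
    have : eval₂ (RingHom.id R) v z = 0 := by simp [z]
    rw [map_mul, this, zero_mul]
  · rw [← Ideal.mem_span_singleton, ← Ideal.Quotient.eq_zero_iff_mem]
    -- Modulo `z` the variable `T` equals the constant `v`, so the quotient map factors through
    -- evaluation at `v`.
    have key : Ideal.Quotient.mk (Ideal.span {z}) =
        ((Ideal.Quotient.mk (Ideal.span {z})).comp C).comp (eval₂ (RingHom.id R) v) := by
      refine laurent_ringHom_ext (by simp) ?_
      rw [RingHom.comp_apply, eval₂_T, zpow_one, RingHom.comp_apply, Ideal.Quotient.eq,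
        Ideal.mem_span_singleton]
      refine ⟨C (v : R), ?_⟩
      rw [sub_mul, mul_assoc, ← map_mul, Units.inv_mul, map_one, mul_one, one_mul]
    rw [key, RingHom.comp_apply, h, map_zero]

/-- The multiples of the given element are the kernel of evaluation at `v`, and evaluation takes
values in a domain. -/
theorem laurent_dvd_or_dvd [IsDomain R] (v : Rˣ) {f g : LaurentPolynomial R}
    (h : T 1 * C ((v⁻¹ : Rˣ) : R) - 1 ∣ f * g) :
    T 1 * C ((v⁻¹ : Rˣ) : R) - 1 ∣ f ∨ T 1 * C ((v⁻¹ : Rˣ) : R) - 1 ∣ g := by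
  rw [laurent_dvd_iff, map_mul, mul_eq_zero] at h
  rwa [laurent_dvd_iff, laurent_dvd_iff]

end Laurent

/-! ### The torus -/

namespace Torus

open LaurentPolynomial

variable {L : Type u} [NormedField L] [IsUltrametricDist L]

instance : IsNoetherianRing (Torus L) := by
  have := laurent_isNoetherianRing (Residue L)
  have := laurent_isNoetherianRing (LaurentPolynomial (Residue L))
  exact laurent_isNoetherianRing (LaurentPolynomial (LaurentPolynomial (Residue L)))

instance : IsNoetherianRing (Torus L)ᵐᵒᵖ :=
  isNoetherianRing_of_ringEquiv (Torus L) (RingEquiv.toOpposite (Torus L))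

instance : IsDomain (Torus L) :=
  inferInstanceAs (IsDomain (LaurentPolynomial (LaurentPolynomial (LaurentPolynomial (Residue L)))))

/-- The automorphism of the torus multiplying `K` and `K₋` by `u`. -/
def scaleAut (u : (Residue L)ˣ) : Torus L ≃+* Torus L :=
  (laurentAut (laurentAut (RingEquiv.refl _) (Units.map (C : Residue L →+* _).toMonoidHom u))
    (Units.map (C : LaurentPolynomial (Residue L) →+* _).toMonoidHom
      (Units.map (C : Residue L →+* _).toMonoidHom u)) :
    LaurentPolynomial (LaurentPolynomial (LaurentPolynomial (Residue L))) ≃+* _)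

theorem scaleAut_const (u : (Residue L)ˣ) (a : LaurentPolynomial (Residue L)) :
    scaleAut u (const a) = const a := by
  change laurentAut _ _ (C (C a)) = C (C a)
  rw [laurentAut_C, laurentAut_C]; rfl

theorem scaleAut_K (u : (Residue L)ˣ) : scaleAut u K = scalar (u : Residue L) * K := by
  change laurentAut _ _ (C (T 1)) = C (C (C (u : Residue L))) * C (T 1)
  rw [laurentAut_C, laurentAut_T, map_mul]; rfl

theorem scaleAut_Km (u : (Residue L)ˣ) : scaleAut u Km = scalar (u : Residue L) * Km := by
  change laurentAut _ _ (T 1) = C (C (C (u : Residue L))) * T 1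
  rw [laurentAut_T]; rfl

theorem scaleAut_one (a : Torus L) : scaleAut 1 a = a :=
  laurentAut_id (laurentAut_id (fun _ => rfl) (by simp)) (by simp) a

/-- The inverse of `K`. -/
def Kinv : Torus L :=
  (C (T (-1)) : LaurentPolynomial (LaurentPolynomial (LaurentPolynomial (Residue L))))

theorem K_mul_Kinv : (K : Torus L) * Kinv = 1 := by
  have : (C (T 1) * C (T (-1)) :
      LaurentPolynomial (LaurentPolynomial (LaurentPolynomial (Residue L)))) = 1 := by
    rw [← map_mul, ← T_add]; simp
  exact this

/-- The element `K₋ K⁻¹ - 1`. -/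
def z : Torus L := Km * Kinv - 1

/-- `K` and `K₋` are scaled by the same factor, so the ratio `K₋ K⁻¹` is fixed. -/
theorem scaleAut_z (u : (Residue L)ˣ) : scaleAut u z = z := by
  have h1 : scaleAut u (Kinv : Torus L) * (scalar (u : Residue L) * K) = 1 := by
    rw [← scaleAut_K, ← map_mul, mul_comm, K_mul_Kinv, map_one]
  have h2 : scaleAut u (Kinv : Torus L) * scalar (u : Residue L) = Kinv := by
    calc _ = scaleAut u (Kinv : Torus L) * (scalar (u : Residue L) * K) * Kinv := by
          rw [mul_assoc, mul_assoc, K_mul_Kinv, mul_one]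
      _ = _ := by rw [h1, one_mul]
  rw [z, map_sub, map_mul, map_one, scaleAut_Km, mul_right_comm, mul_comm _ (scaleAut u Kinv), h2,
    mul_comm]

/-- The torus is a Laurent polynomial ring in `K₋` over the domain of Laurent polynomials in `π` and
`K`. There `z` is the element attached to the point `K₋ = K`, and `laurentT` denotes the unit `K`.
-/
theorem z_dvd_or_dvd (a b : Torus L) (h : z ∣ a * b) : z ∣ a ∨ z ∣ b :=
  laurent_dvd_or_dvd (laurentT (LaurentPolynomial (Residue L))) h

theorem not_z_dvd_one : ¬ (z : Torus L) ∣ 1 := fun h => by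
  have := (laurent_dvd_iff (laurentT (LaurentPolynomial (Residue L))) 1).1 h
  rw [map_one] at this
  exact one_ne_zero this

end Torus

/-! ### Symbols in the associated graded ring -/

section Symbols

variable {A : Type*} [NormedRing A] [IsUltrametricDist A] [NormOneClass A]

theorem symbol_congr {a b : A} {r s : ℝ} (hab : a = b) (hrs : r = s) (hr : 0 < r) (ha : ‖a‖ ≤ r) :
    symbol a r hr ha = symbol b s (hrs ▸ hr) (hab ▸ hrs ▸ ha) := by
  subst hab hrs; rfl

theorem symbol_add {a b : A} {r : ℝ} (hr : 0 < r) (ha : ‖a‖ ≤ r) (hb : ‖b‖ ≤ r) :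
    symbol a r hr ha + symbol b r hr hb =
      symbol (a + b) r hr ((IsUltrametricDist.norm_add_le_max a b).trans (max_le ha hb)) := by
  refine (map_add (Ideal.Quotient.mk (reesIdeal A)) _ _).symm.trans (congrArg _ ?_)
  exact Subtype.ext (MonoidAlgebra.single_add _ _ _).symm

theorem symbol_mul {a b : A} {r s : ℝ} (hr : 0 < r) (hs : 0 < s) (ha : ‖a‖ ≤ r) (hb : ‖b‖ ≤ s) :
    symbol a r hr ha * symbol b s hs hb = symbol (a * b) (r * s) (mul_pos hr hs)
      ((norm_mul_le a b).trans (mul_le_mul ha hb (norm_nonneg b) hr.le)) := by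
  refine (map_mul (Ideal.Quotient.mk (reesIdeal A)) _ _).symm.trans (congrArg _ ?_)
  exact Subtype.ext (MonoidAlgebra.single_mul_single _ _ _ _)

theorem symbol_one : symbol (1 : A) 1 one_pos norm_one.le = 1 :=
  map_one (Ideal.Quotient.mk (reesIdeal A))

theorem symbol_pow {a : A} {r : ℝ} (hr : 0 < r) (ha : ‖a‖ ≤ r) (n : ℕ) :
    symbol a r hr ha ^ n = symbol (a ^ n) (r ^ n) (pow_pos hr n)
      ((norm_pow_le a n).trans (pow_le_pow_left₀ (norm_nonneg a) ha n)) := by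
  induction n with
  | zero =>
    rw [pow_zero, ← symbol_one]
    exact symbol_congr (pow_zero a).symm (pow_zero r).symm _ _
  | succ n ih =>
    rw [pow_succ, ih, symbol_mul]
    exact symbol_congr (pow_succ a n).symm (pow_succ r n).symm _ _

theorem symbol_eq_iff {a b : A} {r : ℝ} (hr : 0 < r) (ha : ‖a‖ ≤ r) (hb : ‖b‖ ≤ r) :
    symbol a r hr ha = symbol b r hr hb ↔ ‖a - b‖ < r := by
  classical
  refine (Ideal.Quotient.eq (I := reesIdeal A)).trans ?_
  change (∀ s : PosReal, ‖(MonoidAlgebra.single _ a - MonoidAlgebra.single _ b :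
    MonoidAlgebra A PosReal).coeff s‖ < s) ↔ _
  rw [← MonoidAlgebra.single_sub]
  simp only [MonoidAlgebra.coeff_single, Finsupp.single_apply]
  refine ⟨fun h => by simpa using h ⟨r, hr⟩, fun h s => ?_⟩
  split_ifs with hs
  · rw [← hs]; exact h
  · simpa using s.2

theorem symbol_eq_zero_iff {a : A} {r : ℝ} (hr : 0 < r) (ha : ‖a‖ ≤ r) :
    symbol a r hr ha = 0 ↔ ‖a‖ < r := by
  have h0 : symbol (0 : A) r hr (by simpa using hr.le) = 0 := by
    have := symbol_add (a := (0 : A)) (b := 0) hr (by simpa using hr.le) (by simpa using hr.le)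
    rw [symbol_congr (add_zero (0 : A)) rfl] at this
    exact left_eq_add.1 this.symm
  rw [← h0, symbol_eq_iff, sub_zero]

/-- An element of the Rees ring is the finite sum of its homogeneous components, so additive
statements need only be tested on symbols. -/
theorem Gr.induction {motive : Gr A → Prop} (x : Gr A)
    (add : ∀ x y, motive x → motive y → motive (x + y))
    (symbol : ∀ a r hr ha, motive (symbol a r hr ha)) : motive x := by
  classical
  obtain ⟨⟨f, hf⟩, rfl⟩ := Ideal.Quotient.mk_surjective x
  have hsum : (⟨f, hf⟩ : rees A) =
      ∑ r ∈ f.coeff.support, reesSingle (f.coeff r) r r.2 (hf r) := by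
    apply Subtype.ext
    rw [AddSubmonoidClass.coe_finsetSum]
    exact (MonoidAlgebra.sum_coeff_single f).symm
  rw [hsum, map_sum]
  refine Finset.sum_induction _ motive add ?_ fun r _ => symbol _ _ r.2 (hf r)
  -- The empty sum is covered by regarding zero as the symbol of `0` in degree `1`.
  have h0 := symbol 0 1 one_pos (by simp)
  rwa [(symbol_eq_zero_iff one_pos (by simp)).2 (by simp)] at h0

/-- If the symbol of `x` is a sum of left multiples of symbols, then the multipliers can be taken
homogeneous. -/
theorem exists_norm_sub_sum_lt {ι : Type*} (s : Finset ι) (b : ι → Gr A) (t : ι → A) (ρ : ι → ℝ)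
    (hρ : ∀ i, 0 < ρ i) (ht : ∀ i, ‖t i‖ ≤ ρ i) {x : A} {r : ℝ} (hr : 0 < r) (hx : ‖x‖ ≤ r)
    (h : symbol x r hr hx = ∑ i ∈ s, b i * symbol (t i) (ρ i) (hρ i) (ht i)) :
    ∃ a : ι → A, (∀ i, ‖a i‖ * ρ i ≤ r) ∧ ‖x - ∑ i ∈ s, a i * t i‖ < r := by
  classical
  choose f hf using fun i => Ideal.Quotient.mk_surjective (I := reesIdeal A) (b i)
  have h' : reesSingle x r hr hx - ∑ i ∈ s, f i * reesSingle (t i) (ρ i) (hρ i) (ht i) ∈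
      reesIdeal A := by
    rw [← Ideal.Quotient.eq, map_sum]
    refine h.trans (Finset.sum_congr rfl fun i _ => ?_)
    rw [map_mul, hf]; rfl
  -- In degree `r` only the component of the multiplier in degree `r / ρ i` contributes; it is taken
  -- as `a i`.
  refine ⟨fun i => (f i : MonoidAlgebra A PosReal).coeff (⟨r, hr⟩ * ⟨ρ i, hρ i⟩⁻¹), fun i => ?_, ?_⟩
  · have := (f i).2 (⟨r, hr⟩ * ⟨ρ i, hρ i⟩⁻¹)
    refine (mul_le_mul_of_nonneg_right this (hρ i).le).trans ?_
    change r * (ρ i)⁻¹ * ρ i ≤ r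
    rw [inv_mul_cancel_right₀ (hρ i).ne']
  · have := h' ⟨r, hr⟩
    rw [AddSubgroupClass.coe_sub, AddSubmonoidClass.coe_finsetSum, MonoidAlgebra.coeff_sub,
      MonoidAlgebra.coeff_sum, Finsupp.sub_apply, Finsupp.finsetSum_apply] at this
    refine lt_of_eq_of_lt (congrArg norm ?_) this
    refine congrArg₂ _ ?_ (Finset.sum_congr rfl fun i _ => ?_)
    · simp [reesSingle]
    · exact (MonoidAlgebra.coeff_mul_single_apply _ _ _ _).symm

/-- The analogue of `exists_norm_sub_sum_lt` for right multiples. -/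
theorem exists_norm_sub_sum_lt' {ι : Type*} (s : Finset ι) (b : ι → Gr A) (t : ι → A) (ρ : ι → ℝ)
    (hρ : ∀ i, 0 < ρ i) (ht : ∀ i, ‖t i‖ ≤ ρ i) {x : A} {r : ℝ} (hr : 0 < r) (hx : ‖x‖ ≤ r)
    (h : symbol x r hr hx = ∑ i ∈ s, symbol (t i) (ρ i) (hρ i) (ht i) * b i) :
    ∃ a : ι → A, (∀ i, ‖a i‖ * ρ i ≤ r) ∧ ‖x - ∑ i ∈ s, t i * a i‖ < r := by
  classical
  choose f hf using fun i => Ideal.Quotient.mk_surjective (I := reesIdeal A) (b i)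
  have h' : reesSingle x r hr hx - ∑ i ∈ s, reesSingle (t i) (ρ i) (hρ i) (ht i) * f i ∈
      reesIdeal A := by
    rw [← Ideal.Quotient.eq, map_sum]
    refine h.trans (Finset.sum_congr rfl fun i _ => ?_)
    rw [map_mul, hf]; rfl
  refine ⟨fun i => (f i : MonoidAlgebra A PosReal).coeff (⟨ρ i, hρ i⟩⁻¹ * ⟨r, hr⟩), fun i => ?_, ?_⟩
  · have := (f i).2 (⟨ρ i, hρ i⟩⁻¹ * ⟨r, hr⟩)
    refine (mul_le_mul_of_nonneg_right this (hρ i).le).trans ?_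
    change (ρ i)⁻¹ * r * ρ i ≤ r
    rw [mul_right_comm, inv_mul_cancel₀ (hρ i).ne', one_mul]
  · have := h' ⟨r, hr⟩
    rw [AddSubgroupClass.coe_sub, AddSubmonoidClass.coe_finsetSum, MonoidAlgebra.coeff_sub,
      MonoidAlgebra.coeff_sum, Finsupp.sub_apply, Finsupp.finsetSum_apply] at this
    refine lt_of_eq_of_lt (congrArg norm ?_) this
    refine congrArg₂ _ ?_ (Finset.sum_congr rfl fun i _ => ?_)
    · simp [reesSingle]
    · exact (MonoidAlgebra.coeff_single_mul_apply _ _ _ _).symm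

/-- This turns divisibility in the graded ring into an approximation of `x` by a multiple of `z`. It
is the case of a single right multiple. -/
theorem exists_norm_sub_mul_lt {z x : A} {r : ℝ} (hr : 0 < r) (hx : ‖x‖ ≤ r) (hz : ‖z‖ ≤ 1)
    (h : symbol z 1 one_pos hz ∣ symbol x r hr hx) : ∃ w, ‖x - z * w‖ < r := by
  obtain ⟨b, hb⟩ := h
  obtain ⟨a, -, ha⟩ := exists_norm_sub_sum_lt' {()} (fun _ => b) (fun _ => z) (fun _ => 1)
    (fun _ => one_pos) (fun _ => hz) hr hx (by simpa using hb)
  exact ⟨a (), by simpa using ha⟩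

/-- If `‖x * y‖` were smaller than `‖x‖ * ‖y‖`, the symbols of `x` and `y` in the degrees of their
norms would be nonzero with product zero. -/
theorem norm_mul_of_noZeroDivisors [NoZeroDivisors (Gr A)] (x y : A) : ‖x * y‖ = ‖x‖ * ‖y‖ := by
  rcases eq_or_ne x 0 with rfl | hx
  · simp
  rcases eq_or_ne y 0 with rfl | hy
  · simp
  refine (norm_mul_le x y).antisymm (le_of_not_gt fun h => ?_)
  have hx' := norm_pos_iff.2 hx
  have hy' := norm_pos_iff.2 hy
  have h0 : symbol x ‖x‖ hx' le_rfl * symbol y ‖y‖ hy' le_rfl = 0 := by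
    rw [symbol_mul, symbol_eq_zero_iff]; exact h
  rcases mul_eq_zero.1 h0 with h0 | h0
  · exact lt_irrefl _ ((symbol_eq_zero_iff _ _).1 h0)
  · exact lt_irrefl _ ((symbol_eq_zero_iff _ _).1 h0)

end Symbols

/-! ### Noetherianity of complete rings -/

section Noetherian

variable {A : Type*} [NormedRing A]

/-- The norm of `A` takes values in `ρ ^ ℤ ∪ {0}`. -/
def DiscreteNorm (A : Type*) [NormedRing A] (ρ : ℝ) : Prop :=
  ∀ x : A, x ≠ 0 → ∃ n : ℤ, ‖x‖ = ρ ^ n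

/-- Consecutive values of the norm differ by a factor at most `ρ`. Strict improvements thus become
geometric ones, which is what makes successive approximation converge. -/
theorem DiscreteNorm.le_mul {ρ : ℝ} (hρ : 0 < ρ) (hρ1 : ρ < 1) (h : DiscreteNorm A ρ) {x y : A}
    (hxy : ‖x‖ < ‖y‖) : ‖x‖ ≤ ρ * ‖y‖ := by
  rcases eq_or_ne x 0 with rfl | hx
  · simpa using mul_nonneg hρ.le (norm_nonneg y)
  · obtain ⟨m, hm⟩ := h x hx
    obtain ⟨n, hn⟩ := h y (norm_pos_iff.1 ((norm_nonneg x).trans_lt hxy))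
    rw [hm, hn] at hxy ⊢
    rw [← zpow_one_add₀ hρ.ne']
    have := (zpow_lt_zpow_iff_right_of_lt_one₀ hρ hρ1).1 hxy
    exact zpow_le_zpow_right_of_le_one₀ hρ hρ1.le (by omega)

/-- A left ideal of a complete ring with discrete norm is finitely generated if its elements can be
approximated by combinations of finitely many of them. -/
theorem fg_of_approx [CompleteSpace A] {ρ : ℝ} (hρ : 0 < ρ) (hρ1 : ρ < 1) (hA : DiscreteNorm A ρ)
    (I : Ideal A) {ι : Type*} [Fintype ι] (t : ι → A) (hT : ∀ i, t i ∈ I) (hT0 : ∀ i, t i ≠ 0)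
    (happ : ∀ x ∈ I, x ≠ 0 → ∃ a : ι → A, (∀ i, ‖a i‖ * ‖t i‖ ≤ ‖x‖) ∧
      ‖x - ∑ i, a i * t i‖ < ‖x‖) : I.FG := by
  classical
  refine ⟨Finset.univ.image t, le_antisymm (Submodule.span_le.2 ?_) fun x hx => ?_⟩
  · rw [Finset.coe_image]; rintro _ ⟨i, -, rfl⟩; exact hT i
  have happ' : ∀ y : I, ∃ a : ι → A, (∀ i, ‖a i‖ * ‖t i‖ ≤ ‖(y : A)‖) ∧
      ‖(y : A) - ∑ i, a i * t i‖ ≤ ρ * ‖(y : A)‖ := by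
    rintro ⟨y, hy⟩
    rcases eq_or_ne y 0 with rfl | hy0
    · exact ⟨0, by simp, by simp⟩
    · obtain ⟨a, h1, h2⟩ := happ y hy hy0
      exact ⟨a, h1, hA.le_mul hρ hρ1 h2⟩
  choose a ha1 ha2 using happ'
  -- Each `y n` is the error left after `n` approximations; it stays in `I` because the
  -- approximating combination does.
  let next : I → I := fun y => ⟨y - ∑ i, a y i * t i,
    sub_mem y.2 (sum_mem fun i _ => I.mul_mem_left _ (hT i))⟩
  let y : ℕ → I := fun n => next^[n] ⟨x, hx⟩
  have hy : ∀ n, (y (n + 1) : A) = y n - ∑ i, a (y n) i * t i := fun n => by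
    simp only [y, Function.iterate_succ_apply']; rfl
  have hyn : ∀ n, ‖(y n : A)‖ ≤ ‖x‖ * ρ ^ n := fun n => by
    induction n with
    | zero => simp [y]
    | succ n ih =>
      rw [hy]
      refine (ha2 (y n)).trans ?_
      rw [pow_succ', mul_left_comm]
      exact mul_le_mul_of_nonneg_left ih hρ.le
  -- The multiplier of `t i` has norm at most `‖y n‖ / ‖t i‖`, so the bound `‖x‖ * ρ ^ n` on the
  -- errors makes the series of multipliers converge.
  have hsum : ∀ i, Summable fun n => a (y n) i := fun i => by
    have ht0 : 0 < ‖t i‖ := norm_pos_iff.2 (hT0 i)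
    refine Summable.of_norm_bounded (g := fun n => ‖x‖ / ‖t i‖ * ρ ^ n)
      ((summable_geometric_of_lt_one hρ.le hρ1).mul_left _) fun n => ?_
    rw [div_mul_eq_mul_div, le_div_iff₀ ht0]
    exact (ha1 (y n) i).trans (hyn n)
  have hpart : ∀ n, x - y n = ∑ i, (∑ k ∈ Finset.range n, a (y k) i) * t i := fun n => by
    induction n with
    | zero => simp [y]
    | succ n ih =>
      rw [hy, ← sub_add, ih, ← Finset.sum_add_distrib]
      refine Finset.sum_congr rfl fun i _ => ?_
      rw [Finset.sum_range_succ, add_mul]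
  have hlim1 : Filter.Tendsto (fun n => x - (y n : A)) Filter.atTop (𝓝 x) := by
    have h0 : Filter.Tendsto (fun n => (y n : A)) Filter.atTop (𝓝 0) := by
      refine squeeze_zero_norm hyn ?_
      simpa using (tendsto_pow_atTop_nhds_zero_of_lt_one hρ.le hρ1).const_mul ‖x‖
    simpa using h0.const_sub x
  have hlim2 : Filter.Tendsto (fun n => x - (y n : A)) Filter.atTop
      (𝓝 (∑ i, (∑' k, a (y k) i) * t i)) := by
    simp only [hpart]
    exact tendsto_finsetSum _ fun i _ => ((hsum i).hasSum.tendsto_sum_nat).mul_const (t i)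
  -- The partial sums `x - y n` tend to `x` and also to the combination of the `t i` with the summed
  -- multipliers.
  rw [tendsto_nhds_unique hlim1 hlim2]
  exact sum_mem fun i _ => Ideal.mul_mem_left _ _ (Submodule.subset_span (by simp))

/-- The finite generating set is chosen inside the family itself, so that for a family of symbols
the generators are again symbols of elements of the ideal. -/
theorem exists_finset_of_mem_span {G ι : Type*} [Ring G] [IsNoetherianRing G] (s : ι → G) :
    ∃ T : Finset ι, ∀ i, ∃ b : T → G, s i = ∑ j, b j * s j := by
  classical
  obtain ⟨T', hT', hspan⟩ := (Submodule.fg_span_iff_fg_span_finset_subset (R := G)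
    (Set.range s)).1 (IsNoetherian.noetherian _)
  obtain ⟨T, -, rfl⟩ := Finset.subset_set_image_iff.1 (Set.image_univ (f := s) ▸ hT')
  refine ⟨T, fun i => ?_⟩
  have hmem : s i ∈ Submodule.span G (s '' T) := by
    have := Submodule.subset_span (R := G) (Set.mem_range_self (f := s) i)
    rw [hspan] at this
    simpa using this
  obtain ⟨b, hb⟩ := (Submodule.mem_span_image_finset_iff_exists_fun G).1 hmem
  exact ⟨b, hb.symm⟩

variable [IsUltrametricDist A] [CompleteSpace A] [NormOneClass A]

/-- A complete ring with discrete norm is left noetherian if its graded ring is. -/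
theorem isNoetherianRing_of_gr {ρ : ℝ} (hρ : 0 < ρ) (hρ1 : ρ < 1) (hA : DiscreteNorm A ρ)
    [IsNoetherianRing (Gr A)] : IsNoetherianRing A := by
  refine ⟨fun I => ?_⟩
  -- The left ideal generated by the symbols of all nonzero elements of `I`, each in the degree of
  -- its norm, is already generated by finitely many of these symbols.
  obtain ⟨T, hT⟩ := exists_finset_of_mem_span fun t : {t : A // t ∈ I ∧ t ≠ 0} =>
    symbol t.1 ‖t.1‖ (norm_pos_iff.2 t.2.2) le_rfl
  refine fg_of_approx hρ hρ1 hA I (fun i : T => (i : {t : A // t ∈ I ∧ t ≠ 0}).1)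
    (fun i => i.1.2.1) (fun i => i.1.2.2) fun x hx hx0 => ?_
  obtain ⟨b, hb⟩ := hT ⟨x, hx, hx0⟩
  exact exists_norm_sub_sum_lt Finset.univ b _ _ _ _ _ _ hb

/-- A complete ring with discrete norm is right noetherian if its graded ring is. -/
theorem isNoetherianRing_op_of_gr {ρ : ℝ} (hρ : 0 < ρ) (hρ1 : ρ < 1) (hA : DiscreteNorm A ρ)
    [IsNoetherianRing (Gr A)ᵐᵒᵖ] : IsNoetherianRing Aᵐᵒᵖ := by
  refine ⟨fun I => ?_⟩
  have hn : ∀ t : {t : Aᵐᵒᵖ // t ∈ I ∧ t ≠ 0}, 0 < ‖t.1.unop‖ := fun t =>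
    norm_pos_iff.2 ((MulOpposite.unop_ne_zero_iff t.1).2 t.2.2)
  obtain ⟨T, hT⟩ := exists_finset_of_mem_span fun t : {t : Aᵐᵒᵖ // t ∈ I ∧ t ≠ 0} =>
    MulOpposite.op (symbol t.1.unop ‖t.1.unop‖ (hn t) le_rfl)
  have hA' : DiscreteNorm Aᵐᵒᵖ ρ := fun x hx => hA x.unop ((MulOpposite.unop_ne_zero_iff x).2 hx)
  refine fg_of_approx hρ hρ1 hA' I (fun i : T => (i : {t : Aᵐᵒᵖ // t ∈ I ∧ t ≠ 0}).1)
    (fun i => i.1.2.1) (fun i => i.1.2.2) fun x hx hx0 => ?_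
  obtain ⟨b, hb⟩ := hT ⟨x, hx, hx0⟩
  -- Left combinations in the opposite ring are right combinations in `A`, to which the
  -- approximation lemma for right multiples applies.
  have hb' := congrArg MulOpposite.unop hb
  simp only [Finset.unop_sum, MulOpposite.unop_mul, MulOpposite.unop_op] at hb'
  obtain ⟨a, ha1, ha2⟩ := exists_norm_sub_sum_lt' Finset.univ (fun i => (b i).unop)
    (fun i => i.1.1.unop) _ (fun i => hn i.1) _ _ _ hb'
  refine ⟨fun i => MulOpposite.op (a i), ha1, ?_⟩
  change ‖(x - ∑ i, MulOpposite.op (a i) * _).unop‖ < ‖x.unop‖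
  rw [MulOpposite.unop_sub, Finset.unop_sum]
  exact ha2

end Noetherian

/-! ### Quotient norms -/

section QuotientNorm

variable {A : Type*} [NormedRing A]

theorem quotient_norm_lt_iff {I : Ideal A} {x : A} {r : ℝ} :
    ‖(Submodule.Quotient.mk x : A ⧸ I)‖ < r ↔ ∃ w ∈ I, ‖x - w‖ < r := by
  refine (QuotientAddGroup.norm_lt_iff (S := I.toAddSubgroup)).trans ⟨?_, ?_⟩
  · rintro ⟨m, hm, hr⟩
    refine ⟨x - m, ?_, by simpa using hr⟩
    exact (Submodule.Quotient.eq I).1 (show Submodule.Quotient.mk x = Submodule.Quotient.mk m from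
      hm.symm)
  · rintro ⟨w, hw, hr⟩
    refine ⟨x - w, ?_, hr⟩
    exact (Submodule.Quotient.eq I).2 (by simpa using hw)

theorem quotient_norm_le {I : Ideal A} (x : A) : ‖(Submodule.Quotient.mk x : A ⧸ I)‖ ≤ ‖x‖ :=
  Submodule.Quotient.norm_mk_le I x

/-- The quotient norm is attained if the norm is discrete. -/
theorem exists_norm_eq_quotient_norm {ρ : ℝ} (hρ : 0 < ρ) (hρ1 : ρ < 1) (hA : DiscreteNorm A ρ)
    {I : Ideal A} {x : A} (hx : 0 < ‖(Submodule.Quotient.mk x : A ⧸ I)‖) :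
    ∃ w ∈ I, ‖x - w‖ = ‖(Submodule.Quotient.mk x : A ⧸ I)‖ := by
  set ν := ‖(Submodule.Quotient.mk x : A ⧸ I)‖
  have hle : ∀ w ∈ I, ν ≤ ‖x - w‖ := fun w hw =>
    le_of_not_gt fun h => lt_irrefl _ (quotient_norm_lt_iff.2 ⟨w, hw, h⟩)
  -- Since `ν < ν / ρ`, some representative has norm below `ν / ρ`. If it were not minimal, a
  -- smaller one would have norm at most `ρ` times as large, hence below `ν`, which is impossible.
  obtain ⟨w, hw, hwr⟩ := (quotient_norm_lt_iff (I := I) (x := x) (r := ν / ρ)).1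
    ((lt_div_iff₀ hρ).2 (mul_lt_of_lt_one_right hx hρ1))
  refine ⟨w, hw, (hle w hw).antisymm' (le_of_not_gt fun h => ?_)⟩
  obtain ⟨w', hw', hlt⟩ := quotient_norm_lt_iff.1 h
  have h1 := hA.le_mul hρ hρ1 hlt
  rw [lt_div_iff₀ hρ] at hwr
  linarith [hle w' hw']

variable [IsUltrametricDist A] [NormOneClass A]

/-- The quotient norm modulo a central element whose symbol generates a completely prime ideal is
multiplicative. -/
theorem quotient_norm_mul {ρ : ℝ} (hρ : 0 < ρ) (hρ1 : ρ < 1) (hA : DiscreteNorm A ρ)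
    (hmul : ∀ x y : A, ‖x * y‖ = ‖x‖ * ‖y‖) {z : A} (hz : ‖z‖ = 1) (hzc : ∀ x, z * x = x * z)
    (hp : ∀ a b : Gr A, symbol z 1 one_pos hz.le ∣ a * b →
      symbol z 1 one_pos hz.le ∣ a ∨ symbol z 1 one_pos hz.le ∣ b)
    {I : Ideal A} (hI : ∀ x, x ∈ I ↔ z ∣ x) (hIc : IsClosed (I : Set A)) (x y : A) :
    ‖(Submodule.Quotient.mk (x * y) : A ⧸ I)‖ =
      ‖(Submodule.Quotient.mk x : A ⧸ I)‖ * ‖(Submodule.Quotient.mk y : A ⧸ I)‖ := by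
  have hmk : ∀ x w : A, w ∈ I →
      (Submodule.Quotient.mk (x - w) : A ⧸ I) = Submodule.Quotient.mk x := fun x w hw => by
    rw [Submodule.Quotient.eq]; simpa using hw
  have hzero : ∀ x : A, ‖(Submodule.Quotient.mk x : A ⧸ I)‖ = 0 → x ∈ I := fun x hx =>
    (QuotientAddGroup.norm_mk_eq_zero (S := I.toAddSubgroup) (hS := hIc)).1 hx
  have hzero' : ∀ x ∈ I, ‖(Submodule.Quotient.mk x : A ⧸ I)‖ = 0 := fun x hx => by
    rw [(Submodule.Quotient.mk_eq_zero I).2 hx, norm_zero]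
  -- A class of norm zero is zero because `I` is closed. Then `x` is a multiple of `z`, and so is
  -- the product. In the same case for `y`, centrality of `z` is used.
  rcases (norm_nonneg (Submodule.Quotient.mk x : A ⧸ I)).eq_or_lt' with hx0 | hx0
  · obtain ⟨k, rfl⟩ := (hI x).1 (hzero x hx0)
    rw [hx0, zero_mul]
    exact hzero' _ ((hI _).2 ⟨k * y, by rw [mul_assoc]⟩)
  rcases (norm_nonneg (Submodule.Quotient.mk y : A ⧸ I)).eq_or_lt' with hy0 | hy0
  · obtain ⟨k, rfl⟩ := (hI y).1 (hzero y hy0)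
    rw [hy0, mul_zero]
    exact hzero' _ ((hI _).2 ⟨x * k, by rw [← mul_assoc, ← hzc x, mul_assoc]⟩)
  -- Both factors are replaced by representatives of minimal norm; this changes the product by a
  -- multiple of the central element `z`.
  obtain ⟨w, hw, hxw⟩ := exists_norm_eq_quotient_norm hρ hρ1 hA hx0
  obtain ⟨v, hv, hyv⟩ := exists_norm_eq_quotient_norm hρ hρ1 hA hy0
  have hxy : (Submodule.Quotient.mk (x * y) : A ⧸ I) =
      Submodule.Quotient.mk ((x - w) * (y - v)) := by
    obtain ⟨k, rfl⟩ := (hI w).1 hw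
    obtain ⟨l, rfl⟩ := (hI v).1 hv
    rw [Submodule.Quotient.eq, hI]
    refine ⟨k * y + x * l - k * (z * l), ?_⟩
    have h1 : x * (z * l) = z * (x * l) := by rw [← mul_assoc, ← hzc x, mul_assoc]
    have h2 : (x - z * k) * (y - z * l) =
        x * y - z * (k * y) - x * (z * l) + z * (k * (z * l)) := by noncomm_ring
    rw [h2, h1, mul_sub, mul_add]
    abel
  rw [← hmk x w hw, ← hmk y v hv] at *
  rw [hxy]
  generalize x - w = x at *
  generalize y - v = y at *
  -- The symbol of a minimal representative is not divisible by the symbol of `z`: otherwise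
  -- subtracting a multiple of `z` would decrease the norm.
  have hnd : ∀ (x : A) (h : 0 < ‖x‖), ‖x‖ = ‖(Submodule.Quotient.mk x : A ⧸ I)‖ →
      ¬ symbol z 1 one_pos hz.le ∣ symbol x ‖x‖ h le_rfl := fun x h hx hd => by
    obtain ⟨k, hk⟩ := exists_norm_sub_mul_lt _ _ _ hd
    have := quotient_norm_lt_iff (I := I).2 ⟨z * k, (hI _).2 (dvd_mul_right z k), hk⟩
    exact this.ne hx.symm
  rw [← hxw] at hx0 ⊢
  rw [← hyv] at hy0 ⊢
  refine ((quotient_norm_le _).trans (hmul x y).le).antisymm (le_of_not_gt fun hlt => ?_)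
  obtain ⟨w', hw', hlt⟩ := quotient_norm_lt_iff.1 hlt
  obtain ⟨k, rfl⟩ := (hI w').1 hw'
  -- The bound on `z * k` comes from the ultrametric inequality; multiplicativity of the norm with
  -- `‖z‖ = 1` transfers it to `k`, so that `k` has a symbol in this degree.
  have hk : ‖k‖ ≤ ‖x‖ * ‖y‖ := by
    have h1 : ‖z * k‖ ≤ ‖x‖ * ‖y‖ := by
      have e : z * k = x * y + -(x * y - z * k) := by abel
      rw [e]
      refine (IsUltrametricDist.norm_add_le_max _ _).trans (max_le (hmul x y).le ?_)
      rw [norm_neg]; exact hlt.le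
    rwa [hmul, hz, one_mul] at h1
  -- A drop of the norm of the product class would make the product of the two symbols a multiple of
  -- the symbol of `z`, against complete primality.
  have hd : symbol z 1 one_pos hz.le ∣ symbol x ‖x‖ hx0 le_rfl * symbol y ‖y‖ hy0 le_rfl := by
    refine ⟨symbol k (‖x‖ * ‖y‖) (mul_pos hx0 hy0) hk, ?_⟩
    rw [symbol_mul, symbol_mul, symbol_congr rfl (one_mul (‖x‖ * ‖y‖)), symbol_eq_iff]
    exact hlt
  rcases hp _ _ hd with h | h
  · exact hnd x hx0 hxw h
  · exact hnd y hy0 hyv h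

/-- If `1` were closer than `1` to a multiple `z * k`, the symbols of `z` and `k` in degree `1`
would multiply to `1`. -/
theorem quotient_norm_one (hmul : ∀ x y : A, ‖x * y‖ = ‖x‖ * ‖y‖) {z : A} (hz : ‖z‖ = 1)
    (hz1 : ¬ symbol z 1 one_pos hz.le ∣ 1) {I : Ideal A} (hI : ∀ x, x ∈ I ↔ z ∣ x) :
    ‖(Submodule.Quotient.mk 1 : A ⧸ I)‖ = 1 := by
  refine ((quotient_norm_le _).trans norm_one.le).antisymm (le_of_not_gt fun hlt => hz1 ?_)
  obtain ⟨w, hw, hlt⟩ := quotient_norm_lt_iff.1 hlt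
  obtain ⟨k, rfl⟩ := (hI w).1 hw
  have hk : ‖k‖ ≤ 1 := by
    have h1 : ‖z * k‖ ≤ 1 := by
      have e : z * k = 1 + -(1 - z * k) := by abel
      rw [e]
      refine (IsUltrametricDist.norm_add_le_max _ _).trans (max_le norm_one.le ?_)
      rw [norm_neg]; exact hlt.le
    rwa [hmul, hz, one_mul] at h1
  refine ⟨symbol k 1 one_pos hk, ?_⟩
  rw [symbol_mul, symbol_congr rfl (one_mul (1 : ℝ)), ← symbol_one, symbol_eq_iff]
  exact hlt

end QuotientNorm

/-! ### Poincaré–Birkhoff–Witt bases -/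

namespace QBorel

variable {L : Type u} [Field L] (p : L)

/-- The action of `X` on the space with basis the monomials `X ^ i K ^ j`. -/
def repX : Module.End L (ℕ × ℤ →₀ L) :=
  Finsupp.linearCombination L fun n => Finsupp.single (n.1 + 1, n.2) 1

/-- The action of `K` on the space with basis the monomials `X ^ i K ^ j`. -/
def repK (hp : p ≠ 0) : (Module.End L (ℕ × ℤ →₀ L))ˣ where
  -- The factor `p ^ i` records the rule `K X ^ i = p ^ i X ^ i K`.
  val := Finsupp.linearCombination L fun n => Finsupp.single (n.1, n.2 + 1) (p ^ n.1)
  inv := Finsupp.linearCombination L fun n => Finsupp.single (n.1, n.2 - 1) (p⁻¹ ^ n.1)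
  val_inv := by
    ext n : 2
    simp [hp]
  inv_val := by
    ext n : 2
    simp [hp]

/-- The left regular representation in terms of monomials. -/
def rep (hp : p ≠ 0) : QBorel p →ₐ[L] Module.End L (ℕ × ℤ →₀ L) :=
  lift (C := Module.End L (ℕ × ℤ →₀ L)) (repK p hp) repX (by
    ext n : 2
    simp [repK, repX, pow_succ'])

theorem repK_zpow (hp : p ≠ 0) (j : ℤ) :
    ((repK p hp ^ j : (Module.End L (ℕ × ℤ →₀ L))ˣ) : Module.End L (ℕ × ℤ →₀ L))
      (Finsupp.single (0, 0) 1) = Finsupp.single (0, j) 1 := by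
  induction j with
  | zero => simp
  | succ j ih =>
    rw [add_comm, zpow_one_add, Units.val_mul, Module.End.mul_apply, ih]
    simp [repK, add_comm]
  | pred j ih =>
    rw [sub_eq_add_neg, add_comm, zpow_add, zpow_neg_one, Units.val_mul, Module.End.mul_apply, ih]
    simp [repK, add_comm, sub_eq_add_neg]

theorem repX_pow (i : ℕ) (j : ℤ) :
    ((repX : Module.End L (ℕ × ℤ →₀ L)) ^ i) (Finsupp.single (0, j) 1) =
      Finsupp.single (i, j) 1 := by
  induction i with
  | zero => simp
  | succ i ih => rw [pow_succ', Module.End.mul_apply, ih]; simp [repX]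

/-- Acting on the basis vector at `(0, 0)`, the monomial `X ^ i K ^ j` produces the basis vector at
`(i, j)`; independence is inherited from the images. -/
theorem linearIndependent_monomials (hp : p ≠ 0) : LinearIndependent L fun n : ℕ × ℤ =>
    X p ^ n.1 * ((K p ^ n.2 : (QBorel p)ˣ) : QBorel p) := by
  let f : QBorel p →ₗ[L] (ℕ × ℤ →₀ L) :=
    (LinearMap.applyₗ (Finsupp.single (0, 0) 1)) ∘ₗ (rep p hp).toLinearMap
  refine LinearIndependent.of_comp f ?_
  have hf : (f ∘ fun n : ℕ × ℤ => X p ^ n.1 * ((K p ^ n.2 : (QBorel p)ˣ) : QBorel p)) =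
      fun n => Finsupp.single n 1 := by
    funext n
    have hK : rep p hp ((K p ^ n.2 : (QBorel p)ˣ) : QBorel p) =
        ((repK p hp ^ n.2 : (Module.End L (ℕ × ℤ →₀ L))ˣ) : Module.End L (ℕ × ℤ →₀ L)) := by
      have h : Units.map (rep p hp : QBorel p →* _) (K p) = repK p hp :=
        Units.ext (lift_K _ _ _)
      rw [← h, ← map_zpow]; rfl
    change rep p hp (X p ^ n.1 * ((K p ^ n.2 : (QBorel p)ˣ) : QBorel p))
      (Finsupp.single (0, 0) 1) = _
    rw [map_mul, hK, map_pow, Module.End.mul_apply, repK_zpow]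
    have hX : rep p hp (X p) = repX := lift_X _ _ _
    rw [hX, repX_pow]
  rw [hf]
  exact Finsupp.linearIndependent_single_one L (ℕ × ℤ)

end QBorel

/-! ### Monomial bases and the norm of the double as a maximum over coordinates. -/

section Basis

variable {L : Type u} [NormedField L] [IsUltrametricDist L] (P : Datum L)

theorem linearIndependent_monB : LinearIndependent L (monB P.q) :=
  QBorel.linearIndependent_monomials _ (by simp)

theorem linearIndependent_monA : LinearIndependent L (monA P.q) :=
  QBorel.linearIndependent_monomials _ (by simp)

/-- The monomial basis of `U_q(b₋)`. -/
def basisB : Module.Basis (ℕ × ℤ) L (UqBMinus P.q) :=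
  Module.Basis.mk (linearIndependent_monB P) (by
    intro b _
    obtain ⟨t, c, rfl, -⟩ := exists_LEB b
    exact (Finsupp.mem_span_range_iff_exists_finsupp).2 ⟨c, rfl⟩)

/-- The monomial basis of `U_q(b₊)`. -/
def basisA : Module.Basis (ℕ × ℤ) L (UqBPlus P.q) :=
  Module.Basis.mk (linearIndependent_monA P) (by
    intro b _
    obtain ⟨t, c, rfl, -⟩ := exists_LEA b
    exact (Finsupp.mem_span_range_iff_exists_finsupp).2 ⟨c, rfl⟩)

/-- The monomial basis of the double. -/
def basisD : Module.Basis ((ℕ × ℤ) × (ℕ × ℤ)) L (UqBMinus P.q ⊗[L] UqBPlus P.q) :=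
  (basisB P).tensorProduct (basisA P)

theorem basisD_apply (n : (ℕ × ℤ) × (ℕ × ℤ)) : basisD P n = monD P.q n := by
  rw [basisD, Module.Basis.tensorProduct_apply]
  rw [basisB, basisA, Module.Basis.mk_apply, Module.Basis.mk_apply]; rfl

namespace NormedDouble

/-- The monomial `F ^ i K₋ ^ j ⊗ E ^ k K ^ l` in the normed double. -/
def mon (n : (ℕ × ℤ) × (ℕ × ℤ)) : NormedDouble P := monD P.q n

/-- The coefficient of an element of the double at a monomial. -/
def coord (n : (ℕ × ℤ) × (ℕ × ℤ)) : NormedDouble P →ₗ[L] L := (basisD P).coord n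

variable {P}

theorem coord_mon (m n : (ℕ × ℤ) × (ℕ × ℤ)) : coord P m (mon P n) = if n = m then 1 else 0 := by
  change (basisD P).repr (monD P.q n) m = _
  rw [← basisD_apply, Module.Basis.repr_self, Finsupp.single_apply]

/-- By linear independence, any combination witnessing the bound is the basis expansion. The infimum
defining the Gauss norm is therefore controlled by the coordinates. -/
theorem coord_le_of_LED {r : ℝ≥0} {x : NormedDouble P} (h : LED P r x) (n : (ℕ × ℤ) × (ℕ × ℤ)) :
    ‖coord P n x‖₊ * wtD P.R n ≤ r := by
  obtain ⟨c, hc, hb⟩ := h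
  have hv : monD P.q = basisD P := funext fun n => (basisD_apply P n).symm
  have : coord P n x = c n := by
    change (basisD P).repr x n = c n
    rw [← hc, hv, Module.Basis.repr_linearCombination]
  rw [this]
  exact hb n

theorem norm_coord_mul_le (n : (ℕ × ℤ) × (ℕ × ℤ)) (x : NormedDouble P) :
    ‖coord P n x‖ * wtD P.R n ≤ ‖x‖ := by
  have : ‖coord P n x‖₊ * wtD P.R n ≤ gaussNorm L (monD P.q) (wtD P.R) x :=
    le_of_forall_gt_imp_ge_of_dense fun r hr => coord_le_of_LED (LED.of_lt hr) n
  exact_mod_cast this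

theorem eq_sum_coord (x : NormedDouble P) :
    ∃ s : Finset ((ℕ × ℤ) × (ℕ × ℤ)), (∀ n, n ∉ s → coord P n x = 0) ∧
      x = ∑ n ∈ s, coord P n x • mon P n := by
  refine ⟨((basisD P).repr x).support, fun n hn => Finsupp.notMem_support_iff.1 hn, ?_⟩
  have h := (basisD P).linearCombination_repr x
  rw [Finsupp.linearCombination_apply, Finsupp.sum] at h
  refine h.symm.trans (Finset.sum_congr rfl fun n _ => ?_)
  rw [basisD_apply]; rfl

theorem norm_le_of_coord {r : ℝ≥0} {x : NormedDouble P}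
    (h : ∀ n, ‖coord P n x‖ * wtD P.R n ≤ r) : ‖x‖ ≤ r := by
  have hv : monD P.q = basisD P := funext fun n => (basisD_apply P n).symm
  have h' : LED P r x := ⟨(basisD P).repr x, by
    rw [hv]; exact (basisD P).linearCombination_repr x, fun n => by exact_mod_cast h n⟩
  exact NNReal.coe_le_coe.2 (gaussNorm_le h')

/-- Only finitely many coordinates are nonzero, so their weighted maximum is attained. The norm of
an element thus equals the norm of a single term, whence its discreteness. -/
theorem exists_norm_eq (x : NormedDouble P) (hx : ‖x‖ ≠ 0) :
    ∃ n, coord P n x ≠ 0 ∧ ‖x‖ = ‖coord P n x‖ * wtD P.R n := by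
  obtain ⟨s, hs, hsum⟩ := eq_sum_coord x
  have hne : s.Nonempty := by
    by_contra h
    rw [Finset.not_nonempty_iff_eq_empty] at h
    subst h
    rw [hsum] at hx
    simp at hx
  obtain ⟨n, hn, hmax⟩ := s.exists_max_image (fun n => ‖coord P n x‖₊ * wtD P.R n) hne
  have hle : ‖x‖ ≤ ((‖coord P n x‖₊ * wtD P.R n : ℝ≥0) : ℝ) := norm_le_of_coord fun m => by
    by_cases hm : m ∈ s
    · exact_mod_cast hmax m hm
    · rw [hs m hm, norm_zero, zero_mul]; exact NNReal.coe_nonneg _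
  have heq : ‖x‖ = ‖coord P n x‖ * wtD P.R n :=
    (norm_coord_mul_le n x).antisymm' (by exact_mod_cast hle)
  refine ⟨n, fun h0 => hx ?_, heq⟩
  rw [heq, h0]; simp

end NormedDouble

end Basis

/-! ### Discreteness of the norms of the base field and of the completed double. -/

section Discrete

variable {L : Type u} [NormedField L] [IsUltrametricDist L]

/-- Multiplication by a power of `π` brings `‖c‖` into the interval `(‖π‖, 1]`, and no element of
`L` has norm strictly between `‖π‖` and `1`. -/
theorem IsUniformizer.exists_zpow {π : L} (hπ : IsUniformizer π) {c : L} (hc : c ≠ 0) :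
    ∃ n : ℤ, ‖c‖ = ‖π‖ ^ n := by
  obtain ⟨h0, h1, h2⟩ := hπ
  obtain ⟨n, hn1, hn2⟩ := exists_mem_Ioc_zpow (norm_pos_iff.2 hc) ((one_lt_inv₀ h0).2 h1)
  have hπ0 : π ≠ 0 := norm_pos_iff.1 h0
  refine ⟨-(n + 1), ?_⟩
  rw [inv_zpow'] at hn1 hn2
  have e : ‖c * π ^ (n + 1)‖ = ‖c‖ * ‖π‖ ^ (n + 1) := by rw [norm_mul, norm_zpow]
  have hpos : 0 < ‖π‖ ^ (n + 1) := zpow_pos h0 _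
  have hle : ‖c‖ * ‖π‖ ^ (n + 1) ≤ 1 := by
    have := mul_le_mul_of_nonneg_right hn2 hpos.le
    rwa [zpow_neg, inv_mul_cancel₀ hpos.ne'] at this
  have hgt : ‖π‖ < ‖c‖ * ‖π‖ ^ (n + 1) := by
    have := mul_lt_mul_of_pos_right hn1 hpos
    rw [← zpow_add₀ h0.ne'] at this
    simpa using this
  have heq : ‖c‖ * ‖π‖ ^ (n + 1) = 1 := by
    refine hle.antisymm (le_of_not_gt fun hlt => ?_)
    have := h2 (c * π ^ (n + 1)) (by rwa [e])
    rw [e] at this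
    exact absurd hgt (not_lt.2 this)
  rw [zpow_neg]
  exact eq_inv_of_mul_eq_one_left heq

theorem wtD_eq (P : Datum L) (n : (ℕ × ℤ) × (ℕ × ℤ)) :
    (wtD P.R n : ℝ) = (P.R : ℝ) ^ (n.1.1 + n.2.1) := by
  simp [wtD, wt, pow_add]

theorem Datum.exists_zpow_R (P : Datum L) {π : L} (hπ : IsUniformizer π) :
    ∃ n : ℤ, (P.R : ℝ) = ‖π‖ ^ n := by
  obtain ⟨s, hs⟩ := P.R_mem
  rw [← hs]
  refine hπ.exists_zpow (norm_pos_iff.1 ?_)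
  rw [hs]; exact P.R_pos

theorem CompletedDouble.exists_norm_sub_lt (P : Datum L) (x : CompletedDouble P) {r : ℝ}
    (hr : 0 < r) : ∃ y : NormedDouble P, ‖x - (y : CompletedDouble P)‖ < r := by
  obtain ⟨y, hy⟩ :=
    (UniformSpace.Completion.denseRange_coe (α := NormedDouble P)).exists_dist_lt x hr
  exact ⟨y, by rwa [dist_eq_norm] at hy⟩

/-- An approximation of `x` with error below `‖x‖` has the same norm. For an element of the
algebraic double, the norm is that of one coordinate times a power of `R`, and both factors are
powers of `‖π‖` because `R` is a value of the norm of `L`. -/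
theorem CompletedDouble.discreteNorm (P : Datum L) {π : L} (hπ : IsUniformizer π) :
    DiscreteNorm (CompletedDouble P) ‖π‖ := fun x hx => by
  have hx' := norm_pos_iff.2 hx
  obtain ⟨y, hy⟩ := CompletedDouble.exists_norm_sub_lt P x hx'
  have hxy : ‖y‖ = ‖x‖ := by
    rw [← UniformSpace.Completion.norm_coe]
    have := IsUltrametricDist.norm_eq_of_add_norm_lt_max (x := x) (y := -(y : CompletedDouble P))
      (by rw [← sub_eq_add_neg]; exact hy.trans_le (le_max_left _ _))
    rw [this, norm_neg]
  obtain ⟨n, hn, hn'⟩ := NormedDouble.exists_norm_eq y (by rw [hxy]; exact hx'.ne')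
  obtain ⟨a, ha⟩ := hπ.exists_zpow hn
  obtain ⟨b, hb⟩ := P.exists_zpow_R hπ
  refine ⟨a + b * (n.1.1 + n.2.1 : ℕ), ?_⟩
  rw [← hxy, hn', ha, wtD_eq, hb, zpow_add₀ hπ.1.ne', zpow_mul, zpow_natCast]

end Discrete

/-! ### Relations in the double -/

section Relations

variable {L : Type u} [NormedField L] (q : Lˣ)

/-- The embedding `b ↦ b ⊗ 1`. -/
def inB : UqBMinus q →ₐ[L] Double q :=
  AlgHom.ofLinearMap ((TensorProduct.mk L (UqBMinus q) (UqBPlus q)).flip 1) rfl fun b b' => by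
    change (b * b') ⊗ₜ[L] (1 : UqBPlus q) = doubleMul q (b ⊗ₜ 1) (b' ⊗ₜ 1)
    rw [doubleMul_tmul, map_one, mul_one, leftB_tmul]

/-- The embedding `a ↦ 1 ⊗ a`. -/
def inA : UqBPlus q →ₐ[L] Double q :=
  AlgHom.ofLinearMap (TensorProduct.mk L (UqBMinus q) (UqBPlus q) 1) rfl fun a a' => by
    change (1 : UqBMinus q) ⊗ₜ[L] (a * a') = doubleMul q (1 ⊗ₜ a) (1 ⊗ₜ a')
    rw [doubleMul_tmul, map_one, one_mul, crossAct_one]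

theorem inB_mul_inA (b : UqBMinus q) (a : UqBPlus q) : inB q b * inA q a = b ⊗ₜ[L] a := by
  change doubleMul q (b ⊗ₜ 1) (1 ⊗ₜ a) = _
  rw [doubleMul_tmul, map_one, mul_one, leftB_tmul, mul_one]

theorem inA_mul_inB (a : UqBPlus q) (b : UqBMinus q) :
    inA q a * inB q b = crossAct q a (b ⊗ₜ[L] 1) := by
  change doubleMul q (1 ⊗ₜ a) (b ⊗ₜ 1) = _
  rw [doubleMul_tmul, map_one, one_mul]

open UqBMinus WithConv

theorem lam_K_F : lam q (UqBPlus.K q : UqBPlus q) (F q) = F q := by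
  rw [lam_K, actL_F]; simp [chi]

theorem lam_K_K : lam q (UqBPlus.K q : UqBPlus q) (K q : UqBMinus q) =
    ((q⁻¹ : Lˣ) : L) ^ 2 • (K q : UqBMinus q) := by
  rw [lam_K, actL_K]; simp [chi]

theorem rho_K_F : rho q (UqBPlus.K q : UqBPlus q) (F q) = ((q⁻¹ : Lˣ) : L) ^ 2 • F q := by
  rw [rho_K, actR_F]; simp [chiInv]

theorem rho_K_K : rho q (UqBPlus.K q : UqBPlus q) (K q : UqBMinus q) =
    (q : L) ^ 2 • (K q : UqBMinus q) := by
  rw [rho_K, actR_K]; simp [chiInv]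

theorem lam_E_F : lam q (UqBPlus.E q) (F q) =
    (((q⁻¹ : Lˣ) : L) - (q : L))⁻¹ • (((K q)⁻¹ : (UqBMinus q)ˣ) : UqBMinus q) := by
  rw [lam_E, actL_F]; simp [pairE_F, pairE_one]

theorem lam_E_K : lam q (UqBPlus.E q) (K q : UqBMinus q) = 0 := by
  rw [lam_E, actL_K]; simp [pairE_K]

theorem rho_E_F : rho q (UqBPlus.E q) (F q) = (-(((q⁻¹ : Lˣ) : L) - (q : L))⁻¹) • 1 := by
  have hv : ∀ b : UqBMinus q, (-(toConv (pairE q) * toConv (chiInv q).toLinearMap)) b =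
      -(LinearMap.mul' L L (TensorProduct.map (pairE q) (chiInv q).toLinearMap
        (Coalgebra.comul b))) := fun b => rfl
  rw [rho_E, actR_F, hv, hv, comul_Kinv, comul_F]
  simp [pairE_F, pairE_Kinv]

theorem rho_E_K : rho q (UqBPlus.E q) (K q : UqBMinus q) = 0 := by
  have hv : ∀ b : UqBMinus q, (-(toConv (pairE q) * toConv (chiInv q).toLinearMap)) b =
      -(LinearMap.mul' L L (TensorProduct.map (pairE q) (chiInv q).toLinearMap
        (Coalgebra.comul b))) := fun b => rfl
  rw [rho_E, actR_K, hv, comul_K]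
  simp [pairE_K]

theorem K_mul_F_double : inA q (UqBPlus.K q : UqBPlus q) * inB q (F q) =
    ((q⁻¹ : Lˣ) : L) ^ 2 • (inB q (F q) * inA q (UqBPlus.K q : UqBPlus q)) := by
  rw [inA_mul_inB, crossAct_groupLike q _ (UqBPlus.comul_K q), lam_K_F, rho_K_F, mul_one,
    inB_mul_inA]
  rfl

/-- The two characters by which `K` acts from the left and from the right contribute `q⁻²` and `q²`,
which cancel. -/
theorem K_mul_Km_double : inA q (UqBPlus.K q : UqBPlus q) * inB q (K q : UqBMinus q) =
    inB q (K q : UqBMinus q) * inA q (UqBPlus.K q : UqBPlus q) := by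
  rw [inA_mul_inB, crossAct_groupLike q _ (UqBPlus.comul_K q), lam_K_K, map_smul, rho_K_K, mul_one,
    inB_mul_inA, smul_smul, ← mul_pow, Units.inv_mul, one_pow, one_smul]

theorem E_mul_Km_double : inA q (UqBPlus.E q) * inB q (K q : UqBMinus q) =
    ((q⁻¹ : Lˣ) : L) ^ 2 • (inB q (K q : UqBMinus q) * inA q (UqBPlus.E q)) := by
  rw [inA_mul_inB, crossAct_E, lam_K_K, map_smul, rho_E_K, lam_E_K, smul_zero,
    TensorProduct.zero_tmul, TensorProduct.zero_tmul, zero_add, add_zero, mul_one, inB_mul_inA]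
  rfl

/-- The twofold coproduct of `E` has three terms. On `F` they give `-c` times `K`, then the product
`F E`, and `c` times the inverse of `K₋`, where `c = ⟨E, F⟩`. This is the only rule between
generators that is not an exchange up to a scalar. -/
theorem E_mul_F_double : inA q (UqBPlus.E q) * inB q (F q) =
    inB q (F q) * inA q (UqBPlus.E q) +
      (((q⁻¹ : Lˣ) : L) - (q : L))⁻¹ • (inB q (((K q)⁻¹ : (UqBMinus q)ˣ) : UqBMinus q) -
        inA q (UqBPlus.K q : UqBPlus q)) := by
  rw [inA_mul_inB, crossAct_E, lam_K_F, rho_E_F, lam_E_F, mul_one, mul_one, inB_mul_inA]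
  have h1 : ∀ c : L, ((c • (1 : UqBMinus q)) ⊗ₜ[L] (UqBPlus.K q : UqBPlus q) : Double q) =
      c • inA q (UqBPlus.K q : UqBPlus q) := fun c => rfl
  have h2 : ∀ c : L, ((c • (((K q)⁻¹ : (UqBMinus q)ˣ) : UqBMinus q)) ⊗ₜ[L] (1 : UqBPlus q) :
      Double q) = c • inB q (((K q)⁻¹ : (UqBMinus q)ˣ) : UqBMinus q) := fun c => rfl
  have h3 : ∀ x y z : Double q, x + y + z = y + (z + x) := fun x y z => by abel
  refine (h3 _ _ _).trans ?_
  rw [h1, h2, smul_sub, neg_smul, ← sub_eq_add_neg]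

end Relations

/-! ### Commutation up to scalars of norm one -/

section QuasiCommute

variable {L : Type u} [NormedField L] {B : Type*} [Ring B] [Algebra L B]

/-- `x y = c y x` for a scalar `c` of norm one. -/
def QuasiCommute (L : Type u) [NormedField L] [Algebra L B] (x y : B) : Prop :=
  ∃ c : L, ‖c‖ = 1 ∧ x * y = c • (y * x)

namespace QuasiCommute

variable {x x' y y' : B}

theorem symm (h : QuasiCommute L x y) : QuasiCommute L y x := by
  obtain ⟨c, hc, h⟩ := h
  have hc0 : c ≠ 0 := by rintro rfl; simp at hc
  exact ⟨c⁻¹, by rw [norm_inv, hc, inv_one], by rw [h, smul_smul, inv_mul_cancel₀ hc0, one_smul]⟩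

theorem mul_right (h : QuasiCommute L x y) (h' : QuasiCommute L x y') :
    QuasiCommute L x (y * y') := by
  obtain ⟨c, hc, h⟩ := h
  obtain ⟨c', hc', h'⟩ := h'
  refine ⟨c * c', by rw [norm_mul, hc, hc', one_mul], ?_⟩
  rw [← mul_assoc, h, smul_mul_assoc, mul_assoc, h', mul_smul_comm, smul_smul, mul_assoc]

theorem one_right : QuasiCommute L x 1 := ⟨1, norm_one, by simp⟩

theorem pow_right (h : QuasiCommute L x y) (n : ℕ) : QuasiCommute L x (y ^ n) := by
  induction n with
  | zero => rw [pow_zero]; exact one_right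
  | succ n ih => rw [pow_succ]; exact ih.mul_right h

theorem inv_right {u : Bˣ} (h : QuasiCommute L x u) :
    QuasiCommute L x ((u⁻¹ : Bˣ) : B) := by
  obtain ⟨c, hc, h⟩ := h.symm
  refine ⟨c, hc, ?_⟩
  rw [← Units.inv_mul_cancel_left u (x * ((u⁻¹ : Bˣ) : B)), ← mul_assoc (u : B), h, smul_mul_assoc,
    mul_assoc x, Units.mul_inv, mul_one, mul_smul_comm]

theorem zpow_right {u : Bˣ} (h : QuasiCommute L x u) (n : ℤ) :
    QuasiCommute L x ((u ^ n : Bˣ) : B) := by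
  induction n with
  | zero => rw [zpow_zero, Units.val_one]; exact one_right
  | succ n ih => rw [zpow_add_one, Units.val_mul]; exact ih.mul_right h
  | pred n ih => rw [zpow_sub_one, Units.val_mul]; exact ih.mul_right h.inv_right

end QuasiCommute

end QuasiCommute

/-! ### Generators of the double and reordering of monomials. -/

namespace NormedDouble

variable {L : Type u} [NormedField L] (P : Datum L)

/-- The generator `E` of the double. -/
def E : NormedDouble P := inA P.q (UqBPlus.E P.q)
/-- The generator `F` of the double. -/
def F : NormedDouble P := inB P.q (UqBMinus.F P.q)
/-- The generator `K` of the double, as a unit. -/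
def K : (NormedDouble P)ˣ := Units.map (inA P.q : UqBPlus P.q →* Double P.q) (UqBPlus.K P.q)
/-- The generator `K₋` of the double, as a unit. -/
def Km : (NormedDouble P)ˣ := Units.map (inB P.q : UqBMinus P.q →* Double P.q) (UqBMinus.K P.q)

theorem K_mul_E : (K P : NormedDouble P) * E P = (P.q : L) ^ 2 • (E P * K P) := by
  have := congrArg (inA P.q) (UqBPlus.K_mul_E P.q)
  rwa [map_mul, map_smul, map_mul] at this

theorem Km_mul_F : (Km P : NormedDouble P) * F P = ((P.q⁻¹ : Lˣ) : L) ^ 2 • (F P * Km P) := by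
  have := congrArg (inB P.q) (UqBMinus.K_mul_F P.q)
  rwa [map_mul, map_smul, map_mul] at this

theorem K_mul_F : (K P : NormedDouble P) * F P = ((P.q⁻¹ : Lˣ) : L) ^ 2 • (F P * K P) :=
  K_mul_F_double P.q

theorem K_mul_Km : (K P : NormedDouble P) * Km P = Km P * K P := K_mul_Km_double P.q

theorem E_mul_Km : E P * (Km P : NormedDouble P) = ((P.q⁻¹ : Lˣ) : L) ^ 2 • (Km P * E P) :=
  E_mul_Km_double P.q

theorem E_mul_F : E P * F P = F P * E P +
    P.c • (((Km P)⁻¹ : (NormedDouble P)ˣ) - (K P : NormedDouble P)) :=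
  E_mul_F_double P.q

theorem mon_eq (n : (ℕ × ℤ) × (ℕ × ℤ)) : mon P n = F P ^ n.1.1 *
    ((Km P ^ n.1.2 : (NormedDouble P)ˣ) : NormedDouble P) * (E P ^ n.2.1 *
    ((K P ^ n.2.2 : (NormedDouble P)ˣ) : NormedDouble P)) := by
  have h : mon P n = inB P.q (monB P.q n.1) * inA P.q (monA P.q n.2) := (inB_mul_inA _ _ _).symm
  have hK : ((K P ^ n.2.2 : (NormedDouble P)ˣ) : NormedDouble P) =
      inA P.q ((UqBPlus.K P.q ^ n.2.2 : (UqBPlus P.q)ˣ) : UqBPlus P.q) :=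
    (congrArg Units.val (map_zpow (Units.map (inA P.q : UqBPlus P.q →* Double P.q))
      (UqBPlus.K P.q) n.2.2)).symm
  have hKm : ((Km P ^ n.1.2 : (NormedDouble P)ˣ) : NormedDouble P) =
      inB P.q ((UqBMinus.K P.q ^ n.1.2 : (UqBMinus P.q)ˣ) : UqBMinus P.q) :=
    (congrArg Units.val (map_zpow (Units.map (inB P.q : UqBMinus P.q →* Double P.q))
      (UqBMinus.K P.q) n.1.2)).symm
  have hprod : inB P.q (monB P.q n.1) * inA P.q (monA P.q n.2) = inB P.q (UqBMinus.F P.q) ^ n.1.1 *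
      inB P.q ((UqBMinus.K P.q ^ n.1.2 : (UqBMinus P.q)ˣ) : UqBMinus P.q) *
      (inA P.q (UqBPlus.E P.q) ^ n.2.1 *
        inA P.q ((UqBPlus.K P.q ^ n.2.2 : (UqBPlus P.q)ˣ) : UqBPlus P.q)) := by
    rw [monB, monA, map_mul, map_mul, map_pow, map_pow]
  rw [hK, hKm]
  exact h.trans hprod

/-- The monomial `K ^ l K₋ ^ j F ^ i E ^ k`. -/
def mon' (n : (ℕ × ℤ) × (ℕ × ℤ)) : NormedDouble P :=
  ((K P ^ n.2.2 : (NormedDouble P)ˣ) : NormedDouble P) *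
    ((Km P ^ n.1.2 : (NormedDouble P)ˣ) : NormedDouble P) * F P ^ n.1.1 * E P ^ n.2.1

/-- In both normal forms `F` stands to the left of `E`, so the relation between `E` and `F` never
enters, and the reordering costs only a scalar of norm one. -/
theorem exists_mon'_eq (n : (ℕ × ℤ) × (ℕ × ℤ)) :
    ∃ u : L, ‖u‖ = 1 ∧ mon' P n = u • mon P n := by
  have hq : ‖((P.q⁻¹ : Lˣ) : L) ^ 2‖ = 1 := by
    rw [norm_pow, Units.val_inv_eq_inv_val, norm_inv, P.norm_q]; simp
  have h1 : QuasiCommute L (F P) (Km P : NormedDouble P) :=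
    QuasiCommute.symm ⟨_, hq, Km_mul_F P⟩
  obtain ⟨c, hc, h1⟩ := ((h1.zpow_right n.1.2).symm.pow_right n.1.1)
  have h2 : QuasiCommute L (F P) (K P : NormedDouble P) := QuasiCommute.symm ⟨_, hq, K_mul_F P⟩
  have h3 : QuasiCommute L (E P) (K P : NormedDouble P) :=
    QuasiCommute.symm ⟨_, by rw [norm_pow, P.norm_q, one_pow], K_mul_E P⟩
  have h4 : QuasiCommute L (Km P : NormedDouble P) (K P : NormedDouble P) :=
    ⟨1, norm_one, by rw [one_smul, K_mul_Km]⟩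
  -- The power of `K` is moved from the far left past all the other factors; the exchange of `K₋`
  -- with `F` was settled by `h1`.
  obtain ⟨d, hd, h5⟩ := ((h2.zpow_right n.2.2).symm.pow_right n.1.1).mul_right
    (((h4.zpow_right n.2.2).symm.zpow_right n.1.2).mul_right
      ((h3.zpow_right n.2.2).symm.pow_right n.2.1))
  refine ⟨c * d, by rw [norm_mul, hc, hd, one_mul], ?_⟩
  rw [mon', mul_assoc (_ * _), mul_assoc,
    ← mul_assoc ((Km P ^ n.1.2 : (NormedDouble P)ˣ) : NormedDouble P),
    h1, smul_mul_assoc, mul_smul_comm, mul_assoc (F P ^ n.1.1), h5, smul_smul, mon_eq]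
  simp only [mul_assoc]

end NormedDouble

/-! ### Homomorphisms from Laurent and skew polynomial rings -/

section LaurentLift

open LaurentPolynomial

variable {R B : Type*} [Semiring R] [Ring B]

/-- If `x` intertwines two homomorphisms on coefficients and on `T`, then it does so everywhere. -/
theorem laurent_intertwine (f g : LaurentPolynomial R →+* B) (x : B)
    (hC : ∀ a, x * f (C a) = g (C a) * x) (hT : x * f (T 1) = g (T 1) * x)
    (p : LaurentPolynomial R) : x * f p = g p * x := by
  have hmul : ∀ p q, x * f p = g p * x → x * f q = g q * x → x * f (p * q) = g (p * q) * x :=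
    fun p q hp hq => by rw [map_mul, map_mul, ← mul_assoc, hp, mul_assoc, hq, mul_assoc]
  have h1 : ∀ h : LaurentPolynomial R →+* B, h (T (-1)) * h (T 1) = 1 := fun h => by
    rw [← map_mul, ← T_add]; simp
  have h2 : ∀ h : LaurentPolynomial R →+* B, h (T 1) * h (T (-1)) = 1 := fun h => by
    rw [← map_mul, ← T_add]; simp
  -- The element `x` need not be invertible; the rule for `T⁻¹` is obtained by inserting `g (T⁻¹) *
  -- g T` on the left and cancelling `f T * f (T⁻¹)` on the right.
  have hTinv : x * f (T (-1)) = g (T (-1)) * x := by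
    calc x * f (T (-1)) = g (T (-1)) * (g (T 1) * x) * f (T (-1)) := by
          rw [← mul_assoc, h1, one_mul]
      _ = g (T (-1)) * x := by rw [← hT, mul_assoc, mul_assoc, h2, mul_one]
  induction p using LaurentPolynomial.induction_on with
  | h_C a => exact hC a
  | h_add hp hq => rw [map_add, map_add, mul_add, add_mul, hp, hq]
  | h_C_mul_T n a h => rw [T_add, ← mul_assoc]; exact hmul _ _ h hT
  | h_C_mul_T_Z n a h => rw [T_sub, ← mul_assoc]; exact hmul _ _ h hTinv

/-- Extension of a ring homomorphism to Laurent polynomials, sending `T` to a unit commuting with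
the image. -/
def laurentLift (f : R →+* B) (u : Bˣ) (h : ∀ a, Commute (f a) u) : LaurentPolynomial R →+* B :=
  AddMonoidAlgebra.liftNCRingHom f ((Units.coeHom B).comp (zpowersHom Bˣ u)) fun a n =>
    (h a).units_zpow_right n.toAdd

variable (f : R →+* B) (u : Bˣ) (h : ∀ a, Commute (f a) u)

theorem laurentLift_single (n : ℤ) (a : R) :
    laurentLift f u h (AddMonoidAlgebra.single n a) = f a * ((u ^ n : Bˣ) : B) :=
  AddMonoidAlgebra.liftNCRingHom_single _ _ _ _ _

theorem laurentLift_C (a : R) : laurentLift f u h (C a) = f a := by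
  refine (laurentLift_single f u h 0 a).trans ?_
  rw [zpow_zero, Units.val_one, mul_one]

theorem laurentLift_T : laurentLift f u h (T 1) = u := by
  refine (laurentLift_single f u h 1 1).trans ?_
  rw [zpow_one, map_one, one_mul]

theorem laurentLift_commute {x : B} (hf : ∀ a, Commute (f a) x) (hu : Commute (u : B) x)
    (p : LaurentPolynomial R) : Commute (laurentLift f u h p) x :=
  Commute.symm (laurent_intertwine _ _ x
    (fun a => by rw [laurentLift_C]; exact (hf a).symm.eq)
    (by rw [laurentLift_T]; exact hu.symm.eq) p)

end LaurentLift

/-! ### Coefficients of the torus and homomorphisms out of it. -/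

namespace Torus

open LaurentPolynomial

variable {L : Type u} [NormedField L] [IsUltrametricDist L]

/-- The element `a π ^ m K ^ l K₋ ^ j`. -/
def monomial (j l m : ℤ) (a : Residue L) : Torus L :=
  (AddMonoidAlgebra.single j (AddMonoidAlgebra.single l (AddMonoidAlgebra.single m a)) :
    LaurentPolynomial (LaurentPolynomial (LaurentPolynomial (Residue L))))

/-- The coefficient of `π ^ m K ^ l K₋ ^ j`. -/
def coeff (j l m : ℤ) : Torus L →+ Residue L where
  toFun p := AddMonoidAlgebra.coeff (AddMonoidAlgebra.coeff (AddMonoidAlgebra.coeff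
    (R := LaurentPolynomial (LaurentPolynomial (Residue L))) p j) l) m
  map_zero' := rfl
  map_add' _ _ := rfl

theorem coeff_monomial (j l m j' l' m' : ℤ) (a : Residue L) :
    coeff j l m (monomial j' l' m' a) = if j' = j ∧ l' = l ∧ m' = m then a else 0 := by
  classical
  change (((AddMonoidAlgebra.single j' (AddMonoidAlgebra.single l'
    (AddMonoidAlgebra.single m' a))).coeff j).coeff l).coeff m = _
  rw [AddMonoidAlgebra.coeff_single, Finsupp.single_apply]
  by_cases hj : j' = j
  · rw [if_pos hj, AddMonoidAlgebra.coeff_single, Finsupp.single_apply]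
    by_cases hl : l' = l
    · rw [if_pos hl, AddMonoidAlgebra.coeff_single, Finsupp.single_apply]
      simp [hj, hl]
    · simp [hl]
  · simp [hj]

theorem ext {p p' : Torus L} (h : ∀ j l m, coeff j l m p = coeff j l m p') : p = p' :=
  AddMonoidAlgebra.ext (Finsupp.ext fun j => AddMonoidAlgebra.ext (Finsupp.ext fun l =>
    AddMonoidAlgebra.ext (Finsupp.ext fun m => h j l m)))

theorem induction {motive : Torus L → Prop} (p : Torus L)
    (add : ∀ p p', motive p → motive p' → motive (p + p'))
    (monomial : ∀ j l m a, motive (monomial j l m a)) : motive p := by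
  have zero : motive 0 := by
    have h := monomial 0 0 0 0
    have h0 : Torus.monomial 0 0 0 (0 : Residue L) = 0 := by
      rw [Torus.monomial]
      simp only [AddMonoidAlgebra.single_zero]; rfl
    rwa [h0] at h
  refine AddMonoidAlgebra.induction_linear (motive := motive) p zero add fun j p => ?_
  refine AddMonoidAlgebra.induction_linear
    (motive := fun p : LaurentPolynomial (LaurentPolynomial (Residue L)) =>
      motive (AddMonoidAlgebra.single j p :)) p ?_ (fun p p' hp hp' => ?_)
    fun l p => ?_
  · rw [AddMonoidAlgebra.single_zero]; exact zero
  · rw [AddMonoidAlgebra.single_add]; exact add _ _ hp hp'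
  refine AddMonoidAlgebra.induction_linear
    (motive := fun p : LaurentPolynomial (Residue L) =>
      motive (AddMonoidAlgebra.single j (AddMonoidAlgebra.single l p) :)) p ?_
    (fun p p' hp hp' => ?_) fun m a => monomial j l m a
  · rw [AddMonoidAlgebra.single_zero, AddMonoidAlgebra.single_zero]; exact zero
  · rw [AddMonoidAlgebra.single_add, AddMonoidAlgebra.single_add]; exact add _ _ hp hp'

variable {B : Type*} [Ring B]

theorem intertwine (f g : Torus L →+* B) (x : B)
    (hc : ∀ a, x * f (const a) = g (const a) * x)
    (hK : x * f K = g K * x) (hKm : x * f Km = g Km * x) (p : Torus L) :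
    x * f p = g p * x := by
  let C' : LaurentPolynomial (LaurentPolynomial (Residue L)) →+* Torus L := LaurentPolynomial.C
  exact laurent_intertwine (R := LaurentPolynomial (LaurentPolynomial (Residue L))) f g x
    (fun a => laurent_intertwine (f.comp C') (g.comp C') x hc hK a) hKm p

theorem ringHom_ext {f g : Torus L →+* B} (hc : ∀ a, f (const a) = g (const a))
    (hK : f K = g K) (hKm : f Km = g Km) : f = g :=
  RingHom.ext fun p => by
    -- Intertwining by `x = 1` is equality of the two homomorphisms.
    simpa using intertwine f g 1 (by simpa using hc) (by simpa using hK) (by simpa using hKm) p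

/-- Needed to extend the automorphism attached to `E` from the torus to the skew polynomials in `F`,
where it must commute with the automorphism attached to `F`. -/
theorem scaleAut_comm (u v : (Residue L)ˣ) (a : Torus L) :
    scaleAut u (scaleAut v a) = scaleAut v (scaleAut u a) := by
  have : ((scaleAut u : Torus L →+* Torus L).comp (scaleAut v : Torus L →+* Torus L)) =
      ((scaleAut v : Torus L →+* Torus L).comp (scaleAut u : Torus L →+* Torus L)) := by
    have hs : ∀ (u : (Residue L)ˣ) (c : Residue L), scaleAut u (scalar c) = scalar c :=
      fun u c => scaleAut_const u _
    refine ringHom_ext (fun a => ?_) ?_ ?_ <;>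
      simp only [RingHom.comp_apply, RingHom.coe_coe, scaleAut_const, scaleAut_K, scaleAut_Km,
        map_mul, hs]
    · rw [mul_left_comm]
    · rw [mul_left_comm]
  exact congrArg (fun f : Torus L →+* Torus L => f a) this

/-- The homomorphism from the torus defined by a homomorphism on the residue field and commuting
units. -/
def lift (f : Residue L →+* B) (p k k' : Bˣ) (hp : ∀ a, Commute (f a) p)
    (hk : ∀ a, Commute (f a) k) (hk' : ∀ a, Commute (f a) k') (hpk : Commute (p : B) k)
    (hpk' : Commute (p : B) k') (hkk' : Commute (k : B) k') : Torus L →+* B :=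
  laurentLift (laurentLift (laurentLift f p hp) k (laurentLift_commute f p hp hk hpk)) k'
    (laurentLift_commute _ k _ (laurentLift_commute f p hp hk' hpk') hkk')

section

variable (f : Residue L →+* B) (p k k' : Bˣ) (hp : ∀ a, Commute (f a) p)
    (hk : ∀ a, Commute (f a) k) (hk' : ∀ a, Commute (f a) k') (hpk : Commute (p : B) k)
    (hpk' : Commute (p : B) k') (hkk' : Commute (k : B) k')

theorem lift_monomial (j l m : ℤ) (a : Residue L) :
    lift f p k k' hp hk hk' hpk hpk' hkk' (monomial j l m a) =
      f a * ((p ^ m : Bˣ) : B) * ((k ^ l : Bˣ) : B) * ((k' ^ j : Bˣ) : B) := by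
  refine (laurentLift_single _ _ _ _ _).trans ?_
  rw [laurentLift_single, laurentLift_single]

theorem lift_const (a : LaurentPolynomial (Residue L)) :
    lift f p k k' hp hk hk' hpk hpk' hkk' (const a) = laurentLift f p hp a := by
  refine (laurentLift_C _ _ _ _).trans ?_
  rw [laurentLift_C]

theorem lift_scalar (a : Residue L) :
    lift f p k k' hp hk hk' hpk hpk' hkk' (scalar a) = f a := by
  rw [scalar, lift_const, laurentLift_C]

theorem lift_K : lift f p k k' hp hk hk' hpk hpk' hkk' K = k := by
  refine (laurentLift_C _ _ _ _).trans ?_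
  rw [laurentLift_T]

theorem lift_Km : lift f p k k' hp hk hk' hpk hpk' hkk' Km = k' := laurentLift_T _ _ _

end

end Torus

theorem SkewPoly.intertwine {S B : Type*} [Ring S] [Ring B] {β : S ≃+* S}
    (f g : SkewPoly β →+* B) (x : B) (hC : ∀ a, x * f (C β a) = g (C β a) * x)
    (hX : x * f (X β) = g (X β) * x) (p : SkewPoly β) : x * f p = g p * x := by
  have hmul : ∀ p q, x * f p = g p * x → x * f q = g q * x → x * f (p * q) = g (p * q) * x :=
    fun p q hp hq => by rw [map_mul, map_mul, ← mul_assoc, hp, mul_assoc, hq, mul_assoc]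
  induction p using SkewPoly.induction with
  | add p q hp hq => rw [map_add, map_add, mul_add, add_mul, hp, hq]
  | monomial n a =>
    rw [monomial_eq]
    refine hmul _ _ (hC a) ?_
    induction n with
    | zero => simp
    | succ n ih => rw [pow_succ]; exact hmul _ _ ih hX

/-! ### Elements of the graded ring represented by given elements -/

section IsSymbol

theorem norm_sub_le_max {A : Type*} [SeminormedAddCommGroup A] [IsUltrametricDist A] (a b : A) :
    ‖a - b‖ ≤ max ‖a‖ ‖b‖ := by
  simpa [sub_eq_add_neg] using IsUltrametricDist.norm_add_le_max a (-b)

variable {A : Type*} [NormedRing A] [IsUltrametricDist A] [NormOneClass A]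

/-- `x` is the class of `a` in degree `r`. -/
def IsSymbol (x : Gr A) (a : A) (r : ℝ) : Prop := ∃ hr ha, x = symbol a r hr ha

theorem isSymbol_symbol (a : A) (r : ℝ) (hr : 0 < r) (ha : ‖a‖ ≤ r) :
    IsSymbol (symbol a r hr ha) a r := ⟨hr, ha, rfl⟩

namespace IsSymbol

variable {x y : Gr A} {a b : A} {r s : ℝ}

theorem one : IsSymbol (1 : Gr A) 1 1 := ⟨one_pos, norm_one.le, symbol_one.symm⟩

theorem mul (hx : IsSymbol x a r) (hy : IsSymbol y b s) : IsSymbol (x * y) (a * b) (r * s) := by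
  obtain ⟨hr, ha, rfl⟩ := hx
  obtain ⟨hs, hb, rfl⟩ := hy
  exact ⟨_, _, symbol_mul _ _ _ _⟩

theorem add (hx : IsSymbol x a r) (hy : IsSymbol y b r) : IsSymbol (x + y) (a + b) r := by
  obtain ⟨hr, ha, rfl⟩ := hx
  obtain ⟨hs, hb, rfl⟩ := hy
  exact ⟨_, _, symbol_add _ _ _⟩

theorem sub (hx : IsSymbol x a r) (hy : IsSymbol y b r) : IsSymbol (x - y) (a - b) r := by
  obtain ⟨hr, ha, rfl⟩ := hx
  obtain ⟨hs, hb, rfl⟩ := hy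
  have h : ‖a - b‖ ≤ r := (norm_sub_le_max a b).trans (max_le ha hb)
  refine ⟨hr, h, sub_eq_of_eq_add ?_⟩
  rw [symbol_add]
  exact symbol_congr (sub_add_cancel a b).symm rfl _ _

theorem pow (hx : IsSymbol x a r) (n : ℕ) : IsSymbol (x ^ n) (a ^ n) (r ^ n) := by
  obtain ⟨hr, ha, rfl⟩ := hx
  exact ⟨_, _, symbol_pow _ _ _⟩

theorem zpow {x : (Gr A)ˣ} {a : Aˣ} (hx : IsSymbol (x : Gr A) a r)
    (hx' : IsSymbol ((x⁻¹ : (Gr A)ˣ) : Gr A) ((a⁻¹ : Aˣ) : A) r⁻¹) (n : ℤ) :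
    IsSymbol ((x ^ n : (Gr A)ˣ) : Gr A) ((a ^ n : Aˣ) : A) (r ^ n) := by
  cases n with
  | ofNat n => simpa using hx.pow n
  | negSucc n => simpa using hx'.pow (n + 1)

theorem congr (hx : IsSymbol x a r) (hab : a = b) (hrs : r = s) : IsSymbol x b s :=
  hab ▸ hrs ▸ hx

theorem eq_of_norm_sub_lt (hx : IsSymbol x a r) (hy : IsSymbol y b r) (h : ‖a - b‖ < r) :
    x = y := by
  obtain ⟨hr, ha, rfl⟩ := hx
  obtain ⟨hs, hb, rfl⟩ := hy
  exact (symbol_eq_iff _ _ _).2 h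

theorem unique (hx : IsSymbol x a r) (hy : IsSymbol y b s) (hab : a = b) (hrs : r = s) :
    x = y := by
  obtain ⟨hr, ha, rfl⟩ := hx
  obtain ⟨hs, hb, rfl⟩ := hy
  exact symbol_congr hab hrs _ _

end IsSymbol

/-- The class of a unit of `A` whose inverse has the reciprocal norm bound. -/
def symbolUnit (a : Aˣ) (r : ℝ) (hr : 0 < r) (ha : ‖(a : A)‖ ≤ r)
    (ha' : ‖((a⁻¹ : Aˣ) : A)‖ ≤ r⁻¹) : (Gr A)ˣ where
  val := symbol (a : A) r hr ha
  inv := symbol ((a⁻¹ : Aˣ) : A) r⁻¹ (inv_pos.2 hr) ha'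
  val_inv := ((isSymbol_symbol _ _ _ _).mul (isSymbol_symbol _ _ _ _)).unique IsSymbol.one
    (Units.mul_inv a) (mul_inv_cancel₀ hr.ne')
  inv_val := ((isSymbol_symbol _ _ _ _).mul (isSymbol_symbol _ _ _ _)).unique IsSymbol.one
    (Units.inv_mul a) (inv_mul_cancel₀ hr.ne')

theorem symbolUnit_zpow (a : Aˣ) (r : ℝ) (hr : 0 < r) (ha : ‖(a : A)‖ ≤ r)
    (ha' : ‖((a⁻¹ : Aˣ) : A)‖ ≤ r⁻¹) (n : ℤ) :
    IsSymbol ((symbolUnit a r hr ha ha' ^ n : (Gr A)ˣ) : Gr A) ((a ^ n : Aˣ) : A) (r ^ n) :=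
  IsSymbol.zpow (isSymbol_symbol _ _ _ _) (isSymbol_symbol _ _ _ _) n

end IsSymbol

/-! ### The residue field -/

section ResidueField

variable {L : Type u} [NormedField L] [IsUltrametricDist L]

theorem res_eq_zero_iff {c : L} (hc : ‖c‖ ≤ 1) : res c hc = 0 ↔ ‖c‖ < 1 := by
  rw [res, IsLocalRing.residue_eq_zero_iff, Valuation.mem_maximalIdeal_iff]
  rfl

theorem res_add {c d : L} (hc : ‖c‖ ≤ 1) (hd : ‖d‖ ≤ 1) : res c hc + res d hd =
    res (c + d) ((IsUltrametricDist.norm_add_le_max c d).trans (max_le hc hd)) :=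
  (map_add (IsLocalRing.residue (NormedField.valuation (K := L)).valuationSubring) _ _).symm

theorem res_mul {c d : L} (hc : ‖c‖ ≤ 1) (hd : ‖d‖ ≤ 1) : res c hc * res d hd =
    res (c * d) (by rw [norm_mul]; exact mul_le_one₀ hc (norm_nonneg d) hd) :=
  (map_mul (IsLocalRing.residue (NormedField.valuation (K := L)).valuationSubring) _ _).symm

theorem res_one : res (1 : L) norm_one.le = 1 :=
  map_one (IsLocalRing.residue (NormedField.valuation (K := L)).valuationSubring)

theorem res_congr {c d : L} (h : c = d) (hc : ‖c‖ ≤ 1) : res c hc = res d (h ▸ hc) := by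
  subst h; rfl

theorem res_eq_iff {c d : L} (hc : ‖c‖ ≤ 1) (hd : ‖d‖ ≤ 1) :
    res c hc = res d hd ↔ ‖c - d‖ < 1 := by
  have h : ‖c - d‖ ≤ 1 := (norm_sub_le_max c d).trans (max_le hc hd)
  rw [← res_eq_zero_iff h, ← sub_eq_zero]
  exact Eq.congr_left
    (map_sub (IsLocalRing.residue (NormedField.valuation (K := L)).valuationSubring) _ _).symm

theorem exists_res_eq (a : Residue L) : ∃ c hc, a = res (c : L) hc := by
  obtain ⟨c, rfl⟩ := IsLocalRing.residue_surjective a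
  exact ⟨c.1, c.2, rfl⟩

variable {A : Type*} [NormedRing A] [IsUltrametricDist A] [NormOneClass A] [NormedAlgebra L A]

/-- The action of the residue field on the graded ring. -/
def resHom (A : Type*) [NormedRing A] [IsUltrametricDist A] [NormOneClass A] [NormedAlgebra L A] :
    Residue L →+* Gr A :=
  Ideal.Quotient.lift (IsLocalRing.maximalIdeal (NormedField.valuation (K := L)).valuationSubring)
    { toFun := fun c => symbol ((c : L) • (1 : A)) 1 one_pos
        (by rw [norm_smul, norm_one, mul_one]; exact c.2)
      map_one' := (isSymbol_symbol _ _ _ _).unique IsSymbol.one (one_smul L 1) rfl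
      map_mul' := fun c d => (isSymbol_symbol _ _ _ _).unique
        ((isSymbol_symbol _ _ _ _).mul (isSymbol_symbol _ _ _ _))
        (by rw [smul_mul_smul_comm, one_mul]; rfl) (one_mul 1).symm
      map_zero' := (symbol_eq_zero_iff _ _).2 (by
        change ‖(0 : L) • (1 : A)‖ < 1
        rw [zero_smul, norm_zero]; exact one_pos)
      map_add' := fun c d => (isSymbol_symbol _ _ _ _).unique
        ((isSymbol_symbol _ _ _ _).add (isSymbol_symbol _ _ _ _)) (add_smul _ _ _) rfl }
    fun c hc => (symbol_eq_zero_iff _ _).2 (by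
      rw [norm_smul, norm_one, mul_one]
      exact (Valuation.mem_maximalIdeal_iff L _).1 hc)

theorem resHom_res {c : L} (hc : ‖c‖ ≤ 1) : IsSymbol (resHom A (res c hc)) (c • (1 : A)) 1 :=
  ⟨one_pos, by rw [norm_smul, norm_one, mul_one]; exact hc, rfl⟩

/-- Scalars of `L` are central in `A` and degrees multiply commutatively, so it suffices to compare
with a single symbol. -/
theorem resHom_commute (a : Residue L) (x : Gr A) : Commute (resHom A a) x := by
  obtain ⟨c, hc, rfl⟩ := exists_res_eq a
  induction x using Gr.induction with
  | add x y hx hy => exact hx.add_right hy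
  | symbol a r hr ha =>
    exact ((resHom_res hc).mul (isSymbol_symbol a r hr ha)).unique
      ((isSymbol_symbol a r hr ha).mul (resHom_res hc)) (by simp) (mul_comm _ _)

theorem symbol_smul_one_commute {c : L} {r : ℝ} (hr : 0 < r) (hc : ‖c • (1 : A)‖ ≤ r) (x : Gr A) :
    Commute (symbol (c • (1 : A)) r hr hc) x := by
  induction x using Gr.induction with
  | add x y hx hy => exact hx.add_right hy
  | symbol a s hs ha =>
    exact ((isSymbol_symbol _ _ _ _).mul (isSymbol_symbol a s hs ha)).unique
      ((isSymbol_symbol a s hs ha).mul (isSymbol_symbol _ _ _ _)) (by simp) (mul_comm _ _)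

end ResidueField

/-! ### The graded ring of the completed double -/

namespace CompletedDouble

variable {L : Type u} [NormedField L] [IsUltrametricDist L] (P : Datum L)

instance : NormedAlgebra L (CompletedDouble P) where
  norm_smul_le := norm_smul_le

/-- The embedding of the double in its completion. -/
def coeHom : NormedDouble P →+* CompletedDouble P := UniformSpace.Completion.coeRingHom

theorem coeHom_smul (c : L) (x : NormedDouble P) : coeHom P (c • x) = c • coeHom P x :=
  UniformSpace.Completion.coe_smul c x

theorem norm_coeHom (x : NormedDouble P) : ‖coeHom P x‖ = ‖x‖ := UniformSpace.Completion.norm_coe x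

/-- The unit `K`. -/
def unitK : (CompletedDouble P)ˣ := Units.map (coeHom P).toMonoidHom (NormedDouble.K P)

/-- The unit `K₋`. -/
def unitKm : (CompletedDouble P)ˣ := Units.map (coeHom P).toMonoidHom (NormedDouble.Km P)

theorem val_unitK : (unitK P : CompletedDouble P) = K P := rfl
theorem val_unitKm : (unitKm P : CompletedDouble P) = Km P := rfl

theorem unitK_mul_E : unitK P * E P = (P.q : L) ^ 2 • (E P * unitK P) := by
  have := congrArg (coeHom P) (NormedDouble.K_mul_E P)
  rwa [map_mul, coeHom_smul, map_mul] at this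

theorem unitKm_mul_F : unitKm P * F P = ((P.q⁻¹ : Lˣ) : L) ^ 2 • (F P * unitKm P) := by
  have := congrArg (coeHom P) (NormedDouble.Km_mul_F P)
  rwa [map_mul, coeHom_smul, map_mul] at this

theorem unitK_mul_F : unitK P * F P = ((P.q⁻¹ : Lˣ) : L) ^ 2 • (F P * unitK P) := by
  have := congrArg (coeHom P) (NormedDouble.K_mul_F P)
  rwa [map_mul, coeHom_smul, map_mul] at this

theorem unitK_mul_unitKm : (unitK P : CompletedDouble P) * unitKm P = unitKm P * unitK P := by
  have := congrArg (coeHom P) (NormedDouble.K_mul_Km P)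
  rwa [map_mul, map_mul] at this

theorem E_mul_unitKm : E P * unitKm P = ((P.q⁻¹ : Lˣ) : L) ^ 2 • (unitKm P * E P) := by
  have := congrArg (coeHom P) (NormedDouble.E_mul_Km P)
  rwa [map_mul, coeHom_smul, map_mul] at this

theorem E_mul_F : E P * F P = F P * E P +
    P.c • (((unitKm P)⁻¹ : (CompletedDouble P)ˣ) - (unitK P : CompletedDouble P)) := by
  have := congrArg (coeHom P) (NormedDouble.E_mul_F P)
  rwa [map_mul, map_add, map_mul, coeHom_smul, map_sub] at this

theorem E_mul_unitK : E P * unitK P = ((P.q⁻¹ : Lˣ) : L) ^ 2 • (unitK P * E P) := by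
  rw [unitK_mul_E, smul_smul, ← mul_pow, Units.inv_mul, one_pow, one_smul]

theorem F_mul_unitK : F P * unitK P = (P.q : L) ^ 2 • (unitK P * F P) := by
  rw [unitK_mul_F, smul_smul, ← mul_pow, Units.mul_inv, one_pow, one_smul]

theorem F_mul_unitKm : F P * unitKm P = (P.q : L) ^ 2 • (unitKm P * F P) := by
  rw [unitKm_mul_F, smul_smul, ← mul_pow, Units.mul_inv, one_pow, one_smul]

theorem coeHom_mon' (n : (ℕ × ℤ) × (ℕ × ℤ)) : coeHom P (NormedDouble.mon' P n) =
    ((unitK P ^ n.2.2 : (CompletedDouble P)ˣ) : CompletedDouble P) *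
    ((unitKm P ^ n.1.2 : (CompletedDouble P)ˣ) : CompletedDouble P) * F P ^ n.1.1 *
    E P ^ n.2.1 := by
  rw [NormedDouble.mon', map_mul, map_mul, map_mul, map_pow, map_pow, unitK, unitKm, ← map_zpow,
    ← map_zpow]
  rfl

theorem norm_mon_le (n : (ℕ × ℤ) × (ℕ × ℤ)) :
    ‖NormedDouble.mon P n‖ ≤ (P.R : ℝ) ^ (n.1.1 + n.2.1) := by
  rw [← wtD_eq]
  refine NormedDouble.norm_le_of_coord fun m => ?_
  rw [NormedDouble.coord_mon]
  split_ifs with h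
  · rw [norm_one, one_mul, h]
  · simp

theorem norm_unitK_inv_le : ‖(((unitK P)⁻¹ : (CompletedDouble P)ˣ) : CompletedDouble P)‖ ≤ 1 := by
  have h : NormedDouble.mon P ((0, 0), (0, -1)) = (((NormedDouble.K P)⁻¹ : (NormedDouble P)ˣ)) := by
    rw [NormedDouble.mon_eq]; simp
  refine (norm_coeHom P ((NormedDouble.K P)⁻¹ : (NormedDouble P)ˣ)).trans_le ?_
  rw [← h]
  simpa using norm_mon_le P ((0, 0), (0, -1))

theorem norm_unitKm_inv_le :
    ‖(((unitKm P)⁻¹ : (CompletedDouble P)ˣ) : CompletedDouble P)‖ ≤ 1 := by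
  have h : NormedDouble.mon P ((0, -1), (0, 0)) =
      (((NormedDouble.Km P)⁻¹ : (NormedDouble P)ˣ)) := by
    rw [NormedDouble.mon_eq]; simp
  refine (norm_coeHom P ((NormedDouble.Km P)⁻¹ : (NormedDouble P)ˣ)).trans_le ?_
  rw [← h]
  simpa using norm_mon_le P ((0, -1), (0, 0))

/-- The class of `K`. -/
def grK : (Gr (CompletedDouble P))ˣ :=
  symbolUnit (unitK P) 1 one_pos (norm_K_le P) (by simpa using norm_unitK_inv_le P)

/-- The class of `K₋`. -/
def grKm : (Gr (CompletedDouble P))ˣ :=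
  symbolUnit (unitKm P) 1 one_pos (norm_Km_le P) (by simpa using norm_unitKm_inv_le P)

/-- The class of `F`. -/
def grF : Gr (CompletedDouble P) := symbol (F P) P.R P.R_pos (norm_F_le P)

/-- The class of `E`. -/
def grE : Gr (CompletedDouble P) := symbol (E P) P.R P.R_pos (norm_E_le P)

variable {π : L} (hπ : IsUniformizer π)

/-- A uniformizer as a unit of the completed double. -/
def unitPi : (CompletedDouble P)ˣ :=
  Units.map (algebraMap L (CompletedDouble P)).toMonoidHom (Units.mk0 π (norm_pos_iff.1 hπ.1))

theorem unitPi_zpow (m : ℤ) :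
    ((unitPi P hπ ^ m : (CompletedDouble P)ˣ) : CompletedDouble P) = (π ^ m) • 1 := by
  rw [unitPi, ← map_zpow, ← Algebra.algebraMap_eq_smul_one]
  change algebraMap L (CompletedDouble P) ((Units.mk0 π _ ^ m : Lˣ) : L) = _
  rw [Units.val_zpow_eq_zpow_val, Units.val_mk0]

theorem val_unitPi : (unitPi P hπ : CompletedDouble P) = π • 1 := by
  simpa using unitPi_zpow P hπ 1

theorem val_unitPi_inv :
    (((unitPi P hπ)⁻¹ : (CompletedDouble P)ˣ) : CompletedDouble P) = π⁻¹ • 1 := by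
  simpa using unitPi_zpow P hπ (-1)

/-- The class of the uniformizer. -/
def grPi : (Gr (CompletedDouble P))ˣ :=
  symbolUnit (unitPi P hπ) ‖π‖ hπ.1 (by rw [val_unitPi]; exact norm_smul_one_le P π)
    (by rw [val_unitPi_inv, ← norm_inv]; exact norm_smul_one_le P π⁻¹)

theorem isSymbol_grPi : IsSymbol (grPi P hπ : Gr (CompletedDouble P)) (π • 1) ‖π‖ :=
  (isSymbol_symbol _ _ _ _).congr (val_unitPi P hπ) rfl

theorem grPi_commute (x : Gr (CompletedDouble P)) :
    Commute (grPi P hπ : Gr (CompletedDouble P)) x := by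
  obtain ⟨hr, ha, h⟩ := isSymbol_grPi P hπ
  rw [h]
  exact symbol_smul_one_commute _ _ _

theorem isSymbol_grK : IsSymbol (grK P : Gr (CompletedDouble P)) (unitK P) 1 :=
  isSymbol_symbol _ _ _ _
theorem isSymbol_grKm : IsSymbol (grKm P : Gr (CompletedDouble P)) (unitKm P) 1 :=
  isSymbol_symbol _ _ _ _
theorem isSymbol_grE : IsSymbol (grE P) (E P) P.R := isSymbol_symbol _ _ _ _
theorem isSymbol_grF : IsSymbol (grF P) (F P) P.R := isSymbol_symbol _ _ _ _

theorem isSymbol_grK_zpow (l : ℤ) : IsSymbol ((grK P ^ l : (Gr (CompletedDouble P))ˣ) : Gr _)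
    ((unitK P ^ l : (CompletedDouble P)ˣ) : CompletedDouble P) (1 ^ l) :=
  symbolUnit_zpow _ _ _ _ _ _

theorem isSymbol_grKm_zpow (j : ℤ) : IsSymbol ((grKm P ^ j : (Gr (CompletedDouble P))ˣ) : Gr _)
    ((unitKm P ^ j : (CompletedDouble P)ˣ) : CompletedDouble P) (1 ^ j) :=
  symbolUnit_zpow _ _ _ _ _ _

theorem isSymbol_grPi_zpow (m : ℤ) :
    IsSymbol ((grPi P hπ ^ m : (Gr (CompletedDouble P))ˣ) : Gr _)
      ((π ^ m) • (1 : CompletedDouble P)) (‖π‖ ^ m) :=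
  (symbolUnit_zpow _ _ _ _ _ _).congr (unitPi_zpow P hπ m) rfl

theorem grK_commute_grKm : Commute (grK P : Gr (CompletedDouble P)) (grKm P) :=
  ((isSymbol_grK P).mul (isSymbol_grKm P)).unique ((isSymbol_grKm P).mul (isSymbol_grK P))
    (unitK_mul_unitKm P) rfl

/-- The condition on `R` enters here: the commutator of `E` and `F` has norm at most `‖c‖`, and `‖c‖
< R ≤ R * R`, so it vanishes in degree `R * R`. -/
theorem grE_mul_grF : grE P * grF P = grF P * grE P := by
  refine ((isSymbol_grE P).mul (isSymbol_grF P)).eq_of_norm_sub_lt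
    ((isSymbol_grF P).mul (isSymbol_grE P)) ?_
  rw [E_mul_F, add_sub_cancel_left, norm_smul]
  have h1 : ‖(((unitKm P)⁻¹ : (CompletedDouble P)ˣ) : CompletedDouble P) - unitK P‖ ≤ 1 :=
    (norm_sub_le_max _ _).trans
      (max_le (norm_unitKm_inv_le P) (norm_K_le P))
  have h2 : ‖P.c‖ < P.R := P.lt_R
  have h3 : (1 : ℝ) ≤ P.R := by exact_mod_cast P.one_le_R
  calc ‖P.c‖ * _ ≤ ‖P.c‖ * 1 := mul_le_mul_of_nonneg_left h1 (norm_nonneg _)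
    _ < P.R * P.R := by nlinarith

/-- The residue class of `q`, as a unit. -/
def resQ : (Residue L)ˣ := Units.mk0 (res (P.q : L) P.norm_q.le) fun h => by
  rw [res_eq_zero_iff, P.norm_q] at h
  exact lt_irrefl _ h

theorem resHom_resQ_sq : IsSymbol
    (resHom (CompletedDouble P) ((resQ P ^ 2 : (Residue L)ˣ) : Residue L))
    ((P.q : L) ^ 2 • 1) 1 := by
  rw [Units.val_pow_eq_pow_val, map_pow]
  exact ((resHom_res P.norm_q.le).pow 2).congr (by rw [smul_pow, one_pow]) (one_pow 2)

theorem resHom_resQ_inv_sq : IsSymbol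
    (resHom (CompletedDouble P) (((resQ P)⁻¹ ^ 2 : (Residue L)ˣ) : Residue L))
    (((P.q⁻¹ : Lˣ) : L) ^ 2 • 1) 1 := by
  have hq : ‖((P.q⁻¹ : Lˣ) : L)‖ ≤ 1 := by
    rw [Units.val_inv_eq_inv_val, norm_inv, P.norm_q, inv_one]
  have h : ((resQ P)⁻¹ : (Residue L)ˣ) = res ((P.q⁻¹ : Lˣ) : L) hq := by
    -- The unit `(resQ P)⁻¹` is identified with the residue class of `q⁻¹` by multiplying with the
    -- class of `q`.
    refine Units.inv_eq_of_mul_eq_one_right ?_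
    change res (P.q : L) P.norm_q.le * _ = 1
    rw [res_mul, ← res_one]
    exact res_congr (Units.mul_inv P.q) _
  rw [Units.val_pow_eq_pow_val, map_pow, h]
  exact ((resHom_res hq).pow 2).congr (by rw [smul_pow, one_pow]) (one_pow 2)

end CompletedDouble

/-! ### The comparison map from the iterated skew polynomial ring to the graded ring. -/

namespace CompletedDouble

variable {L : Type u} [NormedField L] [IsUltrametricDist L] (P : Datum L) {π : L}
  (hπ : IsUniformizer π)

/-- The automorphism of the torus by which `F` commutes with it. -/
def autF : Torus L ≃+* Torus L := Torus.scaleAut (resQ P ^ 2)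

/-- The automorphism of the skew polynomial ring in `F` by which `E` commutes with it. -/
def autE : SkewPoly (autF P) ≃+* SkewPoly (autF P) :=
  SkewPoly.mapEquiv (Torus.scaleAut ((resQ P)⁻¹ ^ 2)) (Torus.scaleAut_comm _ _)

theorem autE_C (a : Torus L) : autE P (SkewPoly.C (autF P) a) =
    SkewPoly.C (autF P) (Torus.scaleAut ((resQ P)⁻¹ ^ 2) a) := SkewPoly.mapEquiv_C _ _ _

theorem autE_X : autE P (SkewPoly.X (autF P)) = SkewPoly.X (autF P) := SkewPoly.mapEquiv_X _ _

/-- The homomorphism from the torus to the graded ring. -/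
def torusHom : Torus L →+* Gr (CompletedDouble P) :=
  Torus.lift (resHom (CompletedDouble P)) (grPi P hπ) (grK P) (grKm P)
    (fun a => resHom_commute a _) (fun a => resHom_commute a _) (fun a => resHom_commute a _)
    (grPi_commute P hπ _) (grPi_commute P hπ _) (grK_commute_grKm P)

theorem torusHom_K : torusHom P hπ Torus.K = grK P := Torus.lift_K _ _ _ _ _ _ _ _ _ _
theorem torusHom_Km : torusHom P hπ Torus.Km = grKm P := Torus.lift_Km _ _ _ _ _ _ _ _ _ _
theorem torusHom_scalar (a : Residue L) :
    torusHom P hπ (Torus.scalar a) = resHom (CompletedDouble P) a :=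
  Torus.lift_scalar _ _ _ _ _ _ _ _ _ _ a

theorem torusHom_pi : torusHom P hπ (Torus.const (LaurentPolynomial.T 1)) = grPi P hπ :=
  (Torus.lift_const _ _ _ _ _ _ _ _ _ _ _).trans (laurentLift_T _ _ _)

theorem torusHom_const_commute (a : LaurentPolynomial (Residue L)) (x : Gr (CompletedDouble P)) :
    Commute (torusHom P hπ (Torus.const a)) x := by
  rw [torusHom, Torus.lift_const]
  exact laurentLift_commute _ _ _ (fun a => resHom_commute a x) (grPi_commute P hπ x) a

/-- Common source of the rules for the symbols of `F` and `E`, with `c = q²` and `c = q⁻²`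
respectively. The coefficients in `k[π^±1]` map to central elements, so only `K` and `K₋` have to be
checked, and both exchange by the same scalar. -/
theorem mul_torusHom {x : Gr (CompletedDouble P)} {y : CompletedDouble P} {r : ℝ}
    (hx : IsSymbol x y r) {v : (Residue L)ˣ} {c : L}
    (hv : IsSymbol (resHom (CompletedDouble P) (v : Residue L)) (c • 1) 1)
    (hK : y * unitK P = c • (unitK P * y)) (hKm : y * unitKm P = c • (unitKm P * y))
    (a : Torus L) : x * torusHom P hπ a = torusHom P hπ (Torus.scaleAut v a) * x := by
  refine Torus.intertwine (torusHom P hπ)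
    ((torusHom P hπ).comp (Torus.scaleAut v : Torus L →+* Torus L)) x (fun a => ?_) ?_ ?_ a
  · rw [RingHom.comp_apply, RingHom.coe_coe, Torus.scaleAut_const]
    exact (torusHom_const_commute P hπ a x).symm.eq
  · rw [RingHom.comp_apply, RingHom.coe_coe, Torus.scaleAut_K, map_mul, torusHom_K,
      torusHom_scalar]
    exact (hx.mul (isSymbol_grK P)).unique ((hv.mul (isSymbol_grK P)).mul hx)
      (by rw [hK, smul_mul_assoc, smul_mul_assoc, one_mul]) (by ring)
  · rw [RingHom.comp_apply, RingHom.coe_coe, Torus.scaleAut_Km, map_mul, torusHom_Km,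
      torusHom_scalar]
    exact (hx.mul (isSymbol_grKm P)).unique ((hv.mul (isSymbol_grKm P)).mul hx)
      (by rw [hKm, smul_mul_assoc, smul_mul_assoc, one_mul]) (by ring)

theorem grF_mul_torusHom (a : Torus L) :
    grF P * torusHom P hπ a = torusHom P hπ (autF P a) * grF P :=
  mul_torusHom P hπ (isSymbol_grF P) (resHom_resQ_sq P) (F_mul_unitK P) (F_mul_unitKm P) a

/-- The homomorphism from the skew polynomial ring in `F` to the graded ring. -/
def skewHomF : SkewPoly (autF P) →+* Gr (CompletedDouble P) :=
  SkewPoly.lift (torusHom P hπ) (grF P) (grF_mul_torusHom P hπ)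

theorem skewHomF_C (a : Torus L) : skewHomF P hπ (SkewPoly.C _ a) = torusHom P hπ a :=
  SkewPoly.lift_C _ _ _ _

theorem skewHomF_X : skewHomF P hπ (SkewPoly.X _) = grF P := SkewPoly.lift_X _ _ _

/-- The compatibility required for adjoining `E`. On torus elements it is the scalar exchange rule;
on the variable `F` it is the commutation of the two symbols, the reason why the second automorphism
fixes `F`. -/
theorem grE_mul_skewHomF (f : SkewPoly (autF P)) :
    grE P * skewHomF P hπ f = skewHomF P hπ (autE P f) * grE P := by
  refine SkewPoly.intertwine (skewHomF P hπ)
    ((skewHomF P hπ).comp (autE P : SkewPoly (autF P) →+* SkewPoly (autF P))) _ (fun a => ?_) ?_ f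
  · rw [RingHom.comp_apply, RingHom.coe_coe, autE_C, skewHomF_C, skewHomF_C]
    exact mul_torusHom P hπ (isSymbol_grE P) (resHom_resQ_inv_sq P) (E_mul_unitK P)
      (E_mul_unitKm P) a
  · rw [RingHom.comp_apply, RingHom.coe_coe, autE_X, skewHomF_X]
    exact grE_mul_grF P

/-- The homomorphism from the iterated skew polynomial ring to the graded ring. -/
def skewHom : SkewPoly (autE P) →+* Gr (CompletedDouble P) :=
  SkewPoly.lift (skewHomF P hπ) (grE P) (grE_mul_skewHomF P hπ)

theorem skewHom_C_C (a : Torus L) :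
    skewHom P hπ (SkewPoly.C _ (SkewPoly.C _ a)) = torusHom P hπ a := by
  rw [skewHom, SkewPoly.lift_C, skewHomF_C]

theorem skewHom_C_X : skewHom P hπ (SkewPoly.C _ (SkewPoly.X _)) = grF P := by
  rw [skewHom, SkewPoly.lift_C, skewHomF_X]

theorem skewHom_X : skewHom P hπ (SkewPoly.X _) = grE P := by
  rw [skewHom, SkewPoly.lift_X]

/-- The monomial `a π ^ m K ^ l K₋ ^ j F ^ i E ^ k` of the iterated skew polynomial ring. -/
def skewMonomial (m : ℤ) (n : (ℕ × ℤ) × (ℕ × ℤ)) (a : Residue L) : SkewPoly (autE P) :=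
  SkewPoly.monomial _ n.2.1 (SkewPoly.monomial _ n.1.1 (Torus.monomial n.1.2 n.2.2 m a))

theorem skewMonomial_induction {motive : SkewPoly (autE P) → Prop} (f : SkewPoly (autE P))
    (add : ∀ f g, motive f → motive g → motive (f + g))
    (monomial : ∀ m n a, motive (skewMonomial P m n a)) : motive f := by
  induction f using SkewPoly.induction with
  | add f g hf hg => exact add f g hf hg
  | monomial k f =>
    induction f using SkewPoly.induction with
    | add f g hf hg => rw [map_add]; exact add _ _ hf hg
    | monomial i p =>
      induction p using Torus.induction with
      | add p p' hp hp' => rw [map_add, map_add]; exact add _ _ hp hp'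
      | monomial j l m a => exact monomial m ((i, j), (k, l)) a

/-- The coefficient of `π ^ m K ^ l K₋ ^ j F ^ i E ^ k`. -/
def skewCoeff (m : ℤ) (n : (ℕ × ℤ) × (ℕ × ℤ)) : SkewPoly (autE P) →+ Residue L :=
  ((Torus.coeff n.1.2 n.2.2 m).comp (SkewPoly.coeff _ n.1.1)).comp (SkewPoly.coeff _ n.2.1)

theorem skewCoeff_monomial (m m' : ℤ) (n n' : (ℕ × ℤ) × (ℕ × ℤ)) (a : Residue L) :
    skewCoeff P m n (skewMonomial P m' n' a) = if m' = m ∧ n' = n then a else 0 := by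
  obtain ⟨⟨i, j⟩, k, l⟩ := n
  obtain ⟨⟨i', j'⟩, k', l'⟩ := n'
  simp only [skewCoeff, skewMonomial, AddMonoidHom.comp_apply, SkewPoly.coeff_monomial]
  by_cases hk : k' = k
  · by_cases hi : i' = i
    · rw [if_pos hk, SkewPoly.coeff_monomial, if_pos hi, Torus.coeff_monomial]
      refine if_congr ?_ rfl rfl
      simp [hk, hi]; tauto
    · simp [hk, hi, SkewPoly.coeff_monomial]
  · simp [hk]

theorem skewCoeff_ext {f : SkewPoly (autE P)} (h : ∀ m n, skewCoeff P m n f = 0) : f = 0 := by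
  refine SkewPoly.ext fun k => ?_
  rw [map_zero]
  refine SkewPoly.ext fun i => ?_
  rw [map_zero]
  refine Torus.ext fun j l m => ?_
  rw [map_zero]
  exact h m ((i, j), (k, l))

/-- The degree of `π ^ m K ^ l K₋ ^ j F ^ i E ^ k` in the graded ring. -/
def monDeg (π : L) (m : ℤ) (n : (ℕ × ℤ) × (ℕ × ℤ)) : ℝ := ‖π‖ ^ m * (P.R : ℝ) ^ (n.1.1 + n.2.1)

/-- Skew polynomials have coefficients on the left, which is why the normal form `mon'`, with torus
part first and then `F` and `E`, occurs in place of the basis monomials. -/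
theorem isSymbol_skewHom_monomial (m : ℤ) (n : (ℕ × ℤ) × (ℕ × ℤ)) {c : L} (hc : ‖c‖ ≤ 1) :
    IsSymbol (skewHom P hπ (skewMonomial P m n (res c hc)))
      ((c * π ^ m) • coeHom P (NormedDouble.mon' P n)) (monDeg P π m n) := by
  rw [skewMonomial, skewHom, SkewPoly.lift_monomial, skewHomF, SkewPoly.lift_monomial, torusHom,
    Torus.lift_monomial]
  have h := (((((resHom_res (A := CompletedDouble P) hc).mul (isSymbol_grPi_zpow P hπ m)).mul
    (isSymbol_grK_zpow P n.2.2)).mul (isSymbol_grKm_zpow P n.1.2)).mul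
    ((isSymbol_grF P).pow n.1.1)).mul ((isSymbol_grE P).pow n.2.1)
  refine h.congr ?_ ?_
  · rw [coeHom_mon', smul_mul_smul_comm, one_mul, smul_mul_assoc, smul_mul_assoc,
      smul_mul_assoc, smul_mul_assoc, one_mul]
  · rw [monDeg, one_zpow, one_zpow, pow_add]; ring

end CompletedDouble

/-! ### Vanishing symbols and finite sums of symbols. -/

section IsSymbol

variable {A : Type*} [NormedRing A] [IsUltrametricDist A] [NormOneClass A]

theorem IsSymbol.zero {a : A} {r : ℝ} (h : ‖a‖ < r) : IsSymbol (0 : Gr A) a r :=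
  ⟨(norm_nonneg a).trans_lt h, h.le, ((symbol_eq_zero_iff _ _).2 h).symm⟩

theorem IsSymbol.sum {ι : Type*} (s : Finset ι) {x : ι → Gr A} {a : ι → A} {r : ℝ} (hr : 0 < r)
    (h : ∀ i ∈ s, IsSymbol (x i) (a i) r) : IsSymbol (∑ i ∈ s, x i) (∑ i ∈ s, a i) r := by
  classical
  induction s using Finset.induction_on with
  | empty => simpa using IsSymbol.zero (A := A) (a := 0) (by simpa using hr)
  | insert i s hi ih =>
    rw [Finset.sum_insert hi, Finset.sum_insert hi]
    exact (h i (Finset.mem_insert_self i s)).add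
      (ih fun j hj => h j (Finset.mem_insert_of_mem hj))

end IsSymbol

/-! ### Bijectivity of the comparison map. -/

namespace CompletedDouble

variable {L : Type u} [NormedField L] [IsUltrametricDist L] (P : Datum L) {π : L}

theorem monDeg_pos (hπ : IsUniformizer π) (m : ℤ) (n : (ℕ × ℤ) × (ℕ × ℤ)) : 0 < monDeg P π m n :=
  mul_pos (zpow_pos hπ.1 m) (pow_pos P.R_pos _)

/-- A term of norm below `r` has zero class in degree `r`. If its weighted norm is exactly `r`,
splitting `c` into a power of `π` and a scalar of norm one exhibits it as the image of a monomial.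
-/
theorem exists_isSymbol_skewHom (hπ : IsUniformizer π) (n : (ℕ × ℤ) × (ℕ × ℤ)) {c : L} {r : ℝ}
    (hc : ‖c‖ * (P.R : ℝ) ^ (n.1.1 + n.2.1) ≤ r) (hr : 0 < r) :
    ∃ f, IsSymbol (skewHom P hπ f) (c • coeHom P (NormedDouble.mon P n)) r := by
  rcases hc.lt_or_eq with hlt | rfl
  · refine ⟨0, ?_⟩
    rw [map_zero]
    refine IsSymbol.zero (lt_of_le_of_lt ?_ hlt)
    rw [norm_smul, norm_coeHom]
    exact mul_le_mul_of_nonneg_left (norm_mon_le P n) (norm_nonneg c)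
  · have hc0 : c ≠ 0 := by rintro rfl; simp at hr
    obtain ⟨m, hm⟩ := hπ.exists_zpow hc0
    obtain ⟨v, hv, hmon⟩ := NormedDouble.exists_mon'_eq P n
    have hπ0 : π ≠ 0 := norm_pos_iff.1 hπ.1
    have hv0 : v ≠ 0 := by rintro rfl; simp at hv
    -- The factor `v⁻¹` compensates the scalar between `mon'` and `mon`, and `(π ^ m)⁻¹` normalizes
    -- the norm to one.
    have h1 : ‖c * v⁻¹ * (π ^ m)⁻¹‖ ≤ 1 := by
      rw [norm_mul, norm_mul, norm_inv, norm_inv, norm_zpow, hv, hm, inv_one, mul_one,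
        mul_inv_cancel₀ (zpow_pos hπ.1 m).ne']
    refine ⟨skewMonomial P m n (res _ h1), (isSymbol_skewHom_monomial P hπ m n h1).congr ?_ ?_⟩
    · rw [hmon, coeHom_smul, smul_smul]
      congr 1
      field_simp
    · rw [monDeg, hm]

theorem norm_le_of_norm_sub_lt {a : CompletedDouble P} {y : NormedDouble P} {r : ℝ}
    (ha : ‖a‖ ≤ r) (hy : ‖a - coeHom P y‖ < r) : ‖y‖ ≤ r := by
  have h : coeHom P y = a - (a - coeHom P y) := by abel
  rw [← norm_coeHom, h]
  exact (norm_sub_le_max _ _).trans (max_le ha hy.le)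

/-- A symbol in degree `r` depends only on `a` up to norm below `r`, so density allows `a` to be
replaced by an element of the algebraic double. By orthogonality each term of its expansion has norm
at most `r` and can be lifted separately. -/
theorem skewHom_surjective (hπ : IsUniformizer π) :
    Function.Surjective (skewHom P hπ) := fun x => by
  induction x using Gr.induction with
  | add x y hx hy =>
    obtain ⟨f, rfl⟩ := hx
    obtain ⟨g, rfl⟩ := hy
    exact ⟨f + g, map_add _ _ _⟩
  | symbol a r hr ha =>
    obtain ⟨y, hy⟩ := exists_norm_sub_lt P a hr
    obtain ⟨s, -, hs⟩ := NormedDouble.eq_sum_coord y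
    have hle : ∀ n, ‖NormedDouble.coord P n y‖ * (P.R : ℝ) ^ (n.1.1 + n.2.1) ≤ r := fun n => by
      rw [← wtD_eq]
      exact (NormedDouble.norm_coord_mul_le n y).trans (norm_le_of_norm_sub_lt P ha hy)
    choose f hf using fun n => exists_isSymbol_skewHom P hπ n (hle n) hr
    refine ⟨∑ n ∈ s, f n, ?_⟩
    rw [map_sum]
    refine (IsSymbol.sum s hr fun n _ => hf n).eq_of_norm_sub_lt (isSymbol_symbol a r hr ha) ?_
    have h : ∑ n ∈ s, NormedDouble.coord P n y • coeHom P (NormedDouble.mon P n) = coeHom P y := by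
      conv_rhs => rw [hs]
      rw [map_sum]
      exact Finset.sum_congr rfl fun n _ => (coeHom_smul P _ _).symm
    rw [h, norm_sub_rev]
    exact hy

/-! ### Coefficients of elements of the graded ring -/

open Classical in
/-- The residue class of `c`, or `0` if `c` is not integral. -/
def resOrZero (c : L) : Residue L := if hc : ‖c‖ ≤ 1 then res c hc else 0

theorem resOrZero_eq {c : L} (hc : ‖c‖ ≤ 1) : resOrZero c = res c hc := dif_pos hc

/-- The scalar relating the two normal forms of a monomial. -/
def monScalar (n : (ℕ × ℤ) × (ℕ × ℤ)) : L := (NormedDouble.exists_mon'_eq P n).choose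

theorem norm_monScalar (n : (ℕ × ℤ) × (ℕ × ℤ)) : ‖monScalar P n‖ = 1 :=
  (NormedDouble.exists_mon'_eq P n).choose_spec.1

theorem mon'_eq (n : (ℕ × ℤ) × (ℕ × ℤ)) :
    NormedDouble.mon' P n = monScalar P n • NormedDouble.mon P n :=
  (NormedDouble.exists_mon'_eq P n).choose_spec.2

/-- The coefficient of `π ^ m` times a monomial, for elements of the double. -/
def scaledCoord (π : L) (m : ℤ) (n : (ℕ × ℤ) × (ℕ × ℤ)) : NormedDouble P →ₗ[L] L :=
  (monScalar P n * π ^ m)⁻¹ • NormedDouble.coord P n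

theorem norm_scaledCoord_mul_le (hπ : IsUniformizer π) (m : ℤ) (n : (ℕ × ℤ) × (ℕ × ℤ))
    (y : NormedDouble P) :
    ‖scaledCoord P π m n y‖ * monDeg P π m n ≤ ‖y‖ := by
  refine le_of_eq_of_le ?_ (NormedDouble.norm_coord_mul_le n y)
  rw [scaledCoord, LinearMap.smul_apply, norm_smul, norm_inv, norm_mul, norm_monScalar, one_mul,
    norm_zpow, monDeg, wtD_eq]
  have := (zpow_pos hπ.1 m).ne'
  field_simp

theorem norm_scaledCoord_le (hπ : IsUniformizer π) {m : ℤ} {n : (ℕ × ℤ) × (ℕ × ℤ)}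
    {y : NormedDouble P}
    (h : ‖y‖ ≤ monDeg P π m n) : ‖scaledCoord P π m n y‖ ≤ 1 := by
  have h1 := (norm_scaledCoord_mul_le P hπ m n y).trans h
  exact le_of_mul_le_mul_right (h1.trans_eq (one_mul _).symm) (monDeg_pos P hπ m n)

theorem norm_scaledCoord_lt (hπ : IsUniformizer π) {m : ℤ} {n : (ℕ × ℤ) × (ℕ × ℤ)}
    {y : NormedDouble P}
    (h : ‖y‖ < monDeg P π m n) : ‖scaledCoord P π m n y‖ < 1 := by
  have h1 := (norm_scaledCoord_mul_le P hπ m n y).trans_lt h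
  exact lt_of_mul_lt_mul_right (h1.trans_eq (one_mul _).symm) (monDeg_pos P hπ m n).le

/-- The residue of the coefficient of an element of the completed double. -/
def leadRes (hπ : IsUniformizer π) (m : ℤ) (n : (ℕ × ℤ) × (ℕ × ℤ)) (a : CompletedDouble P) :
    Residue L :=
  resOrZero (scaledCoord P π m n (exists_norm_sub_lt P a (monDeg_pos P hπ m n)).choose)

/-- Two approximations of `a` differ by less than the degree of the monomial, so their rescaled
coordinates are integral and differ by an element of norm below one. The residue is thus independent
of the choice, and the default value in `resOrZero` is not used. -/
theorem leadRes_eq (hπ : IsUniformizer π) {m : ℤ} {n : (ℕ × ℤ) × (ℕ × ℤ)}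
    {a : CompletedDouble P} {y : NormedDouble P}
    (ha : ‖a‖ ≤ monDeg P π m n) (hy : ‖a - coeHom P y‖ < monDeg P π m n) :
    leadRes P hπ m n a = res (scaledCoord P π m n y)
      (norm_scaledCoord_le P hπ (norm_le_of_norm_sub_lt P ha hy)) := by
  set y' := (exists_norm_sub_lt P a (monDeg_pos P hπ m n)).choose with hy'_def
  have hy' : ‖a - coeHom P y'‖ < monDeg P π m n :=
    (exists_norm_sub_lt P a (monDeg_pos P hπ m n)).choose_spec
  rw [leadRes, ← hy'_def, resOrZero_eq (norm_scaledCoord_le P hπ (norm_le_of_norm_sub_lt P ha hy')),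
    res_eq_iff, ← map_sub]
  refine norm_scaledCoord_lt P hπ ?_
  rw [← norm_coeHom, map_sub]
  have h : coeHom P y' - coeHom P y = (a - coeHom P y) - (a - coeHom P y') := by abel
  rw [h]
  exact (norm_sub_le_max _ _).trans_lt (max_lt hy hy')

theorem leadRes_add (hπ : IsUniformizer π) {m : ℤ} {n : (ℕ × ℤ) × (ℕ × ℤ)} {a b : CompletedDouble P}
    (ha : ‖a‖ ≤ monDeg P π m n) (hb : ‖b‖ ≤ monDeg P π m n) :
    leadRes P hπ m n (a + b) = leadRes P hπ m n a + leadRes P hπ m n b := by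
  obtain ⟨y, hy⟩ := exists_norm_sub_lt P a (monDeg_pos P hπ m n)
  obtain ⟨z, hz⟩ := exists_norm_sub_lt P b (monDeg_pos P hπ m n)
  have h : ‖a + b - coeHom P (y + z)‖ < monDeg P π m n := by
    have e : a + b - coeHom P (y + z) = (a - coeHom P y) + (b - coeHom P z) := by
      rw [map_add]; abel
    rw [e]
    exact (IsUltrametricDist.norm_add_le_max _ _).trans_lt (max_lt hy hz)
  rw [leadRes_eq P hπ ((IsUltrametricDist.norm_add_le_max a b).trans (max_le ha hb)) h,
    leadRes_eq P hπ ha hy, leadRes_eq P hπ hb hz, res_add]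
  exact res_congr (map_add _ _ _) _

theorem leadRes_eq_zero (hπ : IsUniformizer π) {m : ℤ} {n : (ℕ × ℤ) × (ℕ × ℤ)}
    {a : CompletedDouble P}
    (ha : ‖a‖ < monDeg P π m n) : leadRes P hπ m n a = 0 := by
  rw [leadRes_eq P hπ (y := 0) ha.le (by rwa [map_zero, sub_zero]), res_eq_zero_iff, map_zero,
    norm_zero]
  exact one_pos

/-- The coefficient functional on the graded ring. -/
def grCoeff (hπ : IsUniformizer π) (m : ℤ) (n : (ℕ × ℤ) × (ℕ × ℤ)) :
    Gr (CompletedDouble P) →+ Residue L :=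
  -- Only the homogeneous component in the degree of the monomial is read; components of smaller
  -- norm have residue zero, so the functional descends to the quotient.
  QuotientAddGroup.lift (reesIdeal (CompletedDouble P)).toAddSubgroup
    { toFun := fun f => leadRes P hπ m n ((f : MonoidAlgebra (CompletedDouble P) PosReal).coeff
        ⟨monDeg P π m n, monDeg_pos P hπ m n⟩)
      map_zero' := leadRes_eq_zero P hπ (norm_zero.trans_lt (monDeg_pos P hπ m n))
      map_add' := fun f g => leadRes_add P hπ (f.2 _) (g.2 _) }
    fun _ hf => leadRes_eq_zero P hπ (hf ⟨monDeg P π m n, monDeg_pos P hπ m n⟩)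

theorem grCoeff_symbol (hπ : IsUniformizer π) (m : ℤ) (n : (ℕ × ℤ) × (ℕ × ℤ))
    (a : CompletedDouble P) (r : ℝ) (hr : 0 < r)
    (ha : ‖a‖ ≤ r) : grCoeff P hπ m n (symbol a r hr ha) =
      if r = monDeg P π m n then leadRes P hπ m n a else 0 := by
  classical
  change leadRes P hπ m n ((MonoidAlgebra.single ⟨r, hr⟩ a :
    MonoidAlgebra (CompletedDouble P) PosReal).coeff _) = _
  rw [MonoidAlgebra.coeff_single, Finsupp.single_apply]
  simp only [Subtype.mk.injEq]
  split_ifs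
  · rfl
  · exact leadRes_eq_zero P hπ (norm_zero.trans_lt (monDeg_pos P hπ m n))

/-- The functionals `grCoeff` are dual to the images of the monomials, including those of equal
degree, which are separated by the coordinates of the double. -/
theorem grCoeff_skewHom_monomial (hπ : IsUniformizer π) (m m' : ℤ) (n n' : (ℕ × ℤ) × (ℕ × ℤ))
    (a : Residue L) :
    grCoeff P hπ m n (skewHom P hπ (skewMonomial P m' n' a)) =
      if m' = m ∧ n' = n then a else 0 := by
  obtain ⟨c, hc, rfl⟩ := exists_res_eq a
  obtain ⟨hr, ha, h⟩ := isSymbol_skewHom_monomial P hπ m' n' hc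
  rw [h, grCoeff_symbol]
  by_cases hdeg : monDeg P π m' n' = monDeg P π m n
  · rw [hdeg] at ha
    rw [if_pos hdeg, leadRes_eq P hπ (y := (c * π ^ m') • NormedDouble.mon' P n') ha (by
      rw [coeHom_smul, sub_self, norm_zero]; exact monDeg_pos P hπ m n)]
    have hval : scaledCoord P π m n ((c * π ^ m') • NormedDouble.mon' P n') =
        (monScalar P n * π ^ m)⁻¹ * ((c * π ^ m') * (monScalar P n' *
          if n' = n then 1 else 0)) := by
      rw [scaledCoord, LinearMap.smul_apply, mon'_eq, map_smul, map_smul, NormedDouble.coord_mon]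
      simp only [smul_eq_mul]
    by_cases hn : n' = n
    · subst hn
      -- For a fixed monomial the degree determines the exponent of `π`, because `0 < ‖π‖ < 1`.
      have hm : m' = m := by
        have h := mul_right_cancel₀ (pow_pos P.R_pos _).ne' hdeg
        exact zpow_right_injective₀ hπ.1 hπ.2.1.ne h
      subst hm
      rw [if_pos ⟨rfl, rfl⟩]
      refine res_congr (hval.trans ?_) _
      have h1 : π ^ m' ≠ 0 := zpow_ne_zero _ (norm_pos_iff.1 hπ.1)
      have h2 : monScalar P n' ≠ 0 := fun h => by
        have := norm_monScalar P n'
        rw [h, norm_zero] at this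
        exact zero_ne_one this
      rw [if_pos rfl]
      field_simp
    · rw [if_neg fun h => hn h.2, res_eq_zero_iff, hval, if_neg hn]
      simp
  · rw [if_neg hdeg, if_neg]
    rintro ⟨rfl, rfl⟩
    exact hdeg rfl

theorem grCoeff_skewHom (hπ : IsUniformizer π) (m : ℤ) (n : (ℕ × ℤ) × (ℕ × ℤ))
    (f : SkewPoly (autE P)) :
    grCoeff P hπ m n (skewHom P hπ f) = skewCoeff P m n f := by
  induction f using skewMonomial_induction with
  | add f g hf hg => rw [map_add, map_add, map_add, hf, hg]
  | monomial m' n' a => rw [grCoeff_skewHom_monomial, skewCoeff_monomial]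

/-- All coefficients of a skew polynomial can be recovered from its image by the functionals
`grCoeff`. -/
theorem skewHom_injective (hπ : IsUniformizer π) : Function.Injective (skewHom P hπ) := by
  rw [injective_iff_map_eq_zero]
  intro f hf
  refine skewCoeff_ext P fun m n => ?_
  rw [← grCoeff_skewHom P hπ, hf, map_zero]

/-- The graded ring of the completed double is an iterated skew polynomial ring. -/
def grEquiv (hπ : IsUniformizer π) : Gr (CompletedDouble P) ≃+* SkewPoly (autE P) :=
  (RingEquiv.ofBijective (skewHom P hπ) ⟨skewHom_injective P hπ, skewHom_surjective P hπ⟩).symm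

theorem grEquiv_eq_iff (hπ : IsUniformizer π) {x : Gr (CompletedDouble P)} {f : SkewPoly (autE P)} :
    grEquiv P hπ x = f ↔ skewHom P hπ f = x :=
  (RingEquiv.symm_apply_eq _).trans eq_comm

end CompletedDouble

theorem Torus.z_ne_zero {L : Type u} [NormedField L] [IsUltrametricDist L] :
    (Torus.z : Torus L) ≠ 0 := fun h => by
  have h1 : (Torus.Km : Torus L) = Torus.K := by
    rw [Torus.z, sub_eq_zero] at h
    calc (Torus.Km : Torus L) = Torus.Km * (Torus.K * Torus.Kinv) := by
          rw [Torus.K_mul_Kinv, mul_one]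
      _ = Torus.Km * Torus.Kinv * Torus.K := by ring
      _ = _ := by rw [h, one_mul]
  have h2 : (Torus.Km : Torus L) = Torus.monomial 1 0 0 1 := rfl
  have h3 : (Torus.K : Torus L) = Torus.monomial 0 1 0 1 := rfl
  have h4 := congrArg (Torus.coeff 1 0 0) h1
  rw [h2, h3, Torus.coeff_monomial, Torus.coeff_monomial] at h4
  simp at h4

namespace CompletedDouble

variable {L : Type u} [NormedField L] [IsUltrametricDist L] (P : Datum L) {π : L}

/-! ### Structure of the completed double -/

theorem gr_isNoetherianRing (hπ : IsUniformizer π) : IsNoetherianRing (Gr (CompletedDouble P)) :=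
  isNoetherianRing_of_ringEquiv (SkewPoly (autE P)) (grEquiv P hπ).symm

theorem gr_isNoetherianRing_op (hπ : IsUniformizer π) :
    IsNoetherianRing (Gr (CompletedDouble P))ᵐᵒᵖ :=
  isNoetherianRing_of_ringEquiv (SkewPoly (autE P))ᵐᵒᵖ (RingEquiv.op (grEquiv P hπ).symm)

theorem gr_noZeroDivisors (hπ : IsUniformizer π) : NoZeroDivisors (Gr (CompletedDouble P)) := by
  have := SkewPoly.noZeroDivisors (β := autF P)
  have := SkewPoly.noZeroDivisors (β := autE P)
  exact (grEquiv P hπ).injective.noZeroDivisors _ (map_zero _) (map_mul _)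

theorem isNoetherianRing (hπ : IsUniformizer π) : IsNoetherianRing (CompletedDouble P) :=
  have := gr_isNoetherianRing P hπ
  isNoetherianRing_of_gr hπ.1 hπ.2.1 (discreteNorm P hπ)

theorem isNoetherianRing_op (hπ : IsUniformizer π) : IsNoetherianRing (CompletedDouble P)ᵐᵒᵖ :=
  have := gr_isNoetherianRing_op P hπ
  isNoetherianRing_op_of_gr hπ.1 hπ.2.1 (discreteNorm P hπ)

theorem norm_mul_eq (hπ : IsUniformizer π) (x y : CompletedDouble P) : ‖x * y‖ = ‖x‖ * ‖y‖ :=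
  have := gr_noZeroDivisors P hπ
  norm_mul_of_noZeroDivisors x y

/-- The residue class of `q` is `1`, so both automorphisms are trivial and each skew extension stays
commutative. -/
theorem gr_mul_comm (hπ : IsUniformizer π) (hq : ‖1 - (P.q : L)‖ < 1)
    (x y : Gr (CompletedDouble P)) : x * y = y * x := by
  have h1 : resQ P = 1 := by
    refine Units.ext ?_
    change res (P.q : L) P.norm_q.le = 1
    rw [← res_one, res_eq_iff, norm_sub_rev]
    exact hq
  have hF : ∀ a, autF P a = a := fun a => by
    rw [autF, h1, one_pow, Torus.scaleAut_one]
  have hE : (autE P : SkewPoly (autF P) →+* SkewPoly (autF P)) = RingHom.id _ := by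
    refine SkewPoly.ringHom_ext (fun a => ?_) (autE_X P)
    rw [RingHom.coe_coe, autE_C, h1, inv_one, one_pow, Torus.scaleAut_one, RingHom.id_apply]
  refine (grEquiv P hπ).injective ?_
  rw [map_mul, map_mul]
  exact SkewPoly.mul_comm_of_forall (SkewPoly.mul_comm_of_forall mul_comm hF)
    (fun f => congrArg (fun g : SkewPoly (autF P) →+* SkewPoly (autF P) => g f) hE) _ _

/-! ### The central element `K₋ K⁻¹ - 1` -/

/-- The element `K₋ K⁻¹ - 1`. -/
def z : CompletedDouble P := unitKm P * ((unitK P)⁻¹ : (CompletedDouble P)ˣ) - 1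

/-- The scalar picked up by `k'` is undone by `k⁻¹`. Applied to `K` and `K₋`, this makes the ratio
`K₋ K⁻¹` commute with every generator. -/
theorem commute_of_smul {B : Type*} [Ring B] [Algebra L B] {k k' : Bˣ} {x : B} {c : L}
    (hk : x * k = c • (k * x)) (hk' : x * k' = c • (k' * x)) :
    Commute ((k' : B) * ((k⁻¹ : Bˣ) : B)) x := by
  have h : ((k⁻¹ : Bˣ) : B) * x = c • (x * ((k⁻¹ : Bˣ) : B)) := by
    rw [← Units.mul_inv_cancel_right (((k⁻¹ : Bˣ) : B) * x) k, mul_assoc _ x, hk, mul_smul_comm,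
      Units.inv_mul_cancel_left, smul_mul_assoc]
  rw [Commute, SemiconjBy, ← mul_assoc x, hk', smul_mul_assoc, mul_assoc, h, mul_smul_comm,
    mul_assoc]

theorem z_commute_coeHom (y : NormedDouble P) : Commute (z P) (coeHom P y) := by
  set w : CompletedDouble P := unitKm P * ((unitK P)⁻¹ : (CompletedDouble P)ˣ) with hw
  have hF : Commute w (F P) := commute_of_smul (F_mul_unitK P) (F_mul_unitKm P)
  have hE : Commute w (E P) := commute_of_smul (E_mul_unitK P) (E_mul_unitKm P)
  have hK : Commute w (unitK P) := commute_of_smul (c := (1 : L)) (by rw [one_smul])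
    (by rw [one_smul, unitK_mul_unitKm])
  have hKm : Commute w (unitKm P) := commute_of_smul (c := (1 : L))
    (by rw [one_smul, unitK_mul_unitKm]) (by rw [one_smul])
  -- Up to a nonzero scalar, a basis monomial is a product of powers of the generators, where `K`
  -- and `K₋` may have negative exponents.
  have hmon : ∀ n, Commute w (coeHom P (NormedDouble.mon P n)) := fun n => by
    obtain ⟨v, hv, h⟩ := NormedDouble.exists_mon'_eq P n
    have hv0 : v ≠ 0 := by rintro rfl; simp at hv
    have h' : NormedDouble.mon P n = v⁻¹ • NormedDouble.mon' P n := by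
      rw [h, smul_smul, inv_mul_cancel₀ hv0, one_smul]
    rw [h', coeHom_smul, coeHom_mon']
    exact ((((hK.units_zpow_right _).mul_right (hKm.units_zpow_right _)).mul_right
      (hF.pow_right _)).mul_right (hE.pow_right _)).smul_right _
  obtain ⟨s, -, hs⟩ := NormedDouble.eq_sum_coord y
  refine Commute.sub_left (a := w) ?_ (Commute.one_left _)
  rw [hs, map_sum]
  refine Commute.sum_right _ _ _ fun n _ => ?_
  rw [coeHom_smul]
  exact (hmon n).smul_right _

/-- Commutation with `z` is a closed condition, so centrality extends from the dense algebraic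
double. -/
theorem z_mul_comm (x : CompletedDouble P) : z P * x = x * z P := by
  induction x using UniformSpace.Completion.induction_on with
  | hp =>
    exact isClosed_eq (continuous_const.mul continuous_id) (continuous_id.mul continuous_const)
  | ih y => exact z_commute_coeHom P y

theorem isSymbol_torusHom_z (hπ : IsUniformizer π) :
    IsSymbol (torusHom P hπ Torus.z) (z P) 1 := by
  have h : torusHom P hπ Torus.Kinv = ((grK P)⁻¹ : (Gr (CompletedDouble P))ˣ) := by
    symm
    refine Units.inv_eq_of_mul_eq_one_right ?_
    rw [← torusHom_K P hπ, ← map_mul, Torus.K_mul_Kinv, map_one]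
  rw [Torus.z, map_sub, map_mul, map_one, h, torusHom_Km]
  have hinv := isSymbol_grK_zpow P (-1)
  rw [zpow_neg_one, zpow_neg_one] at hinv
  exact (((isSymbol_grKm P).mul hinv).congr rfl (by simp)).sub IsSymbol.one

/-- A norm below one would make the symbol of `z` in degree `1` vanish, but this symbol is the image
of a nonzero element of the torus under an injective map. -/
theorem norm_z (hπ : IsUniformizer π) : ‖z P‖ = 1 := by
  obtain ⟨hr, ha, h⟩ := isSymbol_torusHom_z P hπ
  refine ha.antisymm (le_of_not_gt fun hlt => ?_)
  rw [(symbol_eq_zero_iff hr ha).2 hlt, ← skewHom_C_C, map_eq_zero_iff _ (skewHom_injective P hπ),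
    map_eq_zero_iff _ SkewPoly.C_injective, map_eq_zero_iff _ SkewPoly.C_injective] at h
  exact Torus.z_ne_zero h

theorem grEquiv_symbol_z (hπ : IsUniformizer π) :
    grEquiv P hπ (symbol (z P) 1 one_pos (norm_z P hπ).le) =
      SkewPoly.C (autE P) (SkewPoly.C (autF P) Torus.z) := by
  rw [grEquiv_eq_iff, skewHom_C_C]
  exact (isSymbol_torusHom_z P hπ).unique (isSymbol_symbol _ _ _ _) rfl rfl

/-- Complete primality is transported from the torus through the skew extension by `F` and then the
one by `E`; both automorphisms fix the central element `z`. -/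
theorem symbol_z_dvd_or_dvd (hπ : IsUniformizer π) (a b : Gr (CompletedDouble P))
    (h : symbol (z P) 1 one_pos (norm_z P hπ).le ∣ a * b) :
    symbol (z P) 1 one_pos (norm_z P hπ).le ∣ a ∨ symbol (z P) 1 one_pos (norm_z P hπ).le ∣ b := by
  have hc : ∀ a : Torus L, Torus.z * a = a * Torus.z := fun a => mul_comm _ _
  have hF : autF P Torus.z = Torus.z := Torus.scaleAut_z _
  rw [← map_dvd_iff (grEquiv P hπ), grEquiv_symbol_z] at h ⊢
  rw [← map_dvd_iff (grEquiv P hπ), grEquiv_symbol_z]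
  rw [map_mul] at h
  exact SkewPoly.C_dvd_or_dvd (SkewPoly.C_central hc hF)
    (by rw [autE_C, Torus.scaleAut_z])
    (fun f g => SkewPoly.C_dvd_or_dvd hc hF Torus.z_dvd_or_dvd) h

theorem not_symbol_z_dvd_one (hπ : IsUniformizer π) :
    ¬ symbol (z P) 1 one_pos (norm_z P hπ).le ∣ 1 := fun h => by
  have hcoeff : ∀ {S : Type u} [Ring S] (β : S ≃+* S), SkewPoly.coeff β 0 1 = 1 := fun β => by
    rw [← map_one (SkewPoly.C β), SkewPoly.C_eq_monomial, SkewPoly.coeff_monomial, if_pos rfl]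
  -- Divisibility by a constant is tested on coefficients, so the constant coefficient, taken twice,
  -- reduces the claim to the torus.
  rw [← map_dvd_iff (grEquiv P hπ), grEquiv_symbol_z, map_one, SkewPoly.C_dvd_iff] at h
  have h0 := h 0
  rw [hcoeff, SkewPoly.C_dvd_iff] at h0
  have h1 := h0 0
  rw [hcoeff] at h1
  exact Torus.not_z_dvd_one h1

/-- The ideal of multiples of `K₋ K⁻¹ - 1`. -/
def zIdeal : Ideal (CompletedDouble P) where
  carrier := {x | z P ∣ x}
  add_mem' := dvd_add
  zero_mem' := dvd_zero _
  smul_mem' a x hx := by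
    obtain ⟨w, rfl⟩ := hx
    exact ⟨a * w, by rw [smul_eq_mul, ← mul_assoc, ← z_mul_comm, mul_assoc]⟩

/-- Multiplication by `z` is an isometry, the norm being multiplicative and `‖z‖ = 1`; by
completeness its range is closed. -/
theorem isClosed_zIdeal (hπ : IsUniformizer π) :
    IsClosed (zIdeal P : Set (CompletedDouble P)) := by
  have h : Isometry fun w => z P * w := Isometry.of_dist_eq fun x y => by
    rw [dist_eq_norm, dist_eq_norm, ← mul_sub, norm_mul_eq P hπ, norm_z P hπ, one_mul]
  convert h.isClosedEmbedding.isClosed_range using 1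
  ext x
  exact ⟨fun ⟨w, hw⟩ => ⟨w, hw.symm⟩, fun ⟨w, hw⟩ => ⟨w, hw.symm⟩⟩

theorem K_sub_Km : K P - Km P = z P * -K P := by
  rw [z, ← val_unitK, ← val_unitKm, sub_mul, mul_neg, Units.inv_mul_cancel_right, one_mul]
  abel

theorem z_eq : z P = (K P - Km P) * -((unitK P)⁻¹ : (CompletedDouble P)ˣ) := by
  rw [z, ← val_unitK, ← val_unitKm, mul_neg, sub_mul, Units.mul_inv, neg_sub]

/-- `K - K₋` and `z` differ by a unit factor. The multiples of the central `z` already form a closed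
two-sided ideal, so taking the closure adds nothing. -/
theorem Iq_eq (hπ : IsUniformizer π) : Iq P = zIdeal P := by
  refine le_antisymm (sInf_le ⟨⟨fun {a} b ha => ?_⟩, isClosed_zIdeal P hπ, ?_⟩) ?_
  · exact dvd_mul_of_dvd_left ha b
  · exact ⟨_, K_sub_Km P⟩
  · refine le_sInf fun I ⟨h1, _, h3⟩ => ?_
    rintro _ ⟨w, rfl⟩
    rw [z_eq, mul_assoc]
    exact h1.mul_mem_of_left _ h3

theorem mem_Iq_iff (hπ : IsUniformizer π) (x : CompletedDouble P) : x ∈ Iq P ↔ z P ∣ x := by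
  rw [Iq_eq P hπ]; rfl

theorem isClosed_Iq (hπ : IsUniformizer π) : IsClosed (Iq P : Set (CompletedDouble P)) := by
  rw [Iq_eq P hπ]; exact isClosed_zIdeal P hπ

end CompletedDouble

/-! ### The quotient -/

namespace UqSL2

open CompletedDouble

variable {L : Type u} [NormedField L] [IsUltrametricDist L] (P : Datum L) {π : L}

theorem mk_surjective : Function.Surjective (mk P) := Ideal.Quotient.mk_surjective

theorem isNoetherianRing (hπ : IsUniformizer π) : IsNoetherianRing (UqSL2 P) :=
  have := CompletedDouble.isNoetherianRing P hπ
  isNoetherianRing_of_surjective _ _ (mk P) (mk_surjective P)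

theorem isNoetherianRing_op (hπ : IsUniformizer π) : IsNoetherianRing (UqSL2 P)ᵐᵒᵖ :=
  have := CompletedDouble.isNoetherianRing_op P hπ
  isNoetherianRing_of_surjective _ _ (RingHom.op (mk P)) fun x =>
    (mk_surjective P x.unop).imp' MulOpposite.op fun _ h => congrArg MulOpposite.op h

theorem norm_one_eq (hπ : IsUniformizer π) : ‖(1 : UqSL2 P)‖ = 1 :=
  quotient_norm_one (norm_mul_eq P hπ) (norm_z P hπ) (not_symbol_z_dvd_one P hπ) (mem_Iq_iff P hπ)

theorem norm_mul_eq (hπ : IsUniformizer π) (x y : UqSL2 P) : ‖x * y‖ = ‖x‖ * ‖y‖ := by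
  obtain ⟨x, rfl⟩ := mk_surjective P x
  obtain ⟨y, rfl⟩ := mk_surjective P y
  rw [← map_mul]
  exact quotient_norm_mul hπ.1 hπ.2.1 (discreteNorm P hπ) (CompletedDouble.norm_mul_eq P hπ)
    (norm_z P hπ) (z_mul_comm P) (symbol_z_dvd_or_dvd P hπ) (mem_Iq_iff P hπ) (isClosed_Iq P hπ) x y

end UqSL2

end QuantumSL2

end

theorem mainTheorem3 {L : Type*} [NormedField L] [IsUltrametricDist L]
    (π : L) (hπ : IsUniformizer π) (P : Datum L) :
    -- the completed double is left and right noetherian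
    IsNoetherianRing (CompletedDouble P) ∧
    IsNoetherianRing (CompletedDouble P)ᵐᵒᵖ ∧
    -- its norm is multiplicative
    (∀ x y : CompletedDouble P, ‖x * y‖ = ‖x‖ * ‖y‖) ∧
    -- its associated graded ring is `k[π^±1][K^±1, K₋^±1][F, β₀, 0][E, β₁, 0]`
    (∃ (β₀ : Torus L ≃+* Torus L) (β₁ : SkewPoly β₀ ≃+* SkewPoly β₀)
        (e : Gr (CompletedDouble P) ≃+* SkewPoly β₁),
      (∀ a, β₀ (Torus.const a) = Torus.const a) ∧
      β₀ Torus.K = Torus.scalar (res (P.q : L) P.norm_q.le ^ 2) * Torus.K ∧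
      β₀ Torus.Km = Torus.scalar (res (P.q : L) P.norm_q.le ^ 2) * Torus.Km ∧
      (∀ a, β₁ (SkewPoly.C β₀ (Torus.const a)) = SkewPoly.C β₀ (Torus.const a)) ∧
      β₁ (SkewPoly.C β₀ Torus.K) =
        SkewPoly.C β₀ (Torus.scalar ((res (P.q : L) P.norm_q.le)⁻¹ ^ 2) * Torus.K) ∧
      β₁ (SkewPoly.C β₀ Torus.Km) =
        SkewPoly.C β₀ (Torus.scalar ((res (P.q : L) P.norm_q.le)⁻¹ ^ 2) * Torus.Km) ∧
      β₁ (SkewPoly.X β₀) = SkewPoly.X β₀ ∧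
      (∀ (c : L) (hc : ‖c‖ ≤ 1),
        e (symbol (c • 1) 1 one_pos ((CompletedDouble.norm_smul_one_le P c).trans hc)) =
          SkewPoly.C β₁ (SkewPoly.C β₀ (Torus.scalar (res c hc)))) ∧
      e (symbol (π • 1) ‖π‖ hπ.1 (CompletedDouble.norm_smul_one_le P π)) =
        SkewPoly.C β₁ (SkewPoly.C β₀ (Torus.const (LaurentPolynomial.T 1))) ∧
      e (symbol (CompletedDouble.K P) 1 one_pos (CompletedDouble.norm_K_le P)) =
        SkewPoly.C β₁ (SkewPoly.C β₀ Torus.K) ∧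
      e (symbol (CompletedDouble.Km P) 1 one_pos (CompletedDouble.norm_Km_le P)) =
        SkewPoly.C β₁ (SkewPoly.C β₀ Torus.Km) ∧
      e (symbol (CompletedDouble.F P) P.R P.R_pos (CompletedDouble.norm_F_le P)) =
        SkewPoly.C β₁ (SkewPoly.X β₀) ∧
      e (symbol (CompletedDouble.E P) P.R P.R_pos (CompletedDouble.norm_E_le P)) =
        SkewPoly.X β₁) ∧
    -- this graded ring is commutative if `|1 - q| < 1`
    (‖1 - (P.q : L)‖ < 1 → ∀ x y : Gr (CompletedDouble P), x * y = y * x) ∧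
    -- `U_q(sl₂, R)` is left and right noetherian, with multiplicative quotient norm
    IsNoetherianRing (UqSL2 P) ∧
    IsNoetherianRing (UqSL2 P)ᵐᵒᵖ ∧
    ‖(1 : UqSL2 P)‖ = 1 ∧
    (∀ x y : UqSL2 P, ‖x * y‖ = ‖x‖ * ‖y‖) := by
  -- The statement uses the residue class of `q` and its inverse as field elements, whereas the
  -- automorphisms are built from units; this bridges the two forms.
  have hscalar : ∀ c : Residue L, ∀ u : (Residue L)ˣ, (u : Residue L) = c →
      Torus.scaleAut u Torus.K = Torus.scalar c * Torus.K ∧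
      Torus.scaleAut u Torus.Km = Torus.scalar c * Torus.Km := by
    rintro _ u rfl
    exact ⟨Torus.scaleAut_K u, Torus.scaleAut_Km u⟩
  have hF := hscalar (res (P.q : L) P.norm_q.le ^ 2) (CompletedDouble.resQ P ^ 2)
    (Units.val_pow_eq_pow_val _ _)
  have hE := hscalar ((res (P.q : L) P.norm_q.le)⁻¹ ^ 2) ((CompletedDouble.resQ P)⁻¹ ^ 2) (by
    rw [Units.val_pow_eq_pow_val, Units.val_inv_eq_inv_val]; rfl)
  refine ⟨CompletedDouble.isNoetherianRing P hπ, CompletedDouble.isNoetherianRing_op P hπ,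
    CompletedDouble.norm_mul_eq P hπ,
    ⟨CompletedDouble.autF P, CompletedDouble.autE P, CompletedDouble.grEquiv P hπ,
      Torus.scaleAut_const _, hF.1, hF.2, fun a => ?_, ?_, ?_, CompletedDouble.autE_X P,
      fun c hc => ?_, ?_, ?_, ?_, ?_, ?_⟩,
    CompletedDouble.gr_mul_comm P hπ, UqSL2.isNoetherianRing P hπ,
    UqSL2.isNoetherianRing_op P hπ, UqSL2.norm_one_eq P hπ, UqSL2.norm_mul_eq P hπ⟩
  · rw [CompletedDouble.autE_C, Torus.scaleAut_const]
  · rw [CompletedDouble.autE_C, hE.1]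
  · rw [CompletedDouble.autE_C, hE.2]
  · rw [CompletedDouble.grEquiv_eq_iff, CompletedDouble.skewHom_C_C,
      CompletedDouble.torusHom_scalar]
    exact (resHom_res hc).unique (isSymbol_symbol _ _ _ _) rfl rfl
  · rw [CompletedDouble.grEquiv_eq_iff, CompletedDouble.skewHom_C_C, CompletedDouble.torusHom_pi]
    exact (CompletedDouble.isSymbol_grPi P hπ).unique (isSymbol_symbol _ _ _ _) rfl rfl
  · rw [CompletedDouble.grEquiv_eq_iff, CompletedDouble.skewHom_C_C, CompletedDouble.torusHom_K]
    exact (CompletedDouble.isSymbol_grK P).unique (isSymbol_symbol _ _ _ _) rfl rfl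
  · rw [CompletedDouble.grEquiv_eq_iff, CompletedDouble.skewHom_C_C, CompletedDouble.torusHom_Km]
    exact (CompletedDouble.isSymbol_grKm P).unique (isSymbol_symbol _ _ _ _) rfl rfl
  · rw [CompletedDouble.grEquiv_eq_iff, CompletedDouble.skewHom_C_X]
    exact (CompletedDouble.isSymbol_grF P).unique (isSymbol_symbol _ _ _ _) rfl rfl
  · rw [CompletedDouble.grEquiv_eq_iff, CompletedDouble.skewHom_X]
    exact (CompletedDouble.isSymbol_grE P).unique (isSymbol_symbol _ _ _ _) rfl rfl
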